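/- **Proposition.** Over $\mathbf{BISH}$ (constructive mathematics in the style of Bishop, that is, mathematics with intuitionistic logic in Aczel's constructive set theory $\mathbf{CZF}$ together with the axiom of dependent choice), the pointwise positivity property $\mathbf{POS}_p^{[0,1]}$ and the limited anti-Specker property $\mathbf{AS}_L^{[0,1]}$ are equivalent. In other words, the sentence $\mathbf{POS}_p^{[0,1]}\Leftrightarrow\mathbf{AS}_L^{[0,1]}$ is derivable in intuitionistic first-order logic with equality from the axioms of $\mathbf{CZF}$ and dependent choice. Here: - $\mathbf{POS}_p^{[0,1]}$ is the statement: if $f:[0,1]\to\mathbf{R}$ is pointwise continuous and positive-valued, and if $\inf_{[0,1]} f$ exists, then $\inf_{[0,1]} f>0$. (A real number $m$ is the infimum of $f$ if $m\leqslant f(x)$ for all $x\in[0,1]$ and for each rational $q>m$ there is $x\in[0,1]$ with $f(x)<q$.) - $\mathbf{AS}_L^{[0,1]}$ is the statement: if $[0,1]\cup\{\omega\}$ is a one-point extension of $[0,1]$, and $(x_n)$ is a sequence in $[0,1]\cup\{\omega\}$ that is eventually bounded away from each point of $[0,1]$, then there exists $n$ such that $x_n=\omega$. A one-point extension of $[0,1]$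 is given by a metric space $(E,\rho)$ that has $[0,1]$, with its usual metric, as a subspace, and a point $\omega\in E$ for which there is $\delta>0$ with $\rho(\omega,x)\geqslant\delta$ for all $x\in[0,1]$. The sequence $(x_n)$ is eventually bounded away from the point $x$ if there exist $N$ and $\delta>0$ such that $\rho(x,x_n)\geqslant\delta$ for all $n\geqslant N$. Real numbers are understood as located Dedekind cuts of rational numbers. -/

import Mathlib

/-!  Bishop-style constructive mathematics (BISH) as a formal theory: constructive Zermelo-Fraenkel
set theory CZF with the axiom of dependent choice, in intuitionistic first-order logic.
The real line, its unit interval, metric spaces, and the two principles to be compared are then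
written out as formulas of that theory. -/

namespace BISH

/-! ### Syntax -/

/-- Terms with free variables among `n` de Bruijn indices.  Besides variables there are symbols for
the empty set, the unordered pair, the union, the set of natural numbers, and for addition and
multiplication of natural numbers. -/
inductive Tm : ℕ → Type
  | var {n : ℕ} (i : Fin n) : Tm n
  | empty {n : ℕ} : Tm n
  | omega {n : ℕ} : Tm n
  | upair {n : ℕ} (a b : Tm n) : Tm n
  | union {n : ℕ} (a : Tm n) : Tm n
  | add {n : ℕ} (a b : Tm n) : Tm n
  | mul {n : ℕ} (a b : Tm n) : Tm n

/-- Formulas with free variables among `n` de Bruijn indices; `all` and `ex` bind index `0`. -/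
inductive Fml : ℕ → Type
  | mem {n : ℕ} (a b : Tm n) : Fml n
  | eq {n : ℕ} (a b : Tm n) : Fml n
  | bot {n : ℕ} : Fml n
  | and {n : ℕ} (φ ψ : Fml n) : Fml n
  | or {n : ℕ} (φ ψ : Fml n) : Fml n
  | imp {n : ℕ} (φ ψ : Fml n) : Fml n
  | all {n : ℕ} (φ : Fml (n + 1)) : Fml n
  | ex {n : ℕ} (φ : Fml (n + 1)) : Fml n

/-- Simultaneous substitution in a term. -/
def Tm.subst {n m : ℕ} (σ : Fin n → Tm m) : Tm n → Tm m
  | .var i => σ i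
  | .empty => .empty
  | .omega => .omega
  | .upair a b => .upair (a.subst σ) (b.subst σ)
  | .union a => .union (a.subst σ)
  | .add a b => .add (a.subst σ) (b.subst σ)
  | .mul a b => .mul (a.subst σ) (b.subst σ)

/-- Weakening of a term by one fresh variable (index `0`). -/
def Tm.lift {n : ℕ} (t : Tm n) : Tm (n + 1) := t.subst fun i => .var i.succ

/-- A substitution carried under a binder. -/
def up {n m : ℕ} (σ : Fin n → Tm m) : Fin (n + 1) → Tm (m + 1) :=
  Fin.cases (.var 0) fun i => (σ i).lift

/-- Simultaneous capture-avoiding substitution in a formula. -/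
def Fml.subst : {n m : ℕ} → (Fin n → Tm m) → Fml n → Fml m
  | _, _, σ, .mem a b => .mem (a.subst σ) (b.subst σ)
  | _, _, σ, .eq a b => .eq (a.subst σ) (b.subst σ)
  | _, _, _, .bot => .bot
  | _, _, σ, .and φ ψ => .and (φ.subst σ) (ψ.subst σ)
  | _, _, σ, .or φ ψ => .or (φ.subst σ) (ψ.subst σ)
  | _, _, σ, .imp φ ψ => .imp (φ.subst σ) (ψ.subst σ)
  | _, _, σ, .all φ => .all (φ.subst (up σ))
  | _, _, σ, .ex φ => .ex (φ.subst (up σ))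

/-- Weakening of a formula by one fresh variable. -/
def Fml.lift {n : ℕ} (φ : Fml n) : Fml (n + 1) := φ.subst fun i => .var i.succ

/-- `φ(t)`: the term `t` is substituted for the variable `0`. -/
def Fml.inst {n : ℕ} (φ : Fml (n + 1)) (t : Tm n) : Fml n := φ.subst (Fin.cases t .var)

/-- `φ(t)`, where `t` may involve `k` further variables bound meanwhile; the variables of `φ`
other than `0` are parameters. -/
def Fml.app₁ {n : ℕ} (k : ℕ) (φ : Fml (n + 1)) (t : Tm (n + k)) : Fml (n + k) :=
  φ.subst (Fin.cases t fun i => .var (i.addNat k))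

/-- `φ(s, t)`: `s` for the variable `0` and `t` for the variable `1`. -/
def Fml.app₂ {n : ℕ} (k : ℕ) (φ : Fml (n + 2)) (s t : Tm (n + k)) : Fml (n + k) :=
  φ.subst (Fin.cases s (Fin.cases t fun i => .var (i.addNat k)))

/-- `φ(s, t, u)`: `s`, `t`, `u` for the variables `0`, `1`, `2`. -/
def Fml.app₃ {n : ℕ} (k : ℕ) (φ : Fml (n + 3)) (s t u : Tm (n + k)) : Fml (n + k) :=
  φ.subst (Fin.cases s (Fin.cases t (Fin.cases u fun i => .var (i.addNat k))))

infix:60 " ∈ₛ " => Fml.mem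
infix:60 " =ₛ " => Fml.eq
infixr:45 " ⋏ " => Fml.and
infixr:40 " ⋎ " => Fml.or
infixr:35 " ⟹ " => Fml.imp

/-- Negation. -/
def neg {n : ℕ} (φ : Fml n) : Fml n := φ ⟹ .bot

/-- Equivalence. -/
def iff {n : ℕ} (φ ψ : Fml n) : Fml n := (φ ⟹ ψ) ⋏ (ψ ⟹ φ)

infix:30 " ⟺ " => iff

/-- `All fun x => φ x` is `∀ x, φ x`. -/
def All {n : ℕ} (F : Tm (n + 1) → Fml (n + 1)) : Fml n := .all (F (.var 0))

/-- `Ex fun x => φ x` is `∃ x, φ x`. -/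
def Ex {n : ℕ} (F : Tm (n + 1) → Fml (n + 1)) : Fml n := .ex (F (.var 0))

/-- `AllIn a fun x => φ x` is `∀ x ∈ a, φ x`. -/
def AllIn {n : ℕ} (a : Tm n) (F : Tm (n + 1) → Fml (n + 1)) : Fml n :=
  All fun x => x ∈ₛ a.lift ⟹ F x

/-- `ExIn a fun x => φ x` is `∃ x ∈ a, φ x`. -/
def ExIn {n : ℕ} (a : Tm n) (F : Tm (n + 1) → Fml (n + 1)) : Fml n :=
  Ex fun x => x ∈ₛ a.lift ⋏ F x

/-- Under a binder, the terms from outside are weakened silently. -/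
instance {n : ℕ} : Coe (Tm n) (Tm (n + 1)) := ⟨Tm.lift⟩

/-- Bounded formulas: all quantifiers have the form `∀ x ∈ t` or `∃ x ∈ t`. -/
inductive Fml.Bounded : {n : ℕ} → Fml n → Prop
  | mem {n : ℕ} (a b : Tm n) : Bounded (a ∈ₛ b)
  | eq {n : ℕ} (a b : Tm n) : Bounded (a =ₛ b)
  | bot {n : ℕ} : Bounded (.bot : Fml n)
  | and {n : ℕ} {φ ψ : Fml n} : Bounded φ → Bounded ψ → Bounded (φ ⋏ ψ)
  | or {n : ℕ} {φ ψ : Fml n} : Bounded φ → Bounded ψ → Bounded (φ ⋎ ψ)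
  | imp {n : ℕ} {φ ψ : Fml n} : Bounded φ → Bounded ψ → Bounded (φ ⟹ ψ)
  | all {n : ℕ} (t : Tm n) {φ : Fml (n + 1)} :
      Bounded φ → Bounded (.all (.var 0 ∈ₛ t.lift ⟹ φ))
  | ex {n : ℕ} (t : Tm n) {φ : Fml (n + 1)} :
      Bounded φ → Bounded (.ex (.var 0 ∈ₛ t.lift ⋏ φ))

/-! ### Elementary set-theoretic notions -/

/-- `a ∪ {a}`. -/
def succ {n : ℕ} (a : Tm n) : Tm n := .union (.upair a (.upair a a))

/-- The ordered pair `⟨a, b⟩ = {{a}, {a, b}}`. -/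
def opair {n : ℕ} (a b : Tm n) : Tm n := .upair (.upair a a) (.upair a b)

/-- `a ⊆ b`. -/
def SubsetOf {n : ℕ} (a b : Tm n) : Fml n := AllIn a fun x => x ∈ₛ b

/-- `f` is a function from the class `A` to the class `B`; a class is given by a formula in which
the variable `0` stands for the element. -/
def IsFun {n : ℕ} (f : Tm n) (A B : Fml (n + 1)) : Fml n :=
  (AllIn f fun z => Ex fun x => Ex fun y => A.app₁ 3 x ⋏ B.app₁ 3 y ⋏ z =ₛ opair x y) ⋏
  (All fun x => A ⟹ Ex fun y => opair x y ∈ₛ f ⋏ All fun y' => opair x y' ∈ₛ f ⟹ y' =ₛ y)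

/-! ### The axioms of CZF with dependent choice -/

/-- The axioms of CZF and dependent choice.  The formulas `φ` in the schemes and the terms may contain parameters. -/
inductive CZFDC : {n : ℕ} → Fml n → Prop
  | extensionality {n : ℕ} : CZFDC (n := n)
      (All fun a => All fun b => (All fun x => x ∈ₛ a ⟺ x ∈ₛ b) ⟹ a =ₛ b)
  | emptySet {n : ℕ} : CZFDC (n := n) (All fun x => neg (x ∈ₛ .empty))
  | pairing {n : ℕ} : CZFDC (n := n)
      (All fun a => All fun b => All fun x => x ∈ₛ .upair a b ⟺ (x =ₛ a ⋎ x =ₛ b))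
  | unionSet {n : ℕ} : CZFDC (n := n)
      (All fun a => All fun x => x ∈ₛ .union a ⟺ ExIn a fun y => x ∈ₛ y)
  | infinity {n : ℕ} : CZFDC (n := n)
      (All fun x => x ∈ₛ .omega ⟺ (x =ₛ .empty ⋎ ExIn .omega fun y => x =ₛ succ y))
  | add_zero {n : ℕ} : CZFDC (n := n) (AllIn .omega fun a => .add a .empty =ₛ a)
  | add_succ {n : ℕ} : CZFDC (n := n)
      (AllIn .omega fun a => AllIn .omega fun b => .add a (succ b) =ₛ succ (.add a b))
  | mul_zero {n : ℕ} : CZFDC (n := n) (AllIn .omega fun a => .mul a .empty =ₛ .empty)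
  | mul_succ {n : ℕ} : CZFDC (n := n)
      (AllIn .omega fun a => AllIn .omega fun b => .mul a (succ b) =ₛ .add (.mul a b) a)
  | setInduction {n : ℕ} (φ : Fml (n + 1)) : CZFDC
      ((All fun x => (AllIn x fun y => φ.app₁ 2 y) ⟹ φ.app₁ 1 x) ⟹ All fun x => φ.app₁ 1 x)
  | boundedSeparation {n : ℕ} (φ : Fml (n + 1)) (hφ : φ.Bounded) : CZFDC
      (All fun a => Ex fun b => All fun x => x ∈ₛ b ⟺ (x ∈ₛ a ⋏ φ.app₁ 3 x))
  | strongCollection {n : ℕ} (φ : Fml (n + 2)) : CZFDC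
      (All fun a => (AllIn a fun x => Ex fun y => φ.app₂ 3 x y) ⟹
        Ex fun b => (AllIn a fun x => ExIn b fun y => φ.app₂ 4 x y) ⋏
          (AllIn b fun y => ExIn a fun x => φ.app₂ 4 x y))
  | subsetCollection {n : ℕ} (φ : Fml (n + 3)) : CZFDC
      (All fun a => All fun b => Ex fun c => All fun u =>
        (AllIn a fun x => ExIn b fun y => φ.app₃ 6 x y u) ⟹
        ExIn c fun d => (AllIn a fun x => ExIn d fun y => φ.app₃ 7 x y u) ⋏
          (AllIn d fun y => ExIn a fun x => φ.app₃ 7 x y u))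
  | dependentChoice {n : ℕ} : CZFDC (n := n)
      (All fun a => All fun r => (AllIn a fun x => ExIn a fun y => opair x y ∈ₛ r) ⟹
        AllIn a fun b => Ex fun f => IsFun f (.var 0 ∈ₛ .omega) (.var 0 ∈ₛ a) ⋏
          opair .empty b ∈ₛ f ⋏
          AllIn .omega fun k => All fun x => All fun y =>
            opair k x ∈ₛ f ⟹ opair (succ k) y ∈ₛ f ⟹ opair x y ∈ₛ r)

/-! ### Derivability -/

/-- `Derives Γ φ`: natural deduction of intuitionistic first-order logic with equality, from the
hypotheses `Γ` and the axioms above. -/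
inductive Derives : {n : ℕ} → List (Fml n) → Fml n → Prop
  | ax {n : ℕ} {Γ : List (Fml n)} {φ : Fml n} : CZFDC φ → Derives Γ φ
  | hyp {n : ℕ} {Γ : List (Fml n)} {φ : Fml n} : φ ∈ Γ → Derives Γ φ
  | botE {n : ℕ} {Γ : List (Fml n)} {φ : Fml n} : Derives Γ .bot → Derives Γ φ
  | andI {n : ℕ} {Γ : List (Fml n)} {φ ψ : Fml n} :
      Derives Γ φ → Derives Γ ψ → Derives Γ (φ ⋏ ψ)
  | andE₁ {n : ℕ} {Γ : List (Fml n)} {φ ψ : Fml n} : Derives Γ (φ ⋏ ψ) → Derives Γ φ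
  | andE₂ {n : ℕ} {Γ : List (Fml n)} {φ ψ : Fml n} : Derives Γ (φ ⋏ ψ) → Derives Γ ψ
  | orI₁ {n : ℕ} {Γ : List (Fml n)} {φ ψ : Fml n} : Derives Γ φ → Derives Γ (φ ⋎ ψ)
  | orI₂ {n : ℕ} {Γ : List (Fml n)} {φ ψ : Fml n} : Derives Γ ψ → Derives Γ (φ ⋎ ψ)
  | orE {n : ℕ} {Γ : List (Fml n)} {φ ψ χ : Fml n} :
      Derives Γ (φ ⋎ ψ) → Derives (φ :: Γ) χ → Derives (ψ :: Γ) χ → Derives Γ χ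
  | impI {n : ℕ} {Γ : List (Fml n)} {φ ψ : Fml n} : Derives (φ :: Γ) ψ → Derives Γ (φ ⟹ ψ)
  | impE {n : ℕ} {Γ : List (Fml n)} {φ ψ : Fml n} :
      Derives Γ (φ ⟹ ψ) → Derives Γ φ → Derives Γ ψ
  | allI {n : ℕ} {Γ : List (Fml n)} {φ : Fml (n + 1)} :
      Derives (Γ.map Fml.lift) φ → Derives Γ (.all φ)
  | allE {n : ℕ} {Γ : List (Fml n)} {φ : Fml (n + 1)} (t : Tm n) :
      Derives Γ (.all φ) → Derives Γ (φ.inst t)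
  | exI {n : ℕ} {Γ : List (Fml n)} {φ : Fml (n + 1)} (t : Tm n) :
      Derives Γ (φ.inst t) → Derives Γ (.ex φ)
  | exE {n : ℕ} {Γ : List (Fml n)} {φ : Fml (n + 1)} {ψ : Fml n} :
      Derives Γ (.ex φ) → Derives (φ :: Γ.map Fml.lift) ψ.lift → Derives Γ ψ
  | eqRefl {n : ℕ} {Γ : List (Fml n)} (t : Tm n) : Derives Γ (t =ₛ t)
  | eqSubst {n : ℕ} {Γ : List (Fml n)} {s t : Tm n} (φ : Fml (n + 1)) :
      Derives Γ (s =ₛ t) → Derives Γ (φ.inst s) → Derives Γ (φ.inst t)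

/-- The sentence `φ` is a theorem of BISH. -/
def Provable (φ : Fml 0) : Prop := Derives [] φ

/-! ### Rational numbers

The triple `⟨⟨a, b⟩, c⟩` of natural numbers stands for the rational number `(a - b) / (c + 1)`. -/

/-- The code of `(a - b) / (c + 1)`. -/
def frac {n : ℕ} (a b c : Tm n) : Tm n := opair (opair a b) c

/-- The code of the rational number `0`. -/
def ratZero {n : ℕ} : Tm n := frac .empty .empty .empty

/-- The code of the rational number `1`. -/
def ratOne {n : ℕ} : Tm n := frac (succ .empty) .empty .empty

/-- `q` is (the code of) a rational number. -/
def IsRat {n : ℕ} (q : Tm n) : Fml n :=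
  ExIn .omega fun a => ExIn .omega fun b => ExIn .omega fun c => q =ₛ frac a b c

/-- `p < q` for rational numbers `p = (a - b) / (c + 1)` and `q = (a' - b') / (c' + 1)`; that is,
`a (c' + 1) + b' (c + 1) < a' (c + 1) + b (c' + 1)`. -/
def RatLt {n : ℕ} (p q : Tm n) : Fml n :=
  ExIn .omega fun a => ExIn .omega fun b => ExIn .omega fun c =>
  ExIn .omega fun a' => ExIn .omega fun b' => ExIn .omega fun c' =>
    p =ₛ frac a b c ⋏ q =ₛ frac a' b' c' ⋏
      .add (.mul a (succ c')) (.mul b' (succ c)) ∈ₛ .add (.mul a' (succ c)) (.mul b (succ c'))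

/-- `p + q = s` for rational numbers, where `s` is the code computed from those of `p` and `q`
with the product of the two denominators as denominator. -/
def RatAdd {n : ℕ} (p q s : Tm n) : Fml n :=
  ExIn .omega fun a => ExIn .omega fun b => ExIn .omega fun c =>
  ExIn .omega fun a' => ExIn .omega fun b' => ExIn .omega fun c' =>
    p =ₛ frac a b c ⋏ q =ₛ frac a' b' c' ⋏
      s =ₛ frac (.add (.mul a (succ c')) (.mul a' (succ c)))
        (.add (.mul b (succ c')) (.mul b' (succ c))) (.add (.mul c c') (.add c c'))

/-! ### Real numbers

A real number is a located Dedekind cut, given by its upper half: `q ∈ x` says `x < q`, so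
`q ∉ x` says `q ≤ x`. -/

/-- `x` is a real number: a set of rationals that is inhabited and not everything, open, upward
closed, and located. -/
def IsReal {n : ℕ} (x : Tm n) : Fml n :=
  (AllIn x fun q => IsRat q) ⋏
  (Ex fun q => q ∈ₛ x) ⋏
  (Ex fun p => IsRat p ⋏ neg (p ∈ₛ x)) ⋏
  (AllIn x fun q => ExIn x fun p => RatLt p q) ⋏
  (AllIn x fun p => All fun q => RatLt p q ⟹ q ∈ₛ x) ⋏
  (All fun p => All fun q => RatLt p q ⟹ (neg (p ∈ₛ x) ⋎ q ∈ₛ x))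

/-- `x ≤ y` for real numbers. -/
def RealLe {n : ℕ} (x y : Tm n) : Fml n := SubsetOf y x

/-- The real number `x` is positive: `q ≤ x` for some rational `q > 0`. -/
def RealPos {n : ℕ} (x : Tm n) : Fml n := Ex fun q => RatLt ratZero q ⋏ neg (q ∈ₛ x)

/-- `|x - y| < r` for real numbers `x`, `y` and a rational number `r`: there is a rational `p` with
`p ≤ x < p + r` and `p ≤ y < p + r`. -/
def AbsSubLt {n : ℕ} (x y r : Tm n) : Fml n :=
  Ex fun p => Ex fun s => RatAdd p r s ⋏ neg (p ∈ₛ x) ⋏ neg (p ∈ₛ y) ⋏ s ∈ₛ x ⋏ s ∈ₛ y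

/-- `x ∈ [0,1]`. -/
def InUnit {n : ℕ} (x : Tm n) : Fml n :=
  IsReal x ⋏ neg (ratZero ∈ₛ x) ⋏ All fun q => RatLt ratOne q ⟹ q ∈ₛ x

/-! ### The pointwise positivity property of `[0,1]` -/

/-- The function `f` on `[0,1]` is pointwise continuous. -/
def PtwiseContinuous {n : ℕ} (f : Tm n) : Fml n :=
  All fun x => InUnit x ⟹ All fun ε => RatLt ratZero ε ⟹ Ex fun δ => RatLt ratZero δ ⋏
    All fun y => InUnit y ⟹ AbsSubLt x y δ ⟹
      All fun u => All fun v => opair x u ∈ₛ f ⟹ opair y v ∈ₛ f ⟹ AbsSubLt u v ε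

/-- The function `f` is positive-valued. -/
def PosValued {n : ℕ} (f : Tm n) : Fml n :=
  All fun x => All fun u => opair x u ∈ₛ f ⟹ RealPos u

/-- The real number `m` is the infimum of `f`: it is a lower bound, and each rational number
greater than `m` is greater than some value of `f`. -/
def IsInf {n : ℕ} (f m : Tm n) : Fml n :=
  IsReal m ⋏ (All fun x => All fun u => opair x u ∈ₛ f ⟹ RealLe m u) ⋏
    AllIn m fun q => Ex fun x => Ex fun u => opair x u ∈ₛ f ⋏ q ∈ₛ u

/-- `POS_p^[0,1]`: if `f : [0,1] → ℝ` is pointwise continuous and positive-valued and has an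
infimum, then this infimum is positive. -/
def POSp : Fml 0 :=
  All fun f => IsFun f (InUnit (.var 0)) (IsReal (.var 0)) ⟹ PtwiseContinuous f ⟹ PosValued f ⟹
    All fun m => IsInf f m ⟹ RealPos m

/-! ### The limited anti-Specker property of `[0,1]` -/

/-- `z` is an ordered pair of elements of `E`. -/
def InSquare {n : ℕ} (E z : Tm n) : Fml n := ExIn E fun a => ExIn E fun b => z =ₛ opair a b

/-- `ρ` is a metric on the set `E`: a function `E × E → ℝ` with `ρ(a, b) ≥ 0`, and
`ρ(a, b) = 0` exactly if `a = b`, that is symmetric and satisfies the triangle inequality. -/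
def IsMetric {n : ℕ} (E ρ : Tm n) : Fml n :=
  IsFun ρ (InSquare E (.var 0)) (IsReal (.var 0)) ⋏
  (All fun a => All fun b => All fun d => opair (opair a b) d ∈ₛ ρ ⟹
    (neg (ratZero ∈ₛ d) ⋏
      ((All fun q => RatLt ratZero q ⟹ q ∈ₛ d) ⟺ a =ₛ b) ⋏
      opair (opair b a) d ∈ₛ ρ)) ⋏
  (All fun a => All fun b => All fun c => All fun d => All fun d' => All fun d'' =>
    opair (opair a b) d ∈ₛ ρ ⟹ opair (opair b c) d' ∈ₛ ρ ⟹ opair (opair a c) d'' ∈ₛ ρ ⟹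
      AllIn d fun p => AllIn d' fun q => All fun s => RatAdd p q s ⟹ s ∈ₛ d'')

/-- `[0,1]`, with its usual metric, is a subspace of the metric space `(E, ρ)`. -/
def UnitSubspace {n : ℕ} (E ρ : Tm n) : Fml n :=
  (All fun x => InUnit x ⟹ x ∈ₛ E) ⋏
  (All fun x => All fun y => All fun d => InUnit x ⟹ InUnit y ⟹ opair (opair x y) d ∈ₛ ρ ⟹
    All fun r => IsRat r ⟹ (r ∈ₛ d ⟺ AbsSubLt x y r))

/-- `w` is a point of `E` with `ρ(w, [0,1]) > 0`: there is `δ > 0` with `ρ(w, x) ≥ δ` for all `x`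
in `[0,1]`. -/
def IsExtraPoint {n : ℕ} (E ρ w : Tm n) : Fml n :=
  w ∈ₛ E ⋏ Ex fun δ => RatLt ratZero δ ⋏
    All fun x => All fun d => InUnit x ⟹ opair (opair w x) d ∈ₛ ρ ⟹ neg (δ ∈ₛ d)

/-- The sequence `s` in `(E, ρ)` is eventually bounded away from the point `x`: there are `N` and
`δ > 0` such that `ρ(x, s_k) ≥ δ` for all `k ≥ N`. -/
def EventuallyAway {n : ℕ} (ρ s x : Tm n) : Fml n :=
  ExIn .omega fun N => Ex fun δ => RatLt ratZero δ ⋏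
    AllIn .omega fun k => (N =ₛ k ⋎ N ∈ₛ k) ⟹
      All fun z => All fun d => opair k z ∈ₛ s ⟹ opair (opair x z) d ∈ₛ ρ ⟹ neg (δ ∈ₛ d)

/-- `AS_L^[0,1]`: if `[0,1] ∪ {w}` is a one-point extension of `[0,1]` and `s` a sequence in it
that is eventually bounded away from each point of `[0,1]`, then some term of `s` is `w`. -/
def ASL : Fml 0 :=
  All fun E => All fun ρ => All fun w =>
    IsMetric E ρ ⟹ UnitSubspace E ρ ⟹ IsExtraPoint E ρ w ⟹
    All fun s => IsFun s (.var 0 ∈ₛ .omega) (InUnit (.var 0) ⋎ .var 0 =ₛ (w : Tm 4)) ⟹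
      (All fun x => InUnit x ⟹ EventuallyAway ρ s x) ⟹
      ExIn .omega fun k => opair k w ∈ₛ s

end BISH

namespace BISH

/-! ### Substitution -/

/-! Derivability is established semantically, by a completeness theorem. The points of a topological
space are the consistent, deductively closed, prime theories with existential witnesses, in the
language enriched by countably many constants; a basic neighbourhood fixes finitely many members of
the theory. A formula holds at a point if it belongs to it. Disjunction and existence are then
evaluated at the point itself, implication and universal quantification on a neighbourhood
(`sat_imp`, `sat_all`), and a sentence that holds at all points is derivable (`provable_of_sat`). An
intuitionistic proof becomes an ordinary argument about what happens near a point. There, ω is a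
discretely ordered semiring, the rational numbers are its ordered field of fractions `K x`, and real
numbers are located cuts. Equality and order of rational numbers persist to a neighbourhood, so case
distinctions on them are harmless. Induction and the formation of sets are available only for
formulas of the theory, which is why searches and cuts are spelled out as formulas.

Positivity implies anti-Specker: given a sequence s, let f(z) be the minimum of 1 and the infimum of
max(1/(n+1), (n+1)|z - s n|) over the n for which s 0, ..., s n all differ from ω. Since s is
eventually bounded away from z, near z all but finitely many terms exceed 1 (`Seq.tail`). Hence f(z)
exists as a real number, f is continuous and f(z) > 0. As f(s n) ≤ 1/(n+1), the infimum of f is the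
minimum of 1 and of the numbers 1/(n+1) for the same n; it exists because a finite search tells
whether ω occurs up to a given index (`Seq.before_or`). If the infimum exceeds 1/(N+1), then ω must
occur among s 0, ..., s N (`Seq.exists_mem`).

Anti-Specker implies positivity: adjoin ω = 2 to [0,1] with the metric of the real line. Let m be
the infimum of f. By locatedness and countable choice there are t k such that either t k is in [0,1]
and f(t k) < 1/(k+1), or t k = 2 and 1/(k+2) ≤ m. By continuity and positivity of f, this sequence
is eventually bounded away from every point of [0,1]. So some t k is 2, and m > 0
(`posAt_of_sat_ASL`).

That [0,1] is a set is obtained by bounded separation, from the space E in one direction and from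
the domain of f in the other. -/

theorem Tm.subst_subst {n m k : ℕ} (σ : Fin n → Tm m) (τ : Fin m → Tm k) (t : Tm n) :
    (t.subst σ).subst τ = t.subst fun i => (σ i).subst τ := by
  induction t <;> simp_all [Tm.subst]

theorem Tm.subst_var {n : ℕ} (t : Tm n) : t.subst .var = t := by
  induction t <;> simp_all [Tm.subst]

theorem Tm.lift_subst {n m : ℕ} (t : Tm n) (τ : Fin (n + 1) → Tm m) :
    t.lift.subst τ = t.subst fun i => τ i.succ := by
  simp [Tm.lift, Tm.subst_subst, Tm.subst]

theorem Tm.lift_subst_up {n m : ℕ} (t : Tm n) (σ : Fin n → Tm m) :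
    t.lift.subst (up σ) = (t.subst σ).lift := by
  rw [Tm.lift_subst, Tm.lift, Tm.subst_subst]; rfl

theorem up_var {n : ℕ} : up (Tm.var (n := n)) = Tm.var := by
  funext i; refine Fin.cases rfl (fun i => rfl) i

theorem up_comp {n m k : ℕ} (σ : Fin n → Tm m) (τ : Fin m → Tm k) :
    (fun i => (up σ i).subst (up τ)) = up fun i => (σ i).subst τ := by
  funext i
  refine Fin.cases rfl (fun i => ?_) i
  exact Tm.lift_subst_up _ _

theorem Fml.subst_subst {n m k : ℕ} (σ : Fin n → Tm m) (τ : Fin m → Tm k) (φ : Fml n) :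
    (φ.subst σ).subst τ = φ.subst fun i => (σ i).subst τ := by
  induction φ generalizing m k <;> simp_all [Fml.subst, Tm.subst_subst, up_comp]

theorem Fml.subst_var {n : ℕ} (φ : Fml n) : φ.subst .var = φ := by
  induction φ <;> simp_all [Fml.subst, Tm.subst_var, up_var]

theorem Fml.lift_subst {n m : ℕ} (φ : Fml n) (τ : Fin (n + 1) → Tm m) :
    φ.lift.subst τ = φ.subst fun i => τ i.succ := by
  simp [Fml.lift, Fml.subst_subst, Tm.subst]

theorem Fml.lift_subst_up {n m : ℕ} (φ : Fml n) (σ : Fin n → Tm m) :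
    φ.lift.subst (up σ) = (φ.subst σ).lift := by
  rw [Fml.lift_subst, Fml.lift, Fml.subst_subst]; rfl

theorem Fml.inst_subst {n m : ℕ} (φ : Fml (n + 1)) (t : Tm n) (σ : Fin n → Tm m) :
    (φ.inst t).subst σ = (φ.subst (up σ)).inst (t.subst σ) := by
  simp only [Fml.inst, Fml.subst_subst]
  congr 1; funext i
  refine Fin.cases rfl (fun i => ?_) i
  simp [Tm.subst, up, Tm.lift_subst, Tm.subst_var]

theorem Fml.Bounded.subst {n : ℕ} {φ : Fml n} (h : φ.Bounded) {m : ℕ} (σ : Fin n → Tm m) :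
    (φ.subst σ).Bounded := by
  induction h generalizing m with
  | mem => exact .mem _ _
  | eq => exact .eq _ _
  | bot => exact .bot
  | and _ _ ih₁ ih₂ => exact .and (ih₁ σ) (ih₂ σ)
  | or _ _ ih₁ ih₂ => exact .or (ih₁ σ) (ih₂ σ)
  | imp _ _ ih₁ ih₂ => exact .imp (ih₁ σ) (ih₂ σ)
  | all t _ ih =>
    simp only [Fml.subst, Tm.lift_subst_up]
    exact .all _ (ih _)
  | ex t _ ih =>
    simp only [Fml.subst, Tm.lift_subst_up]
    exact .ex _ (ih _)

/-- A substitution carried under `k` binders. -/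
def upN {n m : ℕ} (σ : Fin n → Tm m) : (k : ℕ) → Fin (n + k) → Tm (m + k)
  | 0 => σ
  | k + 1 => up (upN σ k)

theorem upN_addNat {n m : ℕ} (σ : Fin n → Tm m) (k : ℕ) (i : Fin n) :
    upN σ k (i.addNat k) = (σ i).subst fun j => .var (j.addNat k) := by
  induction k with
  | zero => exact (Tm.subst_var _).symm
  | succ k ih =>
    change (upN σ k (i.addNat k)).lift = _
    rw [ih, Tm.lift, Tm.subst_subst]; rfl

/-- The schemes quote φ below k binders. This rule and its analogues for two and three arguments
show that a substitution turns an instance of a scheme into the instance for the substituted φ. -/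
theorem Fml.app₁_subst {n m : ℕ} (k : ℕ) (φ : Fml (n + 1)) (t : Tm (n + k)) (σ : Fin n → Tm m) :
    (φ.app₁ k t).subst (upN σ k) = (φ.subst (up σ)).app₁ k (t.subst (upN σ k)) := by
  simp only [Fml.app₁, Fml.subst_subst]
  congr 1; funext i
  refine Fin.cases rfl (fun i => ?_) i
  simp [Tm.subst, up, Tm.lift_subst, upN_addNat]

theorem Fml.app₂_subst {n m : ℕ} (k : ℕ) (φ : Fml (n + 2)) (s t : Tm (n + k)) (σ : Fin n → Tm m) :
    (φ.app₂ k s t).subst (upN σ k) =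
      (φ.subst (up (up σ))).app₂ k (s.subst (upN σ k)) (t.subst (upN σ k)) := by
  simp only [Fml.app₂, Fml.subst_subst]
  congr 1; funext i
  refine Fin.cases rfl (fun i => Fin.cases rfl (fun i => ?_) i) i
  simp [Tm.subst, up, Tm.lift_subst, upN_addNat]

theorem Fml.app₃_subst {n m : ℕ} (k : ℕ) (φ : Fml (n + 3)) (s t u : Tm (n + k))
    (σ : Fin n → Tm m) :
    (φ.app₃ k s t u).subst (upN σ k) = (φ.subst (up (up (up σ)))).app₃ k
      (s.subst (upN σ k)) (t.subst (upN σ k)) (u.subst (upN σ k)) := by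
  simp only [Fml.app₃, Fml.subst_subst]
  congr 1; funext i
  refine Fin.cases rfl (fun i => Fin.cases rfl (fun i => Fin.cases rfl (fun i => ?_) i) i) i
  simp [Tm.subst, up, Tm.lift_subst, upN_addNat]

theorem CZFDC.subst {n m : ℕ} {φ : Fml n} (h : CZFDC φ) (σ : Fin n → Tm m) :
    CZFDC (φ.subst σ) := by
  cases h with
  -- The axioms that are not schemes have no free variables, so substitution computes to the same
  -- axiom.
  | extensionality => exact .extensionality
  | emptySet => exact .emptySet
  | pairing => exact .pairing
  | unionSet => exact .unionSet
  | infinity => exact .infinity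
  | add_zero => exact .add_zero
  | add_succ => exact .add_succ
  | mul_zero => exact .mul_zero
  | mul_succ => exact .mul_succ
  | setInduction φ =>
    have h := CZFDC.setInduction (φ.subst (up σ))
    have e₁ := Fml.app₁_subst 1 φ (.var 0) σ
    have e₂ := Fml.app₁_subst 2 φ (.var 0) σ
    simp only [upN] at e₁ e₂
    simp only [All, AllIn, Fml.subst, e₁, e₂]
    exact h
  | boundedSeparation φ hφ =>
    have h := CZFDC.boundedSeparation (φ.subst (up σ)) (hφ.subst _)
    have e₁ := Fml.app₁_subst 3 φ (.var 0) σ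
    simp only [upN] at e₁
    simp only [All, Ex, iff, Fml.subst, e₁]
    exact h
  | strongCollection φ =>
    have h := CZFDC.strongCollection (φ.subst (up (up σ)))
    have e₁ := fun s t => Fml.app₂_subst 3 φ s t σ
    have e₂ := fun s t => Fml.app₂_subst 4 φ s t σ
    simp only [upN] at e₁ e₂
    simp only [All, Ex, AllIn, ExIn, Fml.subst, e₁, e₂]
    exact h
  | subsetCollection φ =>
    have h := CZFDC.subsetCollection (φ.subst (up (up (up σ))))
    have e₁ := fun s t u => Fml.app₃_subst 6 φ s t u σ
    have e₂ := fun s t u => Fml.app₃_subst 7 φ s t u σ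
    simp only [upN] at e₁ e₂
    simp only [All, Ex, AllIn, ExIn, Fml.subst, e₁, e₂]
    exact h
  | dependentChoice => exact .dependentChoice

/-- Derivations are preserved by substitution and by weakening. -/
theorem Derives.subst {n : ℕ} {Γ : List (Fml n)} {φ : Fml n} (h : Derives Γ φ) {m : ℕ}
    (σ : Fin n → Tm m) {Δ : List (Fml m)} (hΔ : ∀ γ ∈ Γ, γ.subst σ ∈ Δ) :
    Derives Δ (φ.subst σ) := by
  have cons : ∀ {n m : ℕ} {σ : Fin n → Tm m} {Γ : List (Fml n)} {Δ : List (Fml m)} (φ : Fml n),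
      (∀ γ ∈ Γ, γ.subst σ ∈ Δ) → ∀ γ ∈ φ :: Γ, γ.subst σ ∈ φ.subst σ :: Δ := by
    intro n m σ Γ Δ φ h γ hγ
    rcases List.mem_cons.1 hγ with rfl | hγ
    · exact List.mem_cons_self
    · exact List.mem_cons_of_mem _ (h _ hγ)
  have lift : ∀ {n m : ℕ} {σ : Fin n → Tm m} {Γ : List (Fml n)} {Δ : List (Fml m)},
      (∀ γ ∈ Γ, γ.subst σ ∈ Δ) → ∀ γ ∈ Γ.map Fml.lift, γ.subst (up σ) ∈ Δ.map Fml.lift := by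
    intro n m σ Γ Δ h γ hγ
    obtain ⟨γ, hγ', rfl⟩ := List.mem_map.1 hγ
    rw [Fml.lift_subst_up]
    exact List.mem_map_of_mem (h _ hγ')
  induction h generalizing m with
  | ax h => exact .ax (h.subst σ)
  | hyp h => exact .hyp (hΔ _ h)
  | botE _ ih => exact .botE (ih σ hΔ)
  | andI _ _ ih₁ ih₂ => exact .andI (ih₁ σ hΔ) (ih₂ σ hΔ)
  | andE₁ _ ih => exact .andE₁ (ih σ hΔ)
  | andE₂ _ ih => exact .andE₂ (ih σ hΔ)
  | orI₁ _ ih => exact .orI₁ (ih σ hΔ)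
  | orI₂ _ ih => exact .orI₂ (ih σ hΔ)
  | orE _ _ _ ih ih₁ ih₂ => exact .orE (ih σ hΔ) (ih₁ σ (cons _ hΔ)) (ih₂ σ (cons _ hΔ))
  | impI _ ih => exact .impI (ih σ (cons _ hΔ))
  | impE _ _ ih₁ ih₂ => exact .impE (ih₁ σ hΔ) (ih₂ σ hΔ)
  | allI _ ih => exact .allI (ih (up σ) (lift hΔ))
  | allE t _ ih =>
    rw [Fml.inst_subst]
    exact .allE _ (ih σ hΔ)
  | exI t _ ih =>
    refine .exI (t.subst σ) ?_
    rw [← Fml.inst_subst]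
    exact ih σ hΔ
  | exE _ _ ih₁ ih₂ =>
    refine .exE (ih₁ σ hΔ) ?_
    rw [← Fml.lift_subst_up]
    exact ih₂ (up σ) (cons _ (lift hΔ))
  | eqRefl t => exact .eqRefl _
  | eqSubst φ _ _ ih₁ ih₂ =>
    rw [Fml.inst_subst]
    refine .eqSubst _ (ih₁ σ hΔ) ?_
    rw [← Fml.inst_subst]
    exact ih₂ σ hΔ

theorem Derives.weaken {n : ℕ} {Γ Δ : List (Fml n)} {φ : Fml n} (h : Derives Γ φ) (hΔ : Γ ⊆ Δ) :
    Derives Δ φ := by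
  simpa [Fml.subst_var] using h.subst (.var) (Δ := Δ) fun γ hγ => by
    simpa [Fml.subst_var] using hΔ hγ

end BISH

/-! ### Completeness: prime saturated theories as points -/

namespace BISH
open Filter Topology

/-! ### Countability of the syntax -/

/-- The objects of the canonical model: closed terms over constants numbered by `ℕ`. -/
inductive Obj : Type
  | const (i : ℕ)
  | empty
  | omega
  | upair (a b : Obj)
  | union (a : Obj)
  | add (a b : Obj)
  | mul (a b : Obj)

/-- An injective numbering of objects. -/
def Obj.code : Obj → ℕ
  | .const i => Nat.pair 0 i
  | .empty => Nat.pair 1 0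
  | .omega => Nat.pair 2 0
  | .upair a b => Nat.pair 3 (Nat.pair a.code b.code)
  | .union a => Nat.pair 4 a.code
  | .add a b => Nat.pair 5 (Nat.pair a.code b.code)
  | .mul a b => Nat.pair 6 (Nat.pair a.code b.code)

theorem Obj.code_injective : Function.Injective Obj.code := by
  intro a b h
  induction a generalizing b <;> cases b <;> simp_all [Obj.code, Nat.pair_eq_pair] <;> grind

instance : Countable Obj := Obj.code_injective.countable

/-- An injective numbering of terms. -/
def Tm.code {n : ℕ} : Tm n → ℕ
  | .var i => Nat.pair 0 i
  | .empty => Nat.pair 1 0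
  | .omega => Nat.pair 2 0
  | .upair a b => Nat.pair 3 (Nat.pair a.code b.code)
  | .union a => Nat.pair 4 a.code
  | .add a b => Nat.pair 5 (Nat.pair a.code b.code)
  | .mul a b => Nat.pair 6 (Nat.pair a.code b.code)

theorem Tm.code_injective {n : ℕ} : Function.Injective (Tm.code (n := n)) := by
  intro a b h
  induction a generalizing b <;> cases b <;> simp only [Tm.code, Nat.pair_eq_pair] at h <;> grind

/-- An injective numbering of formulas. -/
def Fml.code : {n : ℕ} → Fml n → ℕ
  | _, .mem a b => Nat.pair 0 (Nat.pair a.code b.code)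
  | _, .eq a b => Nat.pair 1 (Nat.pair a.code b.code)
  | _, .bot => Nat.pair 2 0
  | _, .and φ ψ => Nat.pair 3 (Nat.pair φ.code ψ.code)
  | _, .or φ ψ => Nat.pair 4 (Nat.pair φ.code ψ.code)
  | _, .imp φ ψ => Nat.pair 5 (Nat.pair φ.code ψ.code)
  | _, .all φ => Nat.pair 6 φ.code
  | _, .ex φ => Nat.pair 7 φ.code

theorem Fml.code_injective {n : ℕ} : Function.Injective (Fml.code (n := n)) := by
  intro a b h
  induction a <;> cases b <;>
    simp_all [Fml.code, Nat.pair_eq_pair, Tm.code_injective.eq_iff] <;> grind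

instance {n : ℕ} : Countable (Fml n) := Fml.code_injective.countable

/-! ### Formulas about objects -/

/-- The value of a term. -/
def Tm.eval {n : ℕ} (v : Fin n → Obj) : Tm n → Obj
  | .var i => v i
  | .empty => .empty
  | .omega => .omega
  | .upair a b => .upair (a.eval v) (b.eval v)
  | .union a => .union (a.eval v)
  | .add a b => .add (a.eval v) (b.eval v)
  | .mul a b => .mul (a.eval v) (b.eval v)

/-- The objects with constants below `N` as terms in `N` variables. -/
def Obj.toTm (N : ℕ) : Obj → Tm N
  -- The value for large constants is arbitrary: entailment looks only at sufficiently large N.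
  | .const i => if h : i < N then .var ⟨i, h⟩ else .empty
  | .empty => .empty
  | .omega => .omega
  | .upair a b => .upair (a.toTm N) (b.toTm N)
  | .union a => .union (a.toTm N)
  | .add a b => .add (a.toTm N) (b.toTm N)
  | .mul a b => .mul (a.toTm N) (b.toTm N)

/-- A strict bound for the constants of an object. -/
def Obj.bound : Obj → ℕ
  | .const i => i + 1
  | .empty => 0
  | .omega => 0
  | .upair a b => max a.bound b.bound
  | .union a => a.bound
  | .add a b => max a.bound b.bound
  | .mul a b => max a.bound b.bound

theorem Tm.eval_subst {n m : ℕ} (σ : Fin n → Tm m) (v : Fin m → Obj) (t : Tm n) :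
    (t.subst σ).eval v = t.eval fun i => (σ i).eval v := by
  induction t <;> simp_all [Tm.subst, Tm.eval]

theorem Tm.toTm_eval {n : ℕ} (N : ℕ) (v : Fin n → Obj) (t : Tm n) :
    (t.eval v).toTm N = t.subst fun i => (v i).toTm N := by
  induction t <;> simp_all [Tm.subst, Tm.eval, Obj.toTm]

infixr:67 " ∷ " => Matrix.vecCons

/-- A formula with objects for its free variables. -/
structure Claim where
  n : ℕ
  fml : Fml n
  env : Fin n → Obj

/-- Countability allows a theory to be built that meets a requirement for each claim. -/
instance : Countable Claim :=
  Function.Injective.countable (β := Σ n, Fml n × (Fin n → Obj))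
    (f := fun c => ⟨c.n, c.fml, c.env⟩) fun ⟨_, _, _⟩ ⟨_, _, _⟩ h => by cases h; rfl

/-- The claim as a formula in `N` variables. -/
def Claim.close (N : ℕ) (c : Claim) : Fml N := c.fml.subst fun i => (c.env i).toTm N

/-- A strict bound for the constants of a claim. -/
def Claim.bound (c : Claim) : ℕ := Finset.univ.sup fun i => (c.env i).bound

theorem close_subst {n m : ℕ} (N : ℕ) (φ : Fml n) (σ : Fin n → Tm m) (v : Fin m → Obj) :
    Claim.close N ⟨m, φ.subst σ, v⟩ = Claim.close N ⟨n, φ, fun i => (σ i).eval v⟩ := by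
  simp [Claim.close, Fml.subst_subst, Tm.toTm_eval]

theorem close_cons {n : ℕ} (N : ℕ) (φ : Fml (n + 1)) (d : Obj) (v : Fin n → Obj) :
    Claim.close N ⟨n + 1, φ, d ∷ v⟩ =
      (φ.subst (up fun i => (v i).toTm N)).inst (d.toTm N) := by
  simp only [Claim.close, Fml.inst, Fml.subst_subst]
  congr 1; funext i
  refine Fin.cases rfl (fun i => ?_) i
  simp [up, Tm.lift_subst, Tm.subst_var]

/-- The substitution that makes the variable `c` the variable `0` and weakens all others. -/
def swapOut {N : ℕ} (c : ℕ) (i : Fin N) : Tm (N + 1) := if i.1 = c then .var 0 else .var i.succ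

theorem Obj.toTm_swapOut {N c : ℕ} (d : Obj) (h : d.bound ≤ c) :
    (d.toTm N).subst (swapOut c) = (d.toTm N).lift := by
  induction d with
  | const i =>
    simp only [Obj.toTm, Obj.bound] at *
    split_ifs
    · simp [Tm.subst, Tm.lift, swapOut, show i ≠ c by omega]
    · rfl
  | _ => simp_all [Tm.subst, Tm.lift, Obj.toTm, Obj.bound]

theorem Claim.close_swapOut {N c : ℕ} (γ : Claim) (h : γ.bound ≤ c) :
    (γ.close N).subst (swapOut c) = (γ.close N).lift := by
  simp only [Claim.close, Fml.lift, Fml.subst_subst]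
  congr 1; funext i
  exact Obj.toTm_swapOut _
    ((Finset.le_sup (f := fun i => (γ.env i).bound) (Finset.mem_univ i)).trans h)

/-- If the parameters do not contain the constant c, then c behaves as a variable and can be made
the bound one. This is the eigenvariable condition in the language with constants. -/
theorem close_const_swapOut {n N c : ℕ} (φ : Fml (n + 1)) (v : Fin n → Obj) (hN : c < N)
    (h : ∀ i, (v i).bound ≤ c) :
    (Claim.close N ⟨n + 1, φ, .const c ∷ v⟩).subst (swapOut c) =
      φ.subst (up fun i => (v i).toTm N) := by
  simp only [Claim.close, Fml.subst_subst]
  congr 1; funext i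
  refine Fin.cases ?_ (fun i => ?_) i
  · simp [Obj.toTm, hN, Tm.subst, swapOut, up]
  · simpa [up] using Obj.toTm_swapOut _ (h i)

/-! ### Entailment between claims -/

/-- The claim `ψ` is derivable from the claims in `Γ`. -/
def Ent (Γ : Finset Claim) (ψ : Claim) : Prop :=
  -- Quantifying over all lists that contain the hypotheses absorbs weakening and the order of a
  -- list.
  ∀ᶠ N in atTop, ∀ Δ : List (Fml N), (∀ γ ∈ Γ, γ.close N ∈ Δ) → Derives Δ (ψ.close N)

open Classical in
section

variable {Γ Δ : Finset Claim} {χ ψ : Claim}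

theorem Ent.hyp (h : ψ ∈ Γ) : Ent Γ ψ := .of_forall fun _ _ hΔ => .hyp (hΔ _ h)

theorem Ent.mono (h : Ent Γ ψ) (hΔ : Γ ⊆ Δ) : Ent Δ ψ :=
  Eventually.mono h fun _ h Θ hΘ => h Θ fun γ hγ => hΘ γ (hΔ hγ)

theorem Ent.insert_left (h : Ent (insert χ Γ) ψ) : ∀ᶠ N in atTop, ∀ Δ : List (Fml N),
    (∀ γ ∈ Γ, γ.close N ∈ Δ) → Derives (χ.close N :: Δ) (ψ.close N) := by
  filter_upwards [h] with N h Δ hΔ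
  refine h _ fun γ hγ => ?_
  rcases Finset.mem_insert.1 hγ with rfl | hγ
  · exact List.mem_cons_self
  · exact List.mem_cons_of_mem _ (hΔ _ hγ)

theorem Ent.cut (h : Ent Γ χ) (h' : Ent (insert χ Γ) ψ) : Ent Γ ψ := by
  filter_upwards [h, h'.insert_left] with N h h' Δ hΔ
  exact .impE (.impI (h' _ hΔ)) (h _ hΔ)

theorem Ent.imp_intro {n : ℕ} {φ ψ : Fml n}
    {v : Fin n → Obj} (h : Ent (insert ⟨n, φ, v⟩ Γ) ⟨n, ψ, v⟩) :
    Ent Γ ⟨n, φ ⟹ ψ, v⟩ := by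
  filter_upwards [h.insert_left] with N h Δ hΔ
  exact .impI (h _ hΔ)

theorem Ent.or_elim {n : ℕ} {φ φ' : Fml n} {v : Fin n → Obj} (h : Ent (insert ⟨n, φ, v⟩ Γ) ψ)
    (h' : Ent (insert ⟨n, φ', v⟩ Γ) ψ) : Ent (insert ⟨n, φ ⋎ φ', v⟩ Γ) ψ := by
  filter_upwards [h.insert_left, h'.insert_left] with N h h' Δ hΔ
  have hΔ' : ∀ γ ∈ Γ, γ.close N ∈ Δ := fun γ hγ => hΔ γ (Finset.mem_insert_of_mem hγ)
  exact .orE (.hyp (hΔ _ (Finset.mem_insert_self _ _))) (h _ hΔ') (h' _ hΔ')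

/-- Generalisation on constants: c occurs neither in Γ nor in v, so `swapOut c` turns a derivation
about c into one about a fresh variable while merely weakening everything else. -/
theorem Ent.all_intro {n c : ℕ} {φ : Fml (n + 1)} {v : Fin n → Obj} (hΓ : ∀ γ ∈ Γ, γ.bound ≤ c)
    (hv : ∀ i, (v i).bound ≤ c) (h : Ent Γ ⟨n + 1, φ, .const c ∷ v⟩) : Ent Γ ⟨n, .all φ, v⟩ := by
  filter_upwards [h, eventually_gt_atTop c] with N h hN Δ hΔ
  have h₁ := (h (Γ.toList.map (Claim.close N))
    fun γ hγ => List.mem_map_of_mem (Finset.mem_toList.2 hγ)).subst (swapOut c)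
    (Δ := Δ.map Fml.lift) fun γ hγ => by
      obtain ⟨γ, hγ', rfl⟩ := List.mem_map.1 hγ
      have hγ' := Finset.mem_toList.1 hγ'
      rw [Claim.close_swapOut _ (hΓ _ hγ')]
      exact List.mem_map_of_mem (hΔ _ hγ')
  rw [close_const_swapOut _ _ hN hv] at h₁
  exact .allI h₁

theorem Ent.ex_elim {n c : ℕ} {φ : Fml (n + 1)} {v : Fin n → Obj} (hΓ : ∀ γ ∈ Γ, γ.bound ≤ c)
    (hv : ∀ i, (v i).bound ≤ c) (hψ : ψ.bound ≤ c)
    (h : Ent (insert ⟨n + 1, φ, .const c ∷ v⟩ Γ) ψ) : Ent (insert ⟨n, .ex φ, v⟩ Γ) ψ := by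
  filter_upwards [h.insert_left, eventually_gt_atTop c] with N h hN Δ hΔ
  have h₁ := (h (Γ.toList.map (Claim.close N))
    fun γ hγ => List.mem_map_of_mem (Finset.mem_toList.2 hγ)).subst (swapOut c)
    (Δ := φ.subst (up fun i => (v i).toTm N) :: Δ.map Fml.lift) fun γ hγ => by
      rcases List.mem_cons.1 hγ with rfl | hγ
      · rw [close_const_swapOut _ _ hN hv]
        exact List.mem_cons_self
      obtain ⟨γ, hγ', rfl⟩ := List.mem_map.1 hγ
      have hγ' := Finset.mem_toList.1 hγ'
      rw [Claim.close_swapOut _ (hΓ _ hγ')]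
      exact List.mem_cons_of_mem _
        (List.mem_map_of_mem (hΔ _ (Finset.mem_insert_of_mem hγ')))
  rw [Claim.close_swapOut _ hψ] at h₁
  exact .exE (.hyp (hΔ _ (Finset.mem_insert_self _ _))) h₁

theorem exists_fresh (Γ : Finset Claim) : ∃ c, ∀ γ ∈ Γ, γ.bound ≤ c :=
  ⟨Γ.sup Claim.bound, fun _ hγ => Finset.le_sup hγ⟩

theorem Claim.env_bound_le {γ : Claim} {c : ℕ} (h : γ.bound ≤ c) (i : Fin γ.n) :
    (γ.env i).bound ≤ c :=
  (Finset.le_sup (f := fun i => (γ.env i).bound) (Finset.mem_univ i)).trans h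

/-! ### Points: saturated prime theories -/

/-- A set of claims that is consistent, deductively closed, prime, and contains a witness for each
existential claim in it. -/
structure Point where
  carrier : Set Claim
  closed : ∀ {Γ : Finset Claim} {ψ : Claim}, ↑Γ ⊆ carrier → Ent Γ ψ → ψ ∈ carrier
  not_bot : ∀ {n : ℕ} {v : Fin n → Obj}, ⟨n, .bot, v⟩ ∉ carrier
  or_mem : ∀ {n : ℕ} {φ ψ : Fml n} {v : Fin n → Obj}, ⟨n, φ ⋎ ψ, v⟩ ∈ carrier →
    ⟨n, φ, v⟩ ∈ carrier ∨ ⟨n, ψ, v⟩ ∈ carrier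
  ex_mem : ∀ {n : ℕ} {φ : Fml (n + 1)} {v : Fin n → Obj}, ⟨n, .ex φ, v⟩ ∈ carrier →
    ∃ d, ⟨n + 1, φ, d ∷ v⟩ ∈ carrier

/-- Disjunctions and existential claims `χ` are witnessed in `Δ`. -/
def Witnessed (χ : Claim) (Δ : Finset Claim) : Prop :=
  (∀ (n : ℕ) (φ φ' : Fml n) (v : Fin n → Obj), χ = ⟨n, φ ⋎ φ', v⟩ →
    ⟨n, φ, v⟩ ∈ Δ ∨ ⟨n, φ', v⟩ ∈ Δ) ∧
  ∀ (n : ℕ) (φ : Fml (n + 1)) (v : Fin n → Obj), χ = ⟨n, .ex φ, v⟩ → ∃ d, ⟨n + 1, φ, d ∷ v⟩ ∈ Δ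

/-- The Henkin step. If both disjuncts entailed ψ, so would the disjunction, and if the instance at
a fresh constant entailed ψ, so would the existential claim. Hence a witness can be added without
entailing ψ. -/
theorem exists_witnessed {χ ψ : Claim} {Δ : Finset Claim} (h : ¬ Ent (insert χ Δ) ψ) :
    ∃ Δ', Δ ⊆ Δ' ∧ χ ∈ Δ' ∧ Witnessed χ Δ' ∧ ¬ Ent Δ' ψ := by
  obtain ⟨n, χ, v⟩ := χ
  have key : ∀ χ', (∀ Δ', χ' ∈ Δ' → Witnessed ⟨n, χ, v⟩ Δ') → 
      ¬ Ent (insert χ' (insert ⟨n, χ, v⟩ Δ)) ψ → ∃ Δ', Δ ⊆ Δ' ∧ ⟨n, χ, v⟩ ∈ Δ' ∧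
      Witnessed ⟨n, χ, v⟩ Δ' ∧ ¬ Ent Δ' ψ := fun χ' h₁ h₂ =>
    ⟨_, (Finset.subset_insert _ _).trans (Finset.subset_insert _ _),
      Finset.mem_insert_of_mem (Finset.mem_insert_self _ _),
      h₁ _ (Finset.mem_insert_self _ _), h₂⟩
  cases χ with
  | or φ φ' =>
    -- The disjunction is inserted twice because elimination consumes one copy, whereas the
    -- extension has to keep it.
    have h' : ¬ Ent (insert ⟨n, φ ⋎ φ', v⟩ (insert ⟨n, φ ⋎ φ', v⟩ Δ)) ψ := by simpa using h
    by_cases h₁ : Ent (insert ⟨n, φ, v⟩ (insert ⟨n, φ ⋎ φ', v⟩ Δ)) ψ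
    · refine key ⟨n, φ', v⟩ (fun Δ' hΔ' => ⟨?_, ?_⟩) fun h₂ => h' (h₁.or_elim h₂)
      · rintro _ _ _ _ ⟨⟩; exact .inr hΔ'
      · rintro _ _ _ ⟨⟩
    · refine key ⟨n, φ, v⟩ (fun Δ' hΔ' => ⟨?_, ?_⟩) h₁
      · rintro _ _ _ _ ⟨⟩; exact .inl hΔ'
      · rintro _ _ _ ⟨⟩
  | ex φ =>
    have h' : ¬ Ent (insert ⟨n, .ex φ, v⟩ (insert ⟨n, .ex φ, v⟩ Δ)) ψ := by simpa using h
    obtain ⟨c, hc⟩ := exists_fresh (insert ψ (insert ⟨n, .ex φ, v⟩ Δ))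
    refine key ⟨n + 1, φ, .const c ∷ v⟩ (fun Δ' hΔ' => ⟨?_, ?_⟩) fun h₂ =>
      h' (h₂.ex_elim (fun γ hγ => hc γ (Finset.mem_insert_of_mem hγ)) (fun i => ?_)
        (hc _ (Finset.mem_insert_self _ _)))
    · rintro _ _ _ _ ⟨⟩
    · rintro _ _ _ ⟨⟩; exact ⟨_, hΔ'⟩
    · exact Claim.env_bound_le (γ := ⟨n, .ex φ, v⟩) (hc _ (by simp)) i
  | _ =>
    refine ⟨_, Finset.subset_insert _ _, Finset.mem_insert_self _ _, ⟨?_, ?_⟩, h⟩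
    · rintro _ _ _ _ ⟨⟩
    · rintro _ _ _ ⟨⟩

/-- A generic filter argument: the conditions are the finite sets of claims that do not entail ψ,
and for each of the countably many claims the conditions that settle it are cofinal. The union of an
ideal of conditions that meets all these cofinal sets is the desired theory. -/
theorem exists_point (h : ¬ Ent Γ ψ) : ∃ x : Point, ↑Γ ⊆ x.carrier ∧ ψ ∉ x.carrier := by
  let P := {Δ : Finset Claim // ¬ Ent Δ ψ}
  let D : Claim → Order.Cofinal P := fun χ =>
    -- To settle χ means to exclude it, because together with the condition it entails ψ, or to
    -- contain it with its witness.
    { carrier := {Δ | Ent (insert χ Δ.1) ψ ∨ (χ ∈ Δ.1 ∧ Witnessed χ Δ.1)}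
      isCofinal := fun Δ => by
        by_cases h : Ent (insert χ Δ.1) ψ
        · exact ⟨Δ, .inl h, le_rfl⟩
        · obtain ⟨Δ', h₁, h₂, h₃, h₄⟩ := exists_witnessed h
          exact ⟨⟨Δ', h₄⟩, .inr ⟨h₂, h₃⟩, h₁⟩ }
  let _ : Encodable Claim := Encodable.ofCountable _
  let I := Order.idealOfCofinals (⟨Γ, h⟩ : P) D
  have generic : ∀ χ, (∃ Δ ∈ I, χ ∈ Δ.1 ∧ Witnessed χ Δ.1) ∨ ∃ Δ ∈ I, Ent (insert χ Δ.1) ψ := by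
    intro χ
    obtain ⟨Δ, h₁, h₂⟩ := Order.cofinal_meets_idealOfCofinals (⟨Γ, h⟩ : P) D χ
    rcases h₁ with h₁ | h₁
    · exact .inr ⟨Δ, h₂, h₁⟩
    · exact .inl ⟨Δ, h₂, h₁⟩
  -- A claim entailed by a condition in the ideal cannot be excluded by another one: by a cut, a
  -- common extension would entail ψ.
  have derivable : ∀ χ (Δ : P), Δ ∈ I → Ent Δ.1 χ → ∃ Δ ∈ I, χ ∈ Δ.1 ∧ Witnessed χ Δ.1 := by
    intro χ Δ hΔ hχ
    refine (generic χ).resolve_right ?_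
    rintro ⟨Δ', hΔ', h'⟩
    obtain ⟨Θ, -, h₁, h₂⟩ := I.directed _ hΔ _ hΔ'
    exact Θ.2 ((hχ.mono h₁).cut (h'.mono (Finset.insert_subset_insert _ h₂)))
  let T : Set Claim := {χ | ∃ Δ ∈ I, χ ∈ Δ.1}
  have witness : ∀ χ ∈ T, ∃ Δ ∈ I, Witnessed χ Δ.1 := by
    rintro χ ⟨Δ, hΔ, hχ⟩
    obtain ⟨Δ', h₁, -, h₂⟩ := derivable χ Δ hΔ (.hyp hχ)
    exact ⟨Δ', h₁, h₂⟩
  have compact : ∀ Θ : Finset Claim, ↑Θ ⊆ T → ∃ Δ ∈ I, Θ ⊆ Δ.1 := by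
    intro Θ
    induction Θ using Finset.induction_on with
    | empty => exact fun _ => ⟨_, Order.mem_idealOfCofinals _ _, by simp⟩
    | insert χ Θ _ ih =>
      intro h
      obtain ⟨Δ₁, h₁, h₁'⟩ := h (Finset.mem_coe.2 (Finset.mem_insert_self _ _))
      obtain ⟨Δ₂, h₂, h₂'⟩ := ih fun γ hγ => h (Finset.mem_coe.2 (Finset.mem_insert_of_mem hγ))
      obtain ⟨Δ, hΔ, h₃, h₄⟩ := I.directed _ h₁ _ h₂
      exact ⟨Δ, hΔ, Finset.insert_subset (h₃ h₁') (h₂'.trans h₄)⟩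
  have not_mem : ψ ∉ T := fun ⟨Δ, _, h⟩ => Δ.2 (.hyp h)
  have closed : ∀ {Θ : Finset Claim} {χ : Claim}, ↑Θ ⊆ T → Ent Θ χ → χ ∈ T := by
    intro Θ χ hΘ hχ
    obtain ⟨Δ, hΔ, h₁⟩ := compact _ hΘ
    obtain ⟨Δ', h₂, h₃, -⟩ := derivable χ Δ hΔ (hχ.mono h₁)
    exact ⟨Δ', h₂, h₃⟩
  refine ⟨⟨T, closed, ?_, ?_, ?_⟩, fun γ hγ => ⟨_, Order.mem_idealOfCofinals _ _, hγ⟩, not_mem⟩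
  · intro n v h
    exact not_mem (closed (Θ := {⟨n, .bot, v⟩}) (by simpa using h)
      (.of_forall fun N Δ hΔ => .botE (.hyp (hΔ ⟨n, .bot, v⟩ (Finset.mem_singleton_self _)))))
  · intro n φ φ' v h
    obtain ⟨Δ, hΔ, hw⟩ := witness _ h
    exact (hw.1 _ _ _ _ rfl).imp (fun h => ⟨Δ, hΔ, h⟩) (fun h => ⟨Δ, hΔ, h⟩)
  · intro n φ v h
    obtain ⟨Δ, hΔ, hw⟩ := witness _ h
    obtain ⟨d, hd⟩ := hw.2 _ _ _ rfl
    exact ⟨d, Δ, hΔ, hd⟩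

end

end BISH

namespace BISH
open Filter Topology

/-! ### Truth at a point -/

/-- A set of points is open if membership is decided by finitely many claims. -/
instance : TopologicalSpace Point where
  IsOpen U := ∀ x ∈ U, ∃ Γ : Finset Claim, ↑Γ ⊆ x.carrier ∧ ∀ y : Point, ↑Γ ⊆ y.carrier → y ∈ U
  isOpen_univ := fun _ _ => ⟨∅, by simp⟩
  isOpen_inter := by
    classical
    rintro U V hU hV x ⟨h₁, h₂⟩
    obtain ⟨Γ, hΓ, hΓ'⟩ := hU x h₁
    obtain ⟨Δ, hΔ, hΔ'⟩ := hV x h₂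
    refine ⟨Γ ∪ Δ, by simp [hΓ, hΔ], fun y hy => ?_⟩
    simp only [Finset.coe_union, Set.union_subset_iff] at hy
    exact ⟨hΓ' y hy.1, hΔ' y hy.2⟩
  isOpen_sUnion := by
    rintro S hS x ⟨U, hU, hx⟩
    obtain ⟨Γ, hΓ, hΓ'⟩ := hS U hU x hx
    exact ⟨Γ, hΓ, fun y hy => ⟨U, hU, hΓ' y hy⟩⟩

/-- The formula `φ` holds of the objects `v` at the point `x`. -/
def Sat (x : Point) {n : ℕ} (φ : Fml n) (v : Fin n → Obj) : Prop := ⟨n, φ, v⟩ ∈ x.carrier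

theorem eventually_nhds_point {x : Point} {P : Point → Prop} : (∀ᶠ y in 𝓝 x, P y) ↔
    ∃ Γ : Finset Claim, ↑Γ ⊆ x.carrier ∧ ∀ y : Point, ↑Γ ⊆ y.carrier → P y := by
  rw [eventually_nhds_iff]
  constructor
  · rintro ⟨U, h₁, h₂, h₃⟩
    obtain ⟨Γ, hΓ, hΓ'⟩ := h₂ x h₃
    exact ⟨Γ, hΓ, fun y hy => h₁ y (hΓ' y hy)⟩
  · rintro ⟨Γ, h₁, h₂⟩
    exact ⟨{y | (Γ : Set Claim) ⊆ y.carrier}, h₂, fun y hy => ⟨Γ, hy, fun _ h => h⟩, h₁⟩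

theorem Point.mem_of_derives {x : Point} {γ ψ : Claim} (hγ : γ ∈ x.carrier)
    (h : ∀ N, Derives [γ.close N] (ψ.close N)) : ψ ∈ x.carrier :=
  x.closed (Γ := {γ}) (by simpa using hγ) (.of_forall fun N Δ hΔ => (h N).weaken (by
    simpa using hΔ))

theorem Sat.eventually {x : Point} {n : ℕ} {φ : Fml n} {v : Fin n → Obj} (h : Sat x φ v) :
    ∀ᶠ y in 𝓝 x, Sat y φ v :=
  eventually_nhds_point.2 ⟨{⟨n, φ, v⟩}, by simpa using! h, fun y hy => by simpa using! hy⟩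

theorem Derives.sat {x : Point} {n : ℕ} {φ : Fml n} (h : Derives [] φ) (v : Fin n → Obj) :
    Sat x φ v :=
  x.closed (Γ := ∅) (by simp) (.of_forall fun N Δ _ => h.subst _ (by simp))

/-- A sentence that holds at all points is a theorem. -/
theorem provable_of_sat {φ : Fml 0} (h : ∀ x, Sat x φ ![]) : Provable φ := by
  have h₁ : Ent ∅ ⟨0, φ, ![]⟩ := by
    by_contra h'
    obtain ⟨x, -, hx⟩ := exists_point h'
    exact hx (h x)
  obtain ⟨N, hN⟩ := h₁.exists
  -- The derivation lives in a context of N idle variables, which are eliminated by substituting the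
  -- empty set.
  have h₂ := (hN [] (by simp)).subst (m := 0) (fun _ => .empty) (Δ := []) (by simp)
  simp only [Claim.close, Fml.subst_subst] at h₂
  rwa [show (fun i : Fin 0 => _) = Tm.var from funext fun i => i.elim0, Fml.subst_var] at h₂

section

variable {x : Point} {n : ℕ} {φ ψ : Fml n} {v : Fin n → Obj}

@[simp] theorem sat_bot : Sat x .bot v ↔ False := ⟨x.not_bot, False.elim⟩

@[simp] theorem sat_and : Sat x (φ ⋏ ψ) v ↔ Sat x φ v ∧ Sat x ψ v := by
  classical
  refine ⟨fun h => ⟨x.mem_of_derives h fun N => .andE₁ (.hyp (List.mem_singleton_self _)),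
    x.mem_of_derives h fun N => .andE₂ (.hyp (List.mem_singleton_self _))⟩, fun ⟨h₁, h₂⟩ =>
    x.closed (Γ := {⟨n, φ, v⟩, ⟨n, ψ, v⟩}) ?_ (.of_forall fun N Δ hΔ =>
      .andI (.hyp (hΔ ⟨n, φ, v⟩ (by simp))) (.hyp (hΔ ⟨n, ψ, v⟩ (by simp))))⟩
  rintro _ h
  simp only [Finset.coe_insert, Finset.coe_singleton, Set.mem_insert_iff,
    Set.mem_singleton_iff] at h
  rcases h with rfl | rfl
  exacts [h₁, h₂]

@[simp] theorem sat_or : Sat x (φ ⋎ ψ) v ↔ Sat x φ v ∨ Sat x ψ v :=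
  ⟨x.or_mem, fun h => h.elim
    (fun h => x.mem_of_derives h fun _ => .orI₁ (.hyp (List.mem_singleton_self _)))
    (fun h => x.mem_of_derives h fun _ => .orI₂ (.hyp (List.mem_singleton_self _)))⟩

-- Conversely, a neighbourhood is given by a finite Γ contained in x. If Γ and φ did not entail ψ,
-- then `exists_point` would give a point of this neighbourhood at which φ holds and ψ fails.
@[simp] theorem sat_imp : Sat x (φ ⟹ ψ) v ↔ ∀ᶠ y in 𝓝 x, Sat y φ v → Sat y ψ v := by
  classical
  constructor
  · intro h
    filter_upwards [h.eventually] with y h₁ h₂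
    refine y.closed (Γ := {⟨n, φ ⟹ ψ, v⟩, ⟨n, φ, v⟩}) ?_ (.of_forall fun N Δ hΔ =>
      .impE (.hyp (hΔ ⟨n, φ ⟹ ψ, v⟩ (by simp))) (.hyp (hΔ ⟨n, φ, v⟩ (by simp))))
    rintro _ h
    simp only [Finset.coe_insert, Finset.coe_singleton, Set.mem_insert_iff,
      Set.mem_singleton_iff] at h
    rcases h with rfl | rfl
    exacts [h₁, h₂]
  · rw [eventually_nhds_point]
    rintro ⟨Γ, h₁, h₂⟩
    refine x.closed h₁ (Ent.imp_intro ?_)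
    by_contra h
    obtain ⟨y, hy, hy'⟩ := exists_point h
    simp only [Finset.coe_insert, Set.insert_subset_iff] at hy
    exact hy' (h₂ y hy.2 hy.1)

@[simp] theorem sat_ex {φ : Fml (n + 1)} : Sat x (.ex φ) v ↔ ∃ d, Sat x φ (d ∷ v) :=
  ⟨x.ex_mem, fun ⟨d, hd⟩ => x.mem_of_derives hd fun N => .exI (d.toTm N) <| by
    rw [← close_cons]
    exact .hyp (List.mem_singleton_self _)⟩

-- Conversely, the instance at a constant fresh for Γ holds at every point above Γ, so Γ entails it
-- by `exists_point`, and the constant can be generalised.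
@[simp] theorem sat_all {φ : Fml (n + 1)} :
    Sat x (.all φ) v ↔ ∀ᶠ y in 𝓝 x, ∀ d, Sat y φ (d ∷ v) := by
  classical
  constructor
  · intro h
    filter_upwards [h.eventually] with y h₁ d
    refine y.mem_of_derives h₁ fun N => ?_
    rw [close_cons]
    exact .allE _ (.hyp (List.mem_singleton_self _))
  · rw [eventually_nhds_point]
    rintro ⟨Γ, h₁, h₂⟩
    obtain ⟨c, hc⟩ := exists_fresh (insert ⟨n, .all φ, v⟩ Γ)
    refine x.closed h₁ (Ent.all_intro (c := c) (fun γ hγ => hc γ (Finset.mem_insert_of_mem hγ))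
      (Claim.env_bound_le (hc _ (Finset.mem_insert_self _ _))) ?_)
    by_contra h
    obtain ⟨y, hy, hy'⟩ := exists_point h
    exact hy' (h₂ y hy _)

theorem sat_subst {m : ℕ} (φ : Fml m) (σ : Fin m → Tm n) (v : Fin n → Obj) :
    Sat x (φ.subst σ) v ↔ Sat x φ fun i => (σ i).eval v := by
  constructor <;> refine fun h => x.mem_of_derives h fun N => ?_
  · rw [close_subst]; exact .hyp (List.mem_singleton_self _)
  · rw [close_subst]; exact .hyp (List.mem_singleton_self _)

@[simp] theorem sat_app₁ (k : ℕ) (φ : Fml (n + 1)) (t : Tm (n + k)) (v : Fin (n + k) → Obj) :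
    Sat x (φ.app₁ k t) v ↔ Sat x φ (t.eval v ∷ fun i => v (i.addNat k)) := by
  rw [Fml.app₁, sat_subst]
  refine iff_of_eq (congrArg _ (funext fun i => ?_))
  refine Fin.cases rfl (fun i => rfl) i

@[simp] theorem sat_app₂ (k : ℕ) (φ : Fml (n + 2)) (s t : Tm (n + k)) (v : Fin (n + k) → Obj) :
    Sat x (φ.app₂ k s t) v ↔ Sat x φ (s.eval v ∷ t.eval v ∷ fun i => v (i.addNat k)) := by
  rw [Fml.app₂, sat_subst]
  refine iff_of_eq (congrArg _ (funext fun i => ?_))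
  refine Fin.cases rfl (fun i => Fin.cases rfl (fun i => rfl) i) i

end

/-! ### Membership and equality -/

/-- `a ∈ b` at the point `x`. -/
def Mem (x : Point) (a b : Obj) : Prop := Sat x (.var 0 ∈ₛ .var 1) ![a, b]

/-- `a = b` at the point `x`. -/
def Eqv (x : Point) (a b : Obj) : Prop := Sat x (.var 0 =ₛ .var 1) ![a, b]

@[simp] theorem sat_mem {x : Point} {n : ℕ} {s t : Tm n} {v : Fin n → Obj} :
    Sat x (s ∈ₛ t) v ↔ Mem x (s.eval v) (t.eval v) := by
  have := sat_subst (x := x) (.var 0 ∈ₛ .var 1) ![s, t] v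
  simp only [Fml.subst, Tm.subst] at this
  refine this.trans (iff_of_eq (congrArg _ (funext fun i => ?_)))
  fin_cases i <;> rfl

@[simp] theorem sat_eq {x : Point} {n : ℕ} {s t : Tm n} {v : Fin n → Obj} :
    Sat x (s =ₛ t) v ↔ Eqv x (s.eval v) (t.eval v) := by
  have := sat_subst (x := x) (.var 0 =ₛ .var 1) ![s, t] v
  simp only [Fml.subst, Tm.subst] at this
  refine this.trans (iff_of_eq (congrArg _ (funext fun i => ?_)))
  fin_cases i <;> rfl

/-- A property of points that spreads to a neighbourhood. -/
def Loc (P : Point → Prop) : Prop := ∀ x, P x → ∀ᶠ y in 𝓝 x, P y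

theorem Loc.sat {n : ℕ} (φ : Fml n) (v : Fin n → Obj) : Loc fun x => Sat x φ v :=
  fun _ h => Sat.eventually h

theorem Mem.eventually {x : Point} {a b : Obj} (h : Mem x a b) : ∀ᶠ y in 𝓝 x, Mem y a b :=
  Sat.eventually h

theorem Eqv.eventually {x : Point} {a b : Obj} (h : Eqv x a b) : ∀ᶠ y in 𝓝 x, Eqv y a b :=
  Sat.eventually h

@[simp] theorem Loc.mem (a b : Obj) : Loc fun x => Mem x a b := fun _ h => h.eventually

@[simp] theorem Loc.eqv (a b : Obj) : Loc fun x => Eqv x a b := fun _ h => h.eventually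

@[simp] theorem Loc.or {P Q : Point → Prop} (hP : Loc P) (hQ : Loc Q) :
    Loc fun x => P x ∨ Q x := fun x h => h.elim (fun h => (hP x h).mono fun _ => .inl)
  fun h => (hQ x h).mono fun _ => .inr

@[simp] theorem Loc.ev (P : Point → Prop) : Loc fun x => ∀ᶠ y in 𝓝 x, P y :=
  fun _ h => eventually_eventually_nhds.2 h

-- Nested implications and universal quantifiers produce nested neighbourhoods. These rules collapse
-- them to a single one, which is legitimate under a premise that itself persists to a
-- neighbourhood.
@[simp] theorem ev_forall_ev {ι : Sort*} {x : Point} {P : ι → Point → Prop} :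
    (∀ᶠ y in 𝓝 x, ∀ i, ∀ᶠ z in 𝓝 y, P i z) ↔ ∀ᶠ y in 𝓝 x, ∀ i, P i y :=
  ⟨fun h => h.mono fun _ h i => (h i).self_of_nhds, fun h =>
    (eventually_eventually_nhds.2 h).mono fun _ h i => h.mono fun _ h => h i⟩

@[simp] theorem ev_imp_ev {x : Point} {P Q : Point → Prop} (hP : Loc P) :
    (∀ᶠ y in 𝓝 x, P y → ∀ᶠ z in 𝓝 y, Q z) ↔ ∀ᶠ y in 𝓝 x, P y → Q y :=
  ⟨fun h => h.mono fun _ h hP => (h hP).self_of_nhds, fun h =>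
    (eventually_eventually_nhds.2 h).mono fun y h hy => ((hP y hy).and h).mono
      fun _ h => h.2 h.1⟩

@[simp] theorem ev_forall_imp_ev {ι : Sort*} {x : Point} {P Q : ι → Point → Prop}
    (hP : ∀ i, Loc (P i)) :
    (∀ᶠ y in 𝓝 x, ∀ i, P i y → ∀ᶠ z in 𝓝 y, Q i z) ↔ ∀ᶠ y in 𝓝 x, ∀ i, P i y → Q i y :=
  ⟨fun h => h.mono fun _ h i hP => (h i hP).self_of_nhds, fun h =>
    (eventually_eventually_nhds.2 h).mono fun y h i hy => ((hP i y hy).and h).mono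
      fun _ h => h.2 i h.1⟩

section

variable {x : Point} {n : ℕ} {φ ψ : Fml n} {v : Fin n → Obj}

@[simp] theorem sat_neg : Sat x (neg φ) v ↔ ∀ᶠ y in 𝓝 x, ¬ Sat y φ v := by
  simp [neg]

@[simp] theorem sat_iff : Sat x (iff φ ψ) v ↔ ∀ᶠ y in 𝓝 x, (Sat y φ v ↔ Sat y ψ v) := by
  simp only [iff, sat_and, sat_imp, ← eventually_and, iff_def]

@[simp] theorem sat_All {F : Tm (n + 1) → Fml (n + 1)} :
    Sat x (All F) v ↔ ∀ᶠ y in 𝓝 x, ∀ d, Sat y (F (.var 0)) (d ∷ v) := sat_all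

@[simp] theorem sat_Ex {F : Tm (n + 1) → Fml (n + 1)} :
    Sat x (Ex F) v ↔ ∃ d, Sat x (F (.var 0)) (d ∷ v) := sat_ex

@[simp] theorem eval_var (i : Fin n) : (Tm.var i).eval v = v i := rfl
@[simp] theorem eval_empty : (Tm.empty : Tm n).eval v = .empty := rfl
@[simp] theorem eval_omega : (Tm.omega : Tm n).eval v = .omega := rfl
@[simp] theorem eval_upair (s t : Tm n) :
    (Tm.upair s t).eval v = .upair (s.eval v) (t.eval v) := rfl
@[simp] theorem eval_union (s : Tm n) : (Tm.union s).eval v = .union (s.eval v) := rfl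
@[simp] theorem eval_add (s t : Tm n) : (Tm.add s t).eval v = .add (s.eval v) (t.eval v) := rfl
@[simp] theorem eval_mul (s t : Tm n) : (Tm.mul s t).eval v = .mul (s.eval v) (t.eval v) := rfl

@[simp] theorem eval_lift (t : Tm n) (d : Obj) : t.lift.eval (d ∷ v) = t.eval v := by
  simp [Tm.lift, Tm.eval_subst]

@[simp] theorem sat_AllIn {a : Tm n} {F : Tm (n + 1) → Fml (n + 1)} : Sat x (AllIn a F) v ↔
    ∀ᶠ y in 𝓝 x, ∀ d, Mem y d (a.eval v) → Sat y (F (.var 0)) (d ∷ v) := by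
  simp [AllIn]

@[simp] theorem sat_ExIn {a : Tm n} {F : Tm (n + 1) → Fml (n + 1)} : Sat x (ExIn a F) v ↔
    ∃ d, Mem x d (a.eval v) ∧ Sat x (F (.var 0)) (d ∷ v) := by
  simp [ExIn]

theorem vecCons_addNat_one (a : Obj) : (fun i : Fin n => (a ∷ v) (i.addNat 1)) = v := rfl
theorem vecCons_addNat_two (a b : Obj) :
    (fun i : Fin n => (a ∷ b ∷ v) (i.addNat 2)) = v := rfl
theorem vecCons_addNat_three (a b c : Obj) :
    (fun i : Fin n => (a ∷ b ∷ c ∷ v) (i.addNat 3)) = v := rfl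
theorem vecCons_addNat_four (a b c d : Obj) :
    (fun i : Fin n => (a ∷ b ∷ c ∷ d ∷ v) (i.addNat 4)) = v := rfl

end

end BISH

namespace BISH
open Filter Topology

/-! ### Equality -/

section

variable {x : Point} {a b c d : Obj}

/-- `a ∪ {a}`. -/
def Obj.succ (a : Obj) : Obj := .union (.upair a (.upair a a))

/-- The ordered pair. -/
def Obj.opair (a b : Obj) : Obj := .upair (.upair a a) (.upair a b)

/-- The code of `(a - b) / (c + 1)`. -/
def Obj.frac (a b c : Obj) : Obj := .opair (.opair a b) c

@[simp] theorem eval_succ {n : ℕ} {v : Fin n → Obj} (s : Tm n) :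
    (succ s).eval v = (s.eval v).succ := rfl

@[simp] theorem eval_opair {n : ℕ} {v : Fin n → Obj} (s t : Tm n) :
    (opair s t).eval v = .opair (s.eval v) (t.eval v) := rfl

@[simp] theorem eval_frac {n : ℕ} {v : Fin n → Obj} (s t u : Tm n) :
    (frac s t u).eval v = .frac (s.eval v) (t.eval v) (u.eval v) := rfl

theorem Eqv.refl (x : Point) (a : Obj) : Eqv x a a := by
  simpa using! (Derives.eqRefl (Γ := []) (.var 0 : Tm 1)).sat (x := x) ![a]

/-- The replacement rule is derived once with variables in place of the two objects; being a
theorem, it holds at x for any objects. -/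
theorem Eqv.sat {n : ℕ} (h : Eqv x a b) (φ : Fml (n + 1)) {v : Fin n → Obj}
    (ha : Sat x φ (a ∷ v)) : Sat x φ (b ∷ v) := by
  let σ : Fin (n + 1) → Tm (n + 2) := Fin.cases (.var 0) fun i => .var i.succ.succ
  let σ' : Fin (n + 1) → Tm (n + 2) := fun i => .var i.succ
  have key : Derives [] ((.var 0 =ₛ .var 1) ⟹ (φ.subst σ) ⟹ (φ.subst σ') : Fml (n + 2)) := by
    refine .impI (.impI ?_)
    have := Derives.eqSubst (Γ := [φ.subst σ, (.var 0 =ₛ .var 1 : Fml (n + 2))]) (s := .var 0)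
      (t := .var 1) (φ.subst (up fun i => .var i.succ.succ)) (.hyp (by simp)) (.hyp ?_)
    · convert! this using 1
      simp only [Fml.inst, Fml.subst_subst]
      congr 1; funext i
      refine Fin.cases rfl (fun i => rfl) i
    · simp only [Fml.inst, Fml.subst_subst]
      refine List.mem_cons.2 (.inl ?_)
      congr 1; funext i
      refine Fin.cases rfl (fun i => rfl) i
  have h₁ := key.sat (x := x) (a ∷ b ∷ v)
  simp only [sat_imp, sat_subst, sat_eq] at h₁
  have h₂ := h₁.self_of_nhds h
  have e : (fun i => (σ i).eval (a ∷ b ∷ v)) = a ∷ v := by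
    funext i
    refine Fin.cases rfl (fun i => rfl) i
  rw [e] at h₂
  exact h₂.self_of_nhds ha

theorem Eqv.symm (h : Eqv x a b) : Eqv x b a := by
  simpa using h.sat (.var 0 =ₛ .var 1) (v := ![a]) (by simpa using Eqv.refl x a)

theorem Eqv.trans (h : Eqv x a b) (h' : Eqv x b c) : Eqv x a c := by
  simpa using h.symm.sat (.var 0 =ₛ .var 1) (v := ![c]) (by simpa using h')

theorem Eqv.mem_left (h : Eqv x a b) : Mem x a c ↔ Mem x b c :=
  ⟨fun h' => by simpa using h.sat (.var 0 ∈ₛ .var 1) (v := ![c]) (by simpa using h'),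
    fun h' => by simpa using h.symm.sat (.var 0 ∈ₛ .var 1) (v := ![c]) (by simpa using h')⟩

theorem Eqv.mem_right (h : Eqv x a b) : Mem x c a ↔ Mem x c b :=
  ⟨fun h' => by simpa using h.sat (.var 1 ∈ₛ .var 0) (v := ![c]) (by simpa using h'),
    fun h' => by simpa using h.symm.sat (.var 1 ∈ₛ .var 0) (v := ![c]) (by simpa using h')⟩

theorem Eqv.term (h : Eqv x a b) (t : Tm 1) : Eqv x (t.eval ![a]) (t.eval ![b]) := by
  have := h.sat (t.subst (fun _ => .var 1) =ₛ t.subst (fun _ => .var 0)) (v := ![a])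
    (by simpa [Tm.eval_subst] using Eqv.refl x _)
  have e : ∀ a : Obj, (fun _ => a) = ![a] := fun a => by funext i; fin_cases i; rfl
  simpa [Tm.eval_subst, e] using this

theorem Eqv.term₂ (h : Eqv x a b) (h' : Eqv x c d) (t : Tm 2) :
    Eqv x (t.eval ![a, c]) (t.eval ![b, d]) := by
  have e : ∀ (i j : Fin 3) (v : Fin 3 → Obj),
      (fun k => ((![.var i, .var j] : Fin 2 → Tm 3) k).eval v) = ![v i, v j] := fun i j v => by
    funext k; fin_cases k <;> rfl
  have h₁ := h.sat (t.subst ![.var 1, .var 2] =ₛ t.subst ![.var 0, .var 2]) (v := ![a, c])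
    (by simp only [Tm.eval_subst, sat_eq, e]; exact Eqv.refl x _)
  have h₂ := h'.sat (t.subst ![.var 2, .var 1] =ₛ t.subst ![.var 2, .var 0]) (v := ![c, b])
    (by simp only [Tm.eval_subst, sat_eq, e]; exact Eqv.refl x _)
  simp only [Tm.eval_subst, sat_eq, e] at h₁ h₂
  exact h₁.trans h₂

theorem Eqv.succ (h : Eqv x a b) : Eqv x a.succ b.succ := h.term (BISH.succ (.var 0))

theorem Eqv.add (h : Eqv x a b) (h' : Eqv x c d) : Eqv x (.add a c) (.add b d) :=
  h.term₂ h' (.add (.var 0) (.var 1))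

theorem Eqv.mul (h : Eqv x a b) (h' : Eqv x c d) : Eqv x (.mul a c) (.mul b d) :=
  h.term₂ h' (.mul (.var 0) (.var 1))

theorem Eqv.opair (h : Eqv x a b) (h' : Eqv x c d) : Eqv x (.opair a c) (.opair b d) :=
  h.term₂ h' (BISH.opair (.var 0) (.var 1))

/-! ### The axioms at a point -/

/-- Agreement of the elements at x alone would not suffice: extensionality has a universal premise,
which speaks of a neighbourhood. -/
theorem Eqv.of_mem_iff (h : ∀ᶠ y in 𝓝 x, ∀ d, Mem y d a ↔ Mem y d b) : Eqv x a b := by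
  have := (Derives.ax (Γ := []) (CZFDC.extensionality (n := 0))).sat (x := x) ![]
  simp at this
  exact this.self_of_nhds a b h

theorem not_mem_empty : ¬ Mem x a .empty := by
  have := (Derives.ax (Γ := []) (CZFDC.emptySet (n := 0))).sat (x := x) ![]
  simp at this
  exact this.self_of_nhds a

theorem mem_upair : Mem x c (.upair a b) ↔ Eqv x c a ∨ Eqv x c b := by
  have := (Derives.ax (Γ := []) (CZFDC.pairing (n := 0))).sat (x := x) ![]
  simp at this
  exact this.self_of_nhds a b c

theorem mem_union : Mem x c (.union a) ↔ ∃ d, Mem x d a ∧ Mem x c d := by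
  have := (Derives.ax (Γ := []) (CZFDC.unionSet (n := 0))).sat (x := x) ![]
  simp at this
  exact this.self_of_nhds a c

theorem mem_omega : Mem x c .omega ↔ Eqv x c .empty ∨ ∃ k, Mem x k .omega ∧ Eqv x c k.succ := by
  have := (Derives.ax (Γ := []) (CZFDC.infinity (n := 0))).sat (x := x) ![]
  simp at this
  exact this.self_of_nhds c

theorem add_empty (ha : Mem x a .omega) : Eqv x (.add a .empty) a := by
  have := (Derives.ax (Γ := []) (CZFDC.add_zero (n := 0))).sat (x := x) ![]
  simp at this
  exact this.self_of_nhds a ha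

theorem add_succ (ha : Mem x a .omega) (hb : Mem x b .omega) :
    Eqv x (.add a b.succ) (.succ (.add a b)) := by
  have := (Derives.ax (Γ := []) (CZFDC.add_succ (n := 0))).sat (x := x) ![]
  simp at this
  exact this.self_of_nhds a ha b hb

theorem mul_empty (ha : Mem x a .omega) : Eqv x (.mul a .empty) .empty := by
  have := (Derives.ax (Γ := []) (CZFDC.mul_zero (n := 0))).sat (x := x) ![]
  simp at this
  exact this.self_of_nhds a ha

theorem mul_succ (ha : Mem x a .omega) (hb : Mem x b .omega) :
    Eqv x (.mul a b.succ) (.add (.mul a b) a) := by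
  have := (Derives.ax (Γ := []) (CZFDC.mul_succ (n := 0))).sat (x := x) ![]
  simp at this
  exact this.self_of_nhds a ha b hb

theorem set_induction {n : ℕ} (φ : Fml (n + 1)) {v : Fin n → Obj}
    (h : ∀ᶠ y in 𝓝 x, ∀ a, (∀ᶠ z in 𝓝 y, ∀ b, Mem z b a → Sat z φ (b ∷ v)) → Sat y φ (a ∷ v)) :
    ∀ᶠ y in 𝓝 x, ∀ a, Sat y φ (a ∷ v) := by
  have := (Derives.ax (Γ := []) (CZFDC.setInduction φ)).sat (x := x) v
  simp only [sat_imp, sat_All, sat_AllIn, sat_app₁, vecCons_addNat_one, vecCons_addNat_two,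
    eval_var, Matrix.cons_val_zero] at this
  exact this.self_of_nhds ((eventually_eventually_nhds.2 h).mono fun _ h d => h.mono fun _ h => h d)

theorem separation {n : ℕ} (φ : Fml (n + 1)) (hφ : φ.Bounded) (v : Fin n → Obj) (a : Obj) :
    ∃ b, ∀ᶠ y in 𝓝 x, ∀ d, Mem y d b ↔ Mem y d a ∧ Sat y φ (d ∷ v) := by
  have := (Derives.ax (Γ := []) (CZFDC.boundedSeparation φ hφ)).sat (x := x) v
  simp [vecCons_addNat_three] at this
  exact this.self_of_nhds a

theorem collection {n : ℕ} (φ : Fml (n + 2)) {v : Fin n → Obj}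
    (h : ∀ᶠ y in 𝓝 x, ∀ d, Mem y d a → ∃ e, Sat y φ (d ∷ e ∷ v)) :
    ∃ b, ∀ᶠ y in 𝓝 x, (∀ d, Mem y d a → ∃ e, Mem y e b ∧ Sat y φ (d ∷ e ∷ v)) ∧
      ∀ e, Mem y e b → ∃ d, Mem y d a ∧ Sat y φ (d ∷ e ∷ v) := by
  have := (Derives.ax (Γ := []) (CZFDC.strongCollection φ)).sat (x := x) v
  simp [vecCons_addNat_three, vecCons_addNat_four] at this
  obtain ⟨b, h₁, h₂⟩ := this.self_of_nhds a h
  exact ⟨b, h₁.and h₂⟩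

end

end BISH

/-! ### Natural, rational and real numbers in the model -/

namespace BISH

/-! ### The field of fractions of a discretely ordered semiring -/

/-- A cancellative commutative semiring, ordered by addition, with least positive element `1`. -/
class DiscreteSemiring (N : Type*) extends CommSemiring N, IsCancelAdd N where
  trichotomy : ∀ a b : N, a = b ∨ (∃ c, b = a + c + 1) ∨ ∃ c, a = b + c + 1
  add_one_ne_zero : ∀ a : N, a + 1 ≠ 0

namespace DiscreteSemiring

variable {N : Type*} [DiscreteSemiring N]

/-- If a and b were different, the larger would exceed the smaller by d + 1, and the products would
differ by d (c + 1) + c + 1, which is not zero. -/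
theorem cancel_succ {a b c : N} (h : a * (c + 1) = b * (c + 1)) : a = b := by
  have key : ∀ a d : N, a * (c + 1) ≠ (a + d + 1) * (c + 1) := fun a d h =>
    add_one_ne_zero (d * (c + 1) + c) (by linear_combination h.symm)
  rcases trichotomy a b with h' | ⟨d, rfl⟩ | ⟨d, rfl⟩
  exacts [h', absurd h (key _ _), absurd h.symm (key _ _)]

variable (N) in
/-- The triple `(a, b, c)` stands for `(a - b) / (c + 1)`. -/
def fracSetoid : Setoid (N × N × N) where
  r p q := p.1 * (q.2.2 + 1) + q.2.1 * (p.2.2 + 1) = q.1 * (p.2.2 + 1) + p.2.1 * (q.2.2 + 1)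
  iseqv :=
    { refl := fun _ => rfl
      symm := fun h => h.symm
      trans := by
        rintro ⟨a, b, c⟩ ⟨a', b', c'⟩ ⟨a'', b'', c''⟩ h h'
        dsimp only at *
        -- Transitivity is an identity after multiplication by the middle denominator c' + 1, which
        -- is then cancelled.
        refine cancel_succ (c := c') ?_
        linear_combination (c'' + 1) * h + (c + 1) * h' }

variable (N) in
/-- The field of fractions `(a - b) / (c + 1)`. -/
def Frac : Type _ := Quotient (fracSetoid N)

namespace Frac

/-- The fraction `(a - b) / (c + 1)`. -/
def mk (a b c : N) : Frac N := Quotient.mk (fracSetoid N) (a, b, c)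

theorem mk_eq_mk {a b c a' b' c' : N} : mk a b c = mk a' b' c' ↔
    a * (c' + 1) + b' * (c + 1) = a' * (c + 1) + b * (c' + 1) :=
  ⟨fun h => Quotient.exact (s := fracSetoid N) h, fun h => Quotient.sound (s := fracSetoid N) h⟩

theorem exists_mk (x : Frac N) : ∃ a b c, x = mk a b c := by
  obtain ⟨⟨a, b, c⟩, rfl⟩ := Quotient.exists_rep x
  exact ⟨a, b, c, rfl⟩

instance : Zero (Frac N) := ⟨mk 0 0 0⟩
instance : One (Frac N) := ⟨mk 1 0 0⟩

instance : Neg (Frac N) := ⟨Quotient.map (sa := fracSetoid N) (sb := fracSetoid N)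
  (fun p => (p.2.1, p.1, p.2.2)) fun ⟨a, b, c⟩ ⟨a', b', c'⟩ h => by
    change _ = _ at h; change _ = _
    dsimp only at *
    linear_combination h.symm⟩

instance : Add (Frac N) := ⟨Quotient.map₂ (sa := fracSetoid N) (sb := fracSetoid N)
  (sc := fracSetoid N)
  (fun p q => (p.1 * (q.2.2 + 1) + q.1 * (p.2.2 + 1), p.2.1 * (q.2.2 + 1) + q.2.1 * (p.2.2 + 1),
    p.2.2 * q.2.2 + p.2.2 + q.2.2))
  fun ⟨a, b, c⟩ ⟨a', b', c'⟩ h ⟨p, q, r⟩ ⟨p', q', r'⟩ h' => by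
    change _ = _ at h; change _ = _ at h'; change _ = _
    dsimp only at *
    linear_combination (r + 1) * (r' + 1) * h + (c + 1) * (c' + 1) * h'⟩

instance : Mul (Frac N) := ⟨Quotient.map₂ (sa := fracSetoid N) (sb := fracSetoid N)
  (sc := fracSetoid N)
  (fun p q => (p.1 * q.1 + p.2.1 * q.2.1, p.1 * q.2.1 + p.2.1 * q.1,
    p.2.2 * q.2.2 + p.2.2 + q.2.2))
  fun ⟨a, b, c⟩ ⟨a', b', c'⟩ h ⟨p, q, r⟩ ⟨p', q', r'⟩ h' => by
    change _ = _ at h; change _ = _ at h'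
    dsimp only at *
    -- The factors are exchanged one at a time. The denominators multiply correctly since c r + c +
    -- r + 1 = (c + 1) (r + 1).
    refine (fracSetoid N).trans (b := (a' * p + b' * q, a' * q + b' * p, c' * r + c' + r)) ?_ ?_ <;>
      change _ = _ <;> dsimp only
    · linear_combination (r + 1) * p * h + (r + 1) * q * h.symm
    · linear_combination (c' + 1) * a' * h' + (c' + 1) * b' * h'.symm⟩

theorem zero_def : (0 : Frac N) = mk 0 0 0 := rfl
theorem one_def : (1 : Frac N) = mk 1 0 0 := rfl
theorem neg_mk (a b c : N) : -mk a b c = mk b a c := rfl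
theorem add_mk (a b c a' b' c' : N) : mk a b c + mk a' b' c' =
    mk (a * (c' + 1) + a' * (c + 1)) (b * (c' + 1) + b' * (c + 1)) (c * c' + c + c') := rfl
theorem mul_mk (a b c a' b' c' : N) : mk a b c * mk a' b' c' =
    mk (a * a' + b * b') (a * b' + b * a') (c * c' + c + c') := rfl

/-- The numerator of a nonzero fraction is d + 1 up to sign, so d can serve as the denominator code
of the inverse. -/
theorem exists_mul_eq_one {x : Frac N} (hx : x ≠ 0) : ∃ y, x * y = 1 := by
  obtain ⟨a, b, c, rfl⟩ := exists_mk x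
  rcases trichotomy a b with rfl | ⟨d, rfl⟩ | ⟨d, rfl⟩
  · exact absurd (mk_eq_mk.2 (by ring)) hx
  · exact ⟨mk 0 (c + 1) d, mk_eq_mk.2 (by ring)⟩
  · exact ⟨mk (c + 1) 0 d, mk_eq_mk.2 (by ring)⟩

open Classical in
noncomputable instance : Field (Frac N) where
  add_assoc x y z := by
    obtain ⟨a, b, c, rfl⟩ := exists_mk x
    obtain ⟨a', b', c', rfl⟩ := exists_mk y
    obtain ⟨a'', b'', c'', rfl⟩ := exists_mk z
    simp only [add_mk, mk_eq_mk]; ring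
  zero_add x := by
    obtain ⟨a, b, c, rfl⟩ := exists_mk x
    simp only [zero_def, add_mk, mk_eq_mk]; ring
  add_zero x := by
    obtain ⟨a, b, c, rfl⟩ := exists_mk x
    simp only [zero_def, add_mk, mk_eq_mk]; ring
  add_comm x y := by
    obtain ⟨a, b, c, rfl⟩ := exists_mk x
    obtain ⟨a', b', c', rfl⟩ := exists_mk y
    simp only [add_mk, mk_eq_mk]; ring
  neg_add_cancel x := by
    obtain ⟨a, b, c, rfl⟩ := exists_mk x
    simp only [zero_def, neg_mk, add_mk, mk_eq_mk]; ring
  left_distrib x y z := by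
    obtain ⟨a, b, c, rfl⟩ := exists_mk x
    obtain ⟨a', b', c', rfl⟩ := exists_mk y
    obtain ⟨a'', b'', c'', rfl⟩ := exists_mk z
    simp only [add_mk, mul_mk, mk_eq_mk]; ring
  right_distrib x y z := by
    obtain ⟨a, b, c, rfl⟩ := exists_mk x
    obtain ⟨a', b', c', rfl⟩ := exists_mk y
    obtain ⟨a'', b'', c'', rfl⟩ := exists_mk z
    simp only [add_mk, mul_mk, mk_eq_mk]; ring
  zero_mul x := by
    obtain ⟨a, b, c, rfl⟩ := exists_mk x
    simp only [zero_def, mul_mk, mk_eq_mk]; ring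
  mul_zero x := by
    obtain ⟨a, b, c, rfl⟩ := exists_mk x
    simp only [zero_def, mul_mk, mk_eq_mk]; ring
  mul_assoc x y z := by
    obtain ⟨a, b, c, rfl⟩ := exists_mk x
    obtain ⟨a', b', c', rfl⟩ := exists_mk y
    obtain ⟨a'', b'', c'', rfl⟩ := exists_mk z
    simp only [mul_mk, mk_eq_mk]; ring
  one_mul x := by
    obtain ⟨a, b, c, rfl⟩ := exists_mk x
    simp only [one_def, mul_mk, mk_eq_mk]; ring
  mul_one x := by
    obtain ⟨a, b, c, rfl⟩ := exists_mk x
    simp only [one_def, mul_mk, mk_eq_mk]; ring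
  mul_comm x y := by
    obtain ⟨a, b, c, rfl⟩ := exists_mk x
    obtain ⟨a', b', c', rfl⟩ := exists_mk y
    simp only [mul_mk, mk_eq_mk]; ring
  exists_pair_ne := ⟨0, 1, fun h => add_one_ne_zero (0 : N) (by
    linear_combination (mk_eq_mk.1 h).symm)⟩
  inv x := if h : x = 0 then 0 else (exists_mul_eq_one h).choose
  mul_inv_cancel x hx := by
    rw [dif_neg hx]
    exact (exists_mul_eq_one hx).choose_spec
  inv_zero := by
    simp
  nsmul := nsmulRec
  zsmul := zsmulRec
  nnqsmul := _
  nnqsmul_def := fun _ _ => rfl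
  qsmul := _
  qsmul_def := fun _ _ => rfl

/-- The fractions `a / (c + 1)`. -/
def cone : RingCone (Frac N) where
  carrier := {x | ∃ a c, x = mk a 0 c}
  mul_mem' := by
    rintro _ _ ⟨a, c, rfl⟩ ⟨a', c', rfl⟩
    exact ⟨a * a', c * c' + c + c', by rw [mul_mk, mk_eq_mk]; ring⟩
  one_mem' := ⟨1, 0, rfl⟩
  add_mem' := by
    rintro _ _ ⟨a, c, rfl⟩ ⟨a', c', rfl⟩
    exact ⟨a * (c' + 1) + a' * (c + 1), c * c' + c + c', by rw [add_mk, mk_eq_mk]; ring⟩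
  zero_mem' := ⟨0, 0, rfl⟩
  eq_zero_of_mem_of_neg_mem' := by
    rintro x ⟨a, c, rfl⟩ ⟨a', c', h⟩
    rw [neg_mk, mk_eq_mk] at h
    rcases trichotomy 0 a with rfl | ⟨d, rfl⟩ | ⟨d, hd⟩
    · rw [zero_def, mk_eq_mk]; ring
    · exact absurd (show (d * (c' + 1) + c') + a' * (c + 1) + 1 = 0 by
        linear_combination h.symm) (add_one_ne_zero _)
    · exact absurd hd.symm (add_one_ne_zero _)

instance : HasMemOrNegMem (cone (N := N)) where
  mem_or_neg_mem x := by
    obtain ⟨a, b, c, rfl⟩ := exists_mk x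
    rcases trichotomy a b with rfl | ⟨d, rfl⟩ | ⟨d, rfl⟩
    · exact .inl ⟨0, 0, mk_eq_mk.2 (by ring)⟩
    · exact .inr ⟨d + 1, c, by rw [neg_mk, mk_eq_mk]; ring⟩
    · exact .inl ⟨d + 1, c, mk_eq_mk.2 (by ring)⟩

open Classical in
noncomputable instance : LinearOrder (Frac N) := LinearOrder.mkOfAddGroupCone cone

instance : IsOrderedRing (Frac N) := IsOrderedRing.mkOfCone cone

instance : IsStrictOrderedRing (Frac N) := IsOrderedRing.toIsStrictOrderedRing _

theorem nonneg_mk (a c : N) : 0 ≤ mk a 0 c := by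
  change _ - 0 ∈ cone
  rw [sub_zero]
  exact ⟨a, c, rfl⟩

/-- The inclusion of the semiring into its field of fractions. -/
def of : N →+* Frac N where
  toFun a := mk a 0 0
  map_zero' := rfl
  map_one' := rfl
  map_add' a b := by rw [add_mk, mk_eq_mk]; ring
  map_mul' a b := by rw [mul_mk, mk_eq_mk]; ring

theorem of_nonneg (a : N) : 0 ≤ of a := nonneg_mk a 0

theorem of_add_one_pos (a : N) : 0 < of a + 1 := by linarith [of_nonneg a]

theorem of_injective : Function.Injective (of (N := N)) := fun a b h => by
  linear_combination mk_eq_mk.1 h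

theorem mk_eq (a b c : N) : mk a b c = (of a - of b) / (of c + 1) := by
  rw [eq_div_iff (of_add_one_pos c).ne', sub_eq_add_neg, ← map_one of, ← map_add]
  change mk a b c * mk (c + 1) 0 0 = mk a 0 0 + mk 0 b 0
  rw [mul_mk, add_mk, mk_eq_mk]; ring

theorem of_lt_of {a b : N} : of a < of b ↔ ∃ c, b = a + c + 1 := by
  constructor
  · intro h
    rcases trichotomy a b with rfl | h' | ⟨c, rfl⟩
    · exact absurd h (lt_irrefl _)
    · exact h'
    · simp only [map_add, map_one] at h
      linarith [of_nonneg c]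
  · rintro ⟨c, rfl⟩
    simp only [map_add, map_one]
    linarith [of_nonneg c]

end Frac
end DiscreteSemiring
end BISH

namespace BISH
open Filter Topology

/-! ### The natural numbers at a point -/

section

variable {x : Point} {a b c k : Obj}

theorem zero_mem_omega : Mem x .empty .omega := mem_omega.2 (.inl (.refl _ _))

theorem succ_mem_omega (h : Mem x a .omega) : Mem x a.succ .omega :=
  mem_omega.2 (.inr ⟨a, h, .refl _ _⟩)

theorem mem_succ : Mem x c a.succ ↔ Mem x c a ∨ Eqv x c a := by
  simp only [Obj.succ, mem_union, mem_upair]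
  constructor
  · rintro ⟨d, hd | hd, h⟩
    · exact .inl (hd.mem_right.1 h)
    · exact .inr (by simpa using! mem_upair.1 (hd.mem_right.1 h))
  · rintro (h | h)
    · exact ⟨a, .inl (.refl _ _), h⟩
    · exact ⟨_, .inr (.refl _ _), mem_upair.2 (.inl h)⟩

/-- The axiom of infinity says only that the elements of ω are zero and the successors of elements.
Induction comes from ∈-induction for the formula x ∈ ω ⟹ φ, as k ∈ k + 1. -/
theorem omega_induction {n : ℕ} (φ : Fml (n + 1)) {v : Fin n → Obj} (h0 : Sat x φ (.empty ∷ v))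
    (hs : ∀ᶠ y in 𝓝 x, ∀ k, Mem y k .omega → Sat y φ (k ∷ v) → Sat y φ (k.succ ∷ v))
    (hk : Mem x k .omega) : Sat x φ (k ∷ v) := by
  have := set_induction (x := x) (.var 0 ∈ₛ .omega ⟹ φ) (v := v) ?_
  · have h := this.self_of_nhds k
    simp only [sat_imp, sat_mem, eval_var, eval_omega, Matrix.cons_val_zero] at h
    exact h.self_of_nhds hk
  filter_upwards [h0.eventually.eventually_nhds, hs.eventually_nhds] with y h0 hs a ih
  simp only [sat_imp, sat_mem, eval_var, eval_omega, Matrix.cons_val_zero]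
  filter_upwards [h0, hs, ih] with z h0 hs ih ha
  rcases mem_omega.1 ha with h | ⟨j, hj, h⟩
  · exact h.symm.sat φ h0
  · have := ih j (h.mem_right.2 (mem_succ.2 (.inr (.refl _ _))))
    simp only [sat_imp, sat_mem, eval_var, eval_omega, Matrix.cons_val_zero] at this
    exact h.symm.sat φ (hs j hj (this.self_of_nhds hj))

theorem not_mem_self : ¬ Mem x a a := by
  have := set_induction (x := x) (neg (.var 0 ∈ₛ .var 0)) (v := ![]) ?_
  · have h := this.self_of_nhds a
    simp only [sat_neg, sat_mem, eval_var, Matrix.cons_val_zero] at h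
    exact h.self_of_nhds
  refine .of_forall fun y a ih => ?_
  simp only [sat_neg, sat_mem, eval_var, Matrix.cons_val_zero] at *
  filter_upwards [ih] with z ih h
  exact (ih a h).self_of_nhds h

theorem mem_trans_omega (hk : Mem x k .omega) (hb : Mem x b k) (hc : Mem x c b) : Mem x c k := by
  have := omega_induction (x := x) (k := k)
    (AllIn (.var 0) fun b => AllIn b fun c => c ∈ₛ .var 2) (v := ![]) ?_ ?_ hk
  · simp at this
    exact this.self_of_nhds b hb c hc
  · simp [not_mem_empty]
  · refine .of_forall fun y k hk ih => ?_
    simp [mem_succ] at *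
    filter_upwards [ih] with z ih b hb c hc
    rcases hb with hb | hb
    · exact .inl (ih b hb c hc)
    · exact .inl (hb.mem_right.1 hc)

theorem add_mem_omega (ha : Mem x a .omega) (hb : Mem x b .omega) : Mem x (.add a b) .omega := by
  have := omega_induction (x := x) (k := b) (.add (.var 1) (.var 0) ∈ₛ .omega) (v := ![a]) ?_ ?_ hb
  · simpa using this
  · simpa using (add_empty ha).mem_left.2 ha
  · filter_upwards [ha.eventually] with y ha k hk ih
    simp at *
    exact (add_succ ha hk).mem_left.2 (succ_mem_omega ih)

theorem mul_mem_omega (ha : Mem x a .omega) (hb : Mem x b .omega) : Mem x (.mul a b) .omega := by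
  have := omega_induction (x := x) (k := b) (.mul (.var 1) (.var 0) ∈ₛ .omega) (v := ![a]) ?_ ?_ hb
  · simpa using this
  · simpa using (mul_empty ha).mem_left.2 zero_mem_omega
  · filter_upwards [ha.eventually] with y ha k hk ih
    simp at *
    exact (mul_succ ha hk).mem_left.2 (add_mem_omega ih ha)

end

/-- The natural numbers at a point. -/
def omegaSetoid (x : Point) : Setoid {a // Mem x a .omega} where
  r a b := Eqv x a b
  iseqv := ⟨fun _ => .refl _ _, .symm, .trans⟩

/-- The natural numbers at a point, up to equality. -/
def Nat' (x : Point) : Type := Quotient (omegaSetoid x)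

namespace Nat'

variable {x : Point} {a b c k : Obj}

instance : Zero (Nat' x) := ⟨Quotient.mk (omegaSetoid x) ⟨_, zero_mem_omega⟩⟩

/-- The successor function. -/
def S : Nat' x → Nat' x := Quotient.map (sa := omegaSetoid x) (sb := omegaSetoid x)
  (fun a => ⟨a.1.succ, succ_mem_omega a.2⟩) fun _ _ h => Eqv.succ h

instance : One (Nat' x) := ⟨S 0⟩

instance : Add (Nat' x) := ⟨Quotient.map₂ (sa := omegaSetoid x) (sb := omegaSetoid x)
  (sc := omegaSetoid x) (fun a b => ⟨.add a.1 b.1, add_mem_omega a.2 b.2⟩)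
  fun _ _ h _ _ h' => Eqv.add h h'⟩

instance : Mul (Nat' x) := ⟨Quotient.map₂ (sa := omegaSetoid x) (sb := omegaSetoid x)
  (sc := omegaSetoid x) (fun a b => ⟨.mul a.1 b.1, mul_mem_omega a.2 b.2⟩)
  fun _ _ h _ _ h' => Eqv.mul h h'⟩

open Classical in
/-- The value of an object as a natural number at `x`. -/
noncomputable def val (x : Point) (a : Obj) : Nat' x :=
  if h : Mem x a .omega then Quotient.mk (omegaSetoid x) ⟨a, h⟩ else 0

theorem val_of_mem (h : Mem x a .omega) : val x a = Quotient.mk (omegaSetoid x) ⟨a, h⟩ :=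
  dif_pos h

theorem val_eq_val (ha : Mem x a .omega) (hb : Mem x b .omega) :
    val x a = val x b ↔ Eqv x a b := by
  rw [val_of_mem ha, val_of_mem hb]
  exact ⟨fun h => Quotient.exact (s := omegaSetoid x) h,
    fun h => Quotient.sound (s := omegaSetoid x) h⟩

theorem exists_val (n : Nat' x) : ∃ a, Mem x a .omega ∧ val x a = n := by
  obtain ⟨⟨a, ha⟩, rfl⟩ := Quotient.exists_rep n
  exact ⟨a, ha, val_of_mem ha⟩

@[simp] theorem val_empty : val x .empty = 0 := val_of_mem zero_mem_omega

@[simp] theorem val_succ (h : Mem x a .omega) : val x a.succ = S (val x a) := by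
  rw [val_of_mem h, val_of_mem (succ_mem_omega h)]; rfl

@[simp] theorem val_add (ha : Mem x a .omega) (hb : Mem x b .omega) :
    val x (.add a b) = val x a + val x b := by
  rw [val_of_mem ha, val_of_mem hb, val_of_mem (add_mem_omega ha hb)]; rfl

@[simp] theorem val_mul (ha : Mem x a .omega) (hb : Mem x b .omega) :
    val x (.mul a b) = val x a * val x b := by
  rw [val_of_mem ha, val_of_mem hb, val_of_mem (mul_mem_omega ha hb)]; rfl

theorem add_zero (m : Nat' x) : m + 0 = m := by
  obtain ⟨a, ha, rfl⟩ := exists_val m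
  rw [← val_empty, ← val_add ha zero_mem_omega, val_eq_val (add_mem_omega ha zero_mem_omega) ha]
  exact add_empty ha

theorem add_S (m n : Nat' x) : m + S n = S (m + n) := by
  obtain ⟨a, ha, rfl⟩ := exists_val m
  obtain ⟨b, hb, rfl⟩ := exists_val n
  rw [← val_succ hb, ← val_add ha hb, ← val_add ha (succ_mem_omega hb),
    ← val_succ (add_mem_omega ha hb), val_eq_val (add_mem_omega ha (succ_mem_omega hb))
      (succ_mem_omega (add_mem_omega ha hb))]
  exact add_succ ha hb

theorem mul_zero (m : Nat' x) : m * 0 = 0 := by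
  obtain ⟨a, ha, rfl⟩ := exists_val m
  rw [← val_empty, ← val_mul ha zero_mem_omega,
    val_eq_val (mul_mem_omega ha zero_mem_omega) zero_mem_omega]
  exact mul_empty ha

theorem mul_S (m n : Nat' x) : m * S n = m * n + m := by
  obtain ⟨a, ha, rfl⟩ := exists_val m
  obtain ⟨b, hb, rfl⟩ := exists_val n
  have h := mul_mem_omega ha hb
  rw [← val_succ hb, ← val_mul ha hb, ← val_mul ha (succ_mem_omega hb), ← val_add h ha,
    val_eq_val (mul_mem_omega ha (succ_mem_omega hb)) (add_mem_omega h ha)]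
  exact mul_succ ha hb

/-- An equation between terms holds for all natural numbers if it is inductive. -/
theorem term_induction {m : ℕ} (s t : Tm (m + 1)) {v : Fin m → Obj}
    (hv : ∀ i, Mem x (v i) .omega)
    (hs : ∀ y k, (∀ i, Mem y (v i) .omega) → Mem y k .omega →
      Mem y (s.eval (k ∷ v)) .omega ∧ Mem y (t.eval (k ∷ v)) .omega)
    (h0 : val x (s.eval (.empty ∷ v)) = val x (t.eval (.empty ∷ v)))
    (h : ∀ y k, (∀ i, Mem y (v i) .omega) → Mem y k .omega →
      val y (s.eval (k ∷ v)) = val y (t.eval (k ∷ v)) →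
      val y (s.eval (k.succ ∷ v)) = val y (t.eval (k.succ ∷ v)))
    (hk : Mem x k .omega) : val x (s.eval (k ∷ v)) = val x (t.eval (k ∷ v)) := by
  -- Equality of values is the truth of an equation of the formal language, and to such a formula
  -- induction applies.
  have key : ∀ y k, (∀ i, Mem y (v i) .omega) → Mem y k .omega →
      (val y (s.eval (k ∷ v)) = val y (t.eval (k ∷ v)) ↔ Sat y (s =ₛ t) (k ∷ v)) :=
    fun y k h₁ h₂ => by rw [sat_eq, val_eq_val (hs y k h₁ h₂).1 (hs y k h₁ h₂).2]
  rw [key x k hv hk]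
  refine omega_induction _ ((key x _ hv zero_mem_omega).1 h0) ?_ hk
  filter_upwards [eventually_all.2 fun i => (hv i).eventually] with y hy k hk ih
  exact (key y _ hy (succ_mem_omega hk)).1 (h y k hy hk ((key y k hy hk).2 ih))

theorem zero_add (m : Nat' x) : 0 + m = m := by
  obtain ⟨a, ha, rfl⟩ := exists_val m
  have := term_induction (x := x) (v := ![]) (.add .empty (.var 0)) (.var 0) (by simp)
    (fun y k _ hk => by simp [hk, add_mem_omega, zero_mem_omega]) ?_ ?_ ha
  · simpa [ha, zero_mem_omega] using this
  · simp [zero_mem_omega, add_zero]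
  · intro y k _ hk ih
    simp_all [zero_mem_omega, succ_mem_omega, add_S]

theorem S_add (m n : Nat' x) : S m + n = S (m + n) := by
  obtain ⟨a, ha, rfl⟩ := exists_val m
  obtain ⟨b, hb, rfl⟩ := exists_val n
  have := term_induction (x := x) (v := ![a]) (.add (succ (.var 1)) (.var 0))
    (succ (.add (.var 1) (.var 0))) (by simp [ha])
    (fun y k h hk => by simp_all [add_mem_omega, succ_mem_omega]) ?_ ?_ hb
  · simpa [ha, hb, succ_mem_omega, add_mem_omega] using this
  · simp [ha, succ_mem_omega, zero_mem_omega, add_mem_omega, add_zero]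
  · intro y k h hk ih
    simp_all (maxDischargeDepth := 8) [succ_mem_omega, add_mem_omega, add_S]

theorem add_comm (m n : Nat' x) : m + n = n + m := by
  obtain ⟨a, ha, rfl⟩ := exists_val m
  obtain ⟨b, hb, rfl⟩ := exists_val n
  have := term_induction (x := x) (v := ![a]) (.add (.var 1) (.var 0))
    (.add (.var 0) (.var 1)) (by simp [ha])
    (fun y k h hk => by simp_all [add_mem_omega]) ?_ ?_ hb
  · simpa [ha, hb, add_mem_omega] using this
  · simp [ha, zero_mem_omega, add_zero, zero_add]
  · intro y k h hk ih
    simp_all (maxDischargeDepth := 8) [succ_mem_omega, add_S, S_add]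

theorem add_assoc (m n p : Nat' x) : m + n + p = m + (n + p) := by
  obtain ⟨a, ha, rfl⟩ := exists_val m
  obtain ⟨b, hb, rfl⟩ := exists_val n
  obtain ⟨c, hc, rfl⟩ := exists_val p
  have := term_induction (x := x) (v := ![a, b]) (.add (.add (.var 1) (.var 2)) (.var 0))
    (.add (.var 1) (.add (.var 2) (.var 0))) (by simp [Fin.forall_fin_two, ha, hb])
    (fun y k h hk => by simp_all [Fin.forall_fin_two, add_mem_omega]) ?_ ?_ hc
  · simpa [ha, hb, hc, add_mem_omega] using this
  · simp [ha, hb, zero_mem_omega, add_mem_omega, add_zero]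
  · intro y k h hk ih
    simp_all (maxDischargeDepth := 8) [Fin.forall_fin_two, succ_mem_omega, add_mem_omega, add_S]

theorem zero_mul (m : Nat' x) : 0 * m = 0 := by
  obtain ⟨a, ha, rfl⟩ := exists_val m
  have := term_induction (x := x) (v := ![]) (.mul .empty (.var 0)) .empty (by simp)
    (fun y k _ hk => by simp [hk, mul_mem_omega, zero_mem_omega]) ?_ ?_ ha
  · simpa [ha, zero_mem_omega] using this
  · simp [zero_mem_omega, mul_zero]
  · intro y k _ hk ih
    simp_all [zero_mem_omega, succ_mem_omega, mul_S, add_zero]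

theorem S_mul (m n : Nat' x) : S m * n = m * n + n := by
  obtain ⟨a, ha, rfl⟩ := exists_val m
  obtain ⟨b, hb, rfl⟩ := exists_val n
  have := term_induction (x := x) (v := ![a]) (.mul (succ (.var 1)) (.var 0))
    (.add (.mul (.var 1) (.var 0)) (.var 0)) (by simp [ha])
    (fun y k h hk => by simp_all [add_mem_omega, succ_mem_omega, mul_mem_omega]) ?_ ?_ hb
  · simpa [ha, hb, succ_mem_omega, mul_mem_omega] using this
  · simp [ha, succ_mem_omega, zero_mem_omega, mul_mem_omega, mul_zero, add_zero]
  · intro y k h hk ih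
    simp_all (maxDischargeDepth := 8) [succ_mem_omega, mul_mem_omega, mul_S, add_S]
    rw [add_assoc, add_assoc, add_comm (val y k)]

theorem mul_comm (m n : Nat' x) : m * n = n * m := by
  obtain ⟨a, ha, rfl⟩ := exists_val m
  obtain ⟨b, hb, rfl⟩ := exists_val n
  have := term_induction (x := x) (v := ![a]) (.mul (.var 1) (.var 0))
    (.mul (.var 0) (.var 1)) (by simp [ha])
    (fun y k h hk => by simp_all [mul_mem_omega]) ?_ ?_ hb
  · simpa [ha, hb] using this
  · simp [ha, zero_mem_omega, mul_zero, zero_mul]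
  · intro y k h hk ih
    simp_all (maxDischargeDepth := 8) [succ_mem_omega, mul_S, S_mul]

theorem mul_add (m n p : Nat' x) : m * (n + p) = m * n + m * p := by
  obtain ⟨a, ha, rfl⟩ := exists_val m
  obtain ⟨b, hb, rfl⟩ := exists_val n
  obtain ⟨c, hc, rfl⟩ := exists_val p
  have := term_induction (x := x) (v := ![a, b]) (.mul (.var 1) (.add (.var 2) (.var 0)))
    (.add (.mul (.var 1) (.var 2)) (.mul (.var 1) (.var 0))) (by simp [Fin.forall_fin_two, ha, hb])
    (fun y k h hk => by simp_all [Fin.forall_fin_two, add_mem_omega, mul_mem_omega]) ?_ ?_ hc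
  · simpa [ha, hb, hc, add_mem_omega, mul_mem_omega] using this
  · simp [ha, hb, zero_mem_omega, mul_mem_omega, add_mem_omega, add_zero, mul_zero]
  · intro y k h hk ih
    simp_all (maxDischargeDepth := 8) [Fin.forall_fin_two, succ_mem_omega,
        add_mem_omega, mul_mem_omega, add_S, mul_S,
      add_assoc]

theorem mul_assoc (m n p : Nat' x) : m * n * p = m * (n * p) := by
  obtain ⟨a, ha, rfl⟩ := exists_val m
  obtain ⟨b, hb, rfl⟩ := exists_val n
  obtain ⟨c, hc, rfl⟩ := exists_val p
  have := term_induction (x := x) (v := ![a, b]) (.mul (.mul (.var 1) (.var 2)) (.var 0))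
    (.mul (.var 1) (.mul (.var 2) (.var 0))) (by simp [Fin.forall_fin_two, ha, hb])
    (fun y k h hk => by simp_all [Fin.forall_fin_two, mul_mem_omega]) ?_ ?_ hc
  · simpa [ha, hb, hc, mul_mem_omega] using this
  · simp [ha, hb, zero_mem_omega, mul_mem_omega, mul_zero]
  · intro y k h hk ih
    simp_all (maxDischargeDepth := 8) [Fin.forall_fin_two,
        succ_mem_omega, mul_mem_omega, mul_S, mul_add]

instance : CommSemiring (Nat' x) where
  add_assoc := add_assoc
  zero_add := zero_add
  add_zero := add_zero
  add_comm := add_comm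
  left_distrib := mul_add
  right_distrib a b c := by rw [mul_comm, mul_add, mul_comm, mul_comm c]
  zero_mul := zero_mul
  mul_zero := mul_zero
  mul_assoc := mul_assoc
  mul_comm := mul_comm
  one_mul m := by change S 0 * m = m; rw [S_mul, zero_mul, zero_add]
  mul_one m := by change m * S 0 = m; rw [mul_S, mul_zero, zero_add]
  nsmul := nsmulRec
  npow := npowRec

theorem S_eq (m : Nat' x) : S m = m + 1 := by
  change _ = m + S 0
  rw [add_S, add_zero]

theorem exists_of_ne_zero (m : Nat' x) : m = 0 ∨ ∃ n, m = n + 1 := by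
  obtain ⟨a, ha, rfl⟩ := exists_val m
  rcases mem_omega.1 ha with h | ⟨k, hk, h⟩
  · exact .inl (by rw [← val_empty, val_eq_val ha zero_mem_omega]; exact h)
  · refine .inr ⟨val x k, ?_⟩
    rw [← S_eq, ← val_succ hk, val_eq_val ha (succ_mem_omega hk)]
    exact h

theorem mem_add_succ (ha : Mem x a .omega) (hb : Mem x b .omega) : Mem x a (.add a b.succ) := by
  have := omega_induction (x := x) (k := b) (.var 1 ∈ₛ .add (.var 1) (succ (.var 0)))
    (v := ![a]) ?_ ?_ hb
  · simpa using this
  · simp only [sat_mem, eval_var, eval_add, eval_succ, Matrix.cons_val_zero,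
      Matrix.cons_val_one]
    exact (add_succ ha zero_mem_omega).mem_right.2 (mem_succ.2 (.inr (add_empty ha).symm))
  · filter_upwards [ha.eventually] with y ha k hk ih
    simp only [sat_mem, eval_var, eval_add, eval_succ, Matrix.cons_val_zero,
      Matrix.cons_val_one] at *
    exact (add_succ ha (succ_mem_omega hk)).mem_right.2 (mem_succ.2 (.inl ih))

/-- Since a is an element of a + (b + 1), equality would make it an element of itself. -/
theorem add_add_one_ne (m n : Nat' x) : m + n + 1 ≠ m := by
  obtain ⟨a, ha, rfl⟩ := exists_val m
  obtain ⟨b, hb, rfl⟩ := exists_val n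
  intro h
  rw [_root_.add_assoc, ← S_eq, ← val_succ hb, ← val_add ha (succ_mem_omega hb),
    val_eq_val (add_mem_omega ha (succ_mem_omega hb)) ha] at h
  exact not_mem_self (h.mem_right.1 (mem_add_succ ha hb))

theorem dichotomy (m n : Nat' x) : (∃ c, n = m + c + 1) ∨ ∃ c, m = n + c := by
  obtain ⟨a, ha, rfl⟩ := exists_val m
  obtain ⟨b, hb, rfl⟩ := exists_val n
  have key : ∀ y b, Mem y a .omega → Mem y b .omega →
      (Sat y ((ExIn .omega fun c => .var 1 =ₛ .add (.var 2) (succ c)) ⋎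
        ExIn .omega fun c => .var 2 =ₛ .add (.var 1) c) ![b, a] ↔
      (∃ c, val y b = val y a + c + 1) ∨ ∃ c, val y a = val y b + c) := by
    intro y b ha hb
    simp only [sat_or, sat_ExIn, sat_eq, eval_var, eval_add, eval_succ, eval_omega]
    constructor
    · rintro (⟨c, hc, h⟩ | ⟨c, hc, h⟩)
      · refine .inl ⟨val y c, ?_⟩
        rw [_root_.add_assoc, ← S_eq, ← val_succ hc, ← val_add ha (succ_mem_omega hc),
          val_eq_val hb (add_mem_omega ha (succ_mem_omega hc))]
        exact h
      · refine .inr ⟨val y c, ?_⟩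
        rw [← val_add hb hc, val_eq_val ha (add_mem_omega hb hc)]
        exact h
    · rintro (⟨c, h⟩ | ⟨c, h⟩) <;> obtain ⟨c, hc, rfl⟩ := exists_val c
      · rw [_root_.add_assoc, ← S_eq, ← val_succ hc, ← val_add ha (succ_mem_omega hc),
          val_eq_val hb (add_mem_omega ha (succ_mem_omega hc))] at h
        exact .inl ⟨c, hc, h⟩
      · rw [← val_add hb hc, val_eq_val ha (add_mem_omega hb hc)] at h
        exact .inr ⟨c, hc, h⟩
  rw [← key x b ha hb]
  -- Induction on b. In the step only the case a = b + c needs thought: if c = 0, then b + 1 exceeds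
  -- a, and otherwise c loses one.
  refine omega_induction (x := x) _ ((key x _ ha zero_mem_omega).2 (.inr ⟨val x a, ?_⟩)) ?_ hb
  · rw [val_empty, zero_add]
  filter_upwards [ha.eventually] with y ha k hk ih
  refine (key y _ ha (succ_mem_omega hk)).2 ?_
  rw [val_succ hk, S_eq]
  rcases (key y _ ha hk).1 ih with ⟨c, h⟩ | ⟨c, h⟩
  · exact .inl ⟨c + 1, by rw [h]; ring⟩
  · rcases exists_of_ne_zero c with rfl | ⟨d, rfl⟩
    · exact .inl ⟨0, by rw [h]; ring⟩
    · exact .inr ⟨d, by rw [h]; ring⟩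

instance : DiscreteSemiring (Nat' x) where
  trichotomy m n := by
    rcases dichotomy m n with h | ⟨c, rfl⟩
    · exact .inr (.inl h)
    · rcases exists_of_ne_zero c with rfl | ⟨d, rfl⟩
      · exact .inl (add_zero _)
      · exact .inr (.inr ⟨d, (_root_.add_assoc _ _ _).symm⟩)
  add_one_ne_zero m h := add_add_one_ne 0 m (by rw [zero_add]; exact h)
  add_left_cancel a b c h := by
    rcases dichotomy b c with ⟨d, rfl⟩ | ⟨d, rfl⟩
    · exact absurd (by simpa [_root_.add_assoc] using h.symm) (add_add_one_ne (a + b) d)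
    · rcases exists_of_ne_zero d with rfl | ⟨d, rfl⟩
      · exact add_zero _
      · exact absurd (by simpa [_root_.add_assoc] using h) (add_add_one_ne (a + c) d)
  add_right_cancel a b c h := by
    replace h : b + a = c + a := h
    rcases dichotomy b c with ⟨d, rfl⟩ | ⟨d, rfl⟩
    · exact absurd (by rw [show b + a + d + 1 = b + d + 1 + a by ring]; exact h.symm)
        (add_add_one_ne (b + a) d)
    · rcases exists_of_ne_zero d with rfl | ⟨d, rfl⟩
      · exact add_zero _
      · exact absurd (by rw [show c + a + d + 1 = c + (d + 1) + a by ring]; exact h)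
          (add_add_one_ne (c + a) d)

theorem mem_iff (ha : Mem x a .omega) (hb : Mem x b .omega) :
    Mem x a b ↔ ∃ c, val x b = val x a + c + 1 := by
  constructor
  · intro h
    rcases dichotomy (val x a) (val x b) with h' | ⟨c, h'⟩
    · exact h'
    · exfalso
      obtain ⟨c, hc, rfl⟩ := exists_val c
      -- Here a = b + c. If c = 0, then a ∈ b = a; if c = d + 1, then b ∈ a, and a ∈ b gives a ∈ a
      -- by transitivity.
      rcases mem_omega.1 hc with h₁ | ⟨d, hd, h₁⟩
      · rw [(val_eq_val hc zero_mem_omega).2 h₁, val_empty, add_zero, val_eq_val ha hb] at h'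
        exact not_mem_self (h'.mem_left.1 h)
      · rw [(val_eq_val hc (succ_mem_omega hd)).2 h₁, ← val_add hb (succ_mem_omega hd),
          val_eq_val ha (add_mem_omega hb (succ_mem_omega hd))] at h'
        exact not_mem_self (mem_trans_omega ha (h'.mem_right.2 (mem_add_succ hb hd)) h)
  · rintro ⟨c, h⟩
    obtain ⟨c, hc, rfl⟩ := exists_val c
    rw [_root_.add_assoc, ← S_eq, ← val_succ hc, ← val_add ha (succ_mem_omega hc),
      val_eq_val hb (add_mem_omega ha (succ_mem_omega hc))] at h
    exact h.mem_right.2 (mem_add_succ ha hc)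

end Nat'
end BISH

namespace BISH
open Filter Topology DiscreteSemiring

/-! ### The rational numbers at a point -/

/-- The field of rational numbers at a point. -/
abbrev K (x : Point) : Type := Frac (Nat' x)

/-- A natural number as an element of the field. -/
noncomputable def nat (x : Point) (a : Obj) : K x := Frac.of (Nat'.val x a)

section

variable {x : Point} {a b c d : Obj}

theorem nat_nonneg : 0 ≤ nat x a := Frac.of_nonneg _

theorem nat_add_one_pos : 0 < nat x a + 1 := Frac.of_add_one_pos _

@[simp] theorem nat_empty : nat x .empty = 0 := by simp [nat]

theorem nat_succ (h : Mem x a .omega) : nat x a.succ = nat x a + 1 := by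
  simp [nat, h, Nat'.S_eq]

theorem nat_add (ha : Mem x a .omega) (hb : Mem x b .omega) :
    nat x (.add a b) = nat x a + nat x b := by
  simp [nat, ha, hb]

theorem nat_mul (ha : Mem x a .omega) (hb : Mem x b .omega) :
    nat x (.mul a b) = nat x a * nat x b := by
  simp [nat, ha, hb]

theorem nat_eq_nat (ha : Mem x a .omega) (hb : Mem x b .omega) :
    nat x a = nat x b ↔ Eqv x a b := by
  rw [nat, nat, Frac.of_injective.eq_iff, Nat'.val_eq_val ha hb]

theorem nat_lt_nat (ha : Mem x a .omega) (hb : Mem x b .omega) :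
    nat x a < nat x b ↔ Mem x a b := by
  rw [nat, nat, Frac.of_lt_of, Nat'.mem_iff ha hb]

theorem nat_le_nat (ha : Mem x a .omega) (hb : Mem x b .omega) :
    nat x a ≤ nat x b ↔ Eqv x a b ∨ Mem x a b := by
  rw [le_iff_eq_or_lt, nat_eq_nat ha hb, nat_lt_nat ha hb]

theorem nat_lt_add_one (ha : Mem x a .omega) (hb : Mem x b .omega) :
    nat x a < nat x b + 1 ↔ nat x a ≤ nat x b := by
  rw [← nat_succ hb, nat_lt_nat ha (succ_mem_omega hb), mem_succ, nat_le_nat ha hb, or_comm]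

theorem exists_frac (k : K x) : ∃ a b c, Mem x a .omega ∧ Mem x b .omega ∧ Mem x c .omega ∧
    k = (nat x a - nat x b) / (nat x c + 1) := by
  obtain ⟨a, b, c, rfl⟩ := Frac.exists_mk k
  obtain ⟨a, ha, rfl⟩ := Nat'.exists_val a
  obtain ⟨b, hb, rfl⟩ := Nat'.exists_val b
  obtain ⟨c, hc, rfl⟩ := Nat'.exists_val c
  exact ⟨a, b, c, ha, hb, hc, Frac.mk_eq _ _ _⟩

/-- The field is Archimedean over the natural numbers at the point. -/
theorem exists_nat_gt (k : K x) : ∃ n, Mem x n .omega ∧ k < nat x n := by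
  obtain ⟨a, b, c, ha, hb, hc, rfl⟩ := exists_frac k
  -- The fraction (a - b) / (c + 1) is at most a.
  refine ⟨a.succ, succ_mem_omega ha, ?_⟩
  rw [nat_succ ha, div_lt_iff₀ nat_add_one_pos]
  nlinarith [nat_nonneg (x := x) (a := a), nat_nonneg (x := x) (a := b),
    nat_nonneg (x := x) (a := c)]

theorem exists_one_div_lt {k : K x} (hk : 0 < k) :
    ∃ n, Mem x n .omega ∧ 1 / (nat x n + 1) < k := by
  obtain ⟨n, hn, h⟩ := exists_nat_gt (1 / k)
  refine ⟨n, hn, ?_⟩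
  rw [div_lt_iff₀ hk] at h
  rw [div_lt_iff₀ nat_add_one_pos]
  nlinarith

theorem eqv_opair : Eqv x (.opair a b) (.opair c d) ↔ Eqv x a c ∧ Eqv x b d := by
  refine ⟨fun h => ?_, fun h => h.1.opair h.2⟩
  have key : ∀ e, Eqv x e (.upair a a) ∨ Eqv x e (.upair a b) ↔
      Eqv x e (.upair c c) ∨ Eqv x e (.upair c d) := fun e => by
    have := h.mem_right (c := e)
    simpa only [Obj.opair, mem_upair] using this
  have up : ∀ {a b c d}, Eqv x (.upair a b) (.upair c d) →
      ∀ e, Eqv x e a ∨ Eqv x e b ↔ Eqv x e c ∨ Eqv x e d := fun h e => by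
    simpa only [mem_upair] using h.mem_right (c := e)
  have hac : Eqv x a c := by
    rcases (key _).1 (.inl (.refl _ _)) with h | h
    · simpa using (up h a).1 (.inl (.refl _ _))
    · simpa using ((up h c).2 (.inl (.refl _ _))).imp Eqv.symm Eqv.symm
  refine ⟨hac, ?_⟩
  rcases (key _).1 (.inr (.refl _ _)) with h₁ | h₁
  · have hb : Eqv x b c := by simpa using (up h₁ b).1 (.inr (.refl _ _))
    rcases (key _).2 (.inr (.refl _ _)) with h₂ | h₂
    · have hd : Eqv x d a := by simpa using (up h₂ d).1 (.inr (.refl _ _))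
      exact hb.trans (hac.symm.trans hd.symm)
    · rcases (up h₂ d).1 (.inr (.refl _ _)) with hd | hd
      · exact hb.trans (hac.symm.trans hd.symm)
      · exact hd.symm
  · rcases (up h₁ b).1 (.inr (.refl _ _)) with hb | hb
    · rcases (up h₁ d).2 (.inr (.refl _ _)) with hd | hd
      · exact hb.trans (hac.symm.trans hd.symm)
      · exact hd.symm
    · exact hb

/-- `q` codes the rational number `k` at the point `x`. -/
def Code (x : Point) (q : Obj) (k : K x) : Prop := ∃ a b c, Mem x a .omega ∧ Mem x b .omega ∧
  Mem x c .omega ∧ Eqv x q (.frac a b c) ∧ k = (nat x a - nat x b) / (nat x c + 1)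

variable {p q r : Obj} {k l : K x}

theorem Code.unique (h : Code x q k) (h' : Code x q l) : k = l := by
  obtain ⟨a, b, c, ha, hb, hc, h, rfl⟩ := h
  obtain ⟨a', b', c', ha', hb', hc', h', rfl⟩ := h'
  have := h.symm.trans h'
  simp only [Obj.frac, eqv_opair] at this
  rw [(nat_eq_nat ha ha').2 this.1.1, (nat_eq_nat hb hb').2 this.1.2,
    (nat_eq_nat hc hc').2 this.2]

theorem exists_code (k : K x) : ∃ q, Code x q k := by
  obtain ⟨a, b, c, ha, hb, hc, rfl⟩ := exists_frac k
  exact ⟨_, a, b, c, ha, hb, hc, .refl _ _, rfl⟩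

theorem code_frac (ha : Mem x a .omega) (hb : Mem x b .omega) (hc : Mem x c .omega) :
    Code x (.frac a b c) ((nat x a - nat x b) / (nat x c + 1)) :=
  ⟨a, b, c, ha, hb, hc, .refl _ _, rfl⟩

theorem Eqv.code (h : Eqv x p q) (hp : Code x p k) : Code x q k := by
  obtain ⟨a, b, c, ha, hb, hc, h', rfl⟩ := hp
  exact ⟨a, b, c, ha, hb, hc, h.symm.trans h', rfl⟩

@[simp] theorem code_zero : Code x (.frac .empty .empty .empty) k ↔ k = 0 := by
  have : Code x (.frac .empty .empty .empty) 0 := by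
    simpa using code_frac (x := x) zero_mem_omega zero_mem_omega zero_mem_omega
  exact ⟨fun h => h.unique this, fun h => h ▸ this⟩

@[simp] theorem code_one : Code x (.frac (.succ .empty) .empty .empty) k ↔ k = 1 := by
  have : Code x (.frac (.succ .empty) .empty .empty) 1 := by
    simpa [nat_succ, zero_mem_omega] using
      code_frac (x := x) (succ_mem_omega zero_mem_omega) zero_mem_omega zero_mem_omega
  exact ⟨fun h => h.unique this, fun h => h ▸ this⟩

theorem code_one_div (hc : Mem x c .omega) :
    Code x (.frac (.succ .empty) .empty c) (1 / (nat x c + 1)) := by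
  simpa [nat_succ, zero_mem_omega] using
      code_frac (x := x) (succ_mem_omega zero_mem_omega) zero_mem_omega hc

end

section

variable {x : Point} {n : ℕ} {v : Fin n → Obj}

@[simp] theorem sat_IsRat {t : Tm n} : Sat x (IsRat t) v ↔ ∃ k, Code x (t.eval v) k := by
  simp only [IsRat, sat_ExIn, sat_eq, eval_omega, eval_frac, eval_lift,
    eval_var, Matrix.cons_val_zero]
  constructor
  · rintro ⟨a, ha, b, hb, c, hc, h⟩
    exact ⟨_, a, b, c, ha, hb, hc, h, rfl⟩
  · rintro ⟨k, a, b, c, ha, hb, hc, h, -⟩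
    exact ⟨a, ha, b, hb, c, hc, h⟩

theorem lt_iff_mem {a b c a' b' c' : Obj} (ha : Mem x a .omega) (hb : Mem x b .omega)
    (hc : Mem x c .omega) (ha' : Mem x a' .omega) (hb' : Mem x b' .omega) (hc' : Mem x c' .omega) :
    (nat x a - nat x b) / (nat x c + 1) < (nat x a' - nat x b') / (nat x c' + 1) ↔
    Mem x (.add (.mul a (.succ c')) (.mul b' (.succ c)))
      (.add (.mul a' (.succ c)) (.mul b (.succ c'))) := by
  have h₁ := succ_mem_omega hc
  have h₂ := succ_mem_omega hc'
  rw [← nat_lt_nat (add_mem_omega (mul_mem_omega ha h₂) (mul_mem_omega hb' h₁))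
    (add_mem_omega (mul_mem_omega ha' h₁) (mul_mem_omega hb h₂)),
    nat_add (mul_mem_omega ha h₂) (mul_mem_omega hb' h₁),
    nat_add (mul_mem_omega ha' h₁) (mul_mem_omega hb h₂), nat_mul ha h₂, nat_mul hb' h₁,
    nat_mul ha' h₁, nat_mul hb h₂, nat_succ hc, nat_succ hc',
    div_lt_div_iff₀ nat_add_one_pos nat_add_one_pos]
  constructor <;> intro h <;> linarith

/-- `p < q` for codes of rational numbers. -/
def RLt (x : Point) (p q : Obj) : Prop := ∃ k l, Code x p k ∧ Code x q l ∧ k < l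

@[simp] theorem sat_RatLt {s t : Tm n} :
    Sat x (RatLt s t) v ↔ RLt x (s.eval v) (t.eval v) := by
  simp only [RLt, RatLt, sat_ExIn, sat_eq, sat_and, sat_mem, eval_omega, eval_frac, eval_lift,
    eval_var, Matrix.cons_val_zero, eval_succ, eval_add, eval_mul]
  constructor
  · rintro ⟨a, ha, b, hb, c, hc, a', ha', b', hb', c', hc', h, h', hlt⟩
    exact ⟨_, _, ⟨a, b, c, ha, hb, hc, h, rfl⟩, ⟨a', b', c', ha', hb', hc', h', rfl⟩,
      (lt_iff_mem ha hb hc ha' hb' hc').2 hlt⟩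
  · rintro ⟨_, _, ⟨a, b, c, ha, hb, hc, h, rfl⟩, ⟨a', b', c', ha', hb', hc', h', rfl⟩, hlt⟩
    exact ⟨a, ha, b, hb, c, hc, a', ha', b', hb', c', hc', h, h',
      (lt_iff_mem ha hb hc ha' hb' hc').1 hlt⟩

/-- The object `s` is the code of the sum computed from the codes `p` and `q`. -/
def RAdd (x : Point) (p q s : Obj) : Prop := Sat x (RatAdd (.var 0) (.var 1) (.var 2)) ![p, q, s]

@[simp] theorem sat_RatAdd {s t u : Tm n} : Sat x (RatAdd s t u) v ↔
    RAdd x (s.eval v) (t.eval v) (u.eval v) := by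
  simp only [RAdd, RatAdd, sat_ExIn, sat_eq, sat_and, eval_omega, eval_frac, eval_lift,
    eval_var, Matrix.cons_val_zero, eval_succ, eval_add, eval_mul, Matrix.cons_val]

theorem RAdd.code {p q s : Obj} (h : RAdd x p q s) :
    ∃ k l, Code x p k ∧ Code x q l ∧ Code x s (k + l) := by
  simp only [RAdd, RatAdd, sat_ExIn, sat_eq, sat_and, eval_omega, eval_frac, eval_lift,
    eval_var, Matrix.cons_val_zero, eval_succ, eval_add, eval_mul, Matrix.cons_val] at h
  obtain ⟨a, ha, b, hb, c, hc, a', ha', b', hb', c', hc', h, h', h''⟩ := h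
  have h₁ := succ_mem_omega hc
  have h₂ := succ_mem_omega hc'
  refine ⟨_, _, ⟨a, b, c, ha, hb, hc, h, rfl⟩, ⟨a', b', c', ha', hb', hc', h', rfl⟩, _, _, _,
    add_mem_omega (mul_mem_omega ha h₂) (mul_mem_omega ha' h₁),
    add_mem_omega (mul_mem_omega hb h₂) (mul_mem_omega hb' h₁),
    add_mem_omega (mul_mem_omega hc hc') (add_mem_omega hc hc'), h'', ?_⟩
  rw [nat_add (mul_mem_omega ha h₂) (mul_mem_omega ha' h₁),
    nat_add (mul_mem_omega hb h₂) (mul_mem_omega hb' h₁),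
    nat_add (mul_mem_omega hc hc') (add_mem_omega hc hc'), nat_add hc hc', nat_mul ha h₂,
    nat_mul ha' h₁, nat_mul hb h₂, nat_mul hb' h₁, nat_mul hc hc', nat_succ hc, nat_succ hc']
  have h₃ : nat x c + 1 ≠ 0 := nat_add_one_pos.ne'
  have h₄ : nat x c' + 1 ≠ 0 := nat_add_one_pos.ne'
  rw [show nat x c * nat x c' + (nat x c + nat x c') + 1 = (nat x c + 1) * (nat x c' + 1) by ring,
    div_add_div _ _ h₃ h₄]
  congr 1; ring

theorem exists_rAdd {p q : Obj} {k l : K x} (hp : Code x p k) (hq : Code x q l) :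
    ∃ s, RAdd x p q s := by
  obtain ⟨a, b, c, ha, hb, hc, h, -⟩ := hp
  obtain ⟨a', b', c', ha', hb', hc', h', -⟩ := hq
  refine ⟨.frac (.add (.mul a (.succ c')) (.mul a' (.succ c)))
        (.add (.mul b (.succ c')) (.mul b' (.succ c))) (.add (.mul c c') (.add c c')), ?_⟩
  simp only [RAdd, RatAdd, sat_ExIn, sat_eq, sat_and, eval_omega, eval_frac, eval_lift,
    eval_var, Matrix.cons_val_zero, eval_succ, eval_add, eval_mul, Matrix.cons_val]
  exact ⟨a, ha, b, hb, c, hc, a', ha', b', hb', c', hc', h, h', .refl _ _⟩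

end

/-! ### Germs of rational numbers -/

/-- The family `E` of rational numbers is given near the point `x` by one code. -/
def Germ (x : Point) (E : ∀ y, K y) : Prop := ∃ a b c, ∀ᶠ y in 𝓝 x, Mem y a .omega ∧
  Mem y b .omega ∧ Mem y c .omega ∧ E y = (nat y a - nat y b) / (nat y c + 1)

namespace Germ

variable {x : Point} {E F : ∀ y, K y}

theorem nat {a : Obj} (h : Mem x a .omega) : Germ x fun y => nat y a := by
  refine ⟨a, .empty, .empty, ?_⟩
  filter_upwards [h.eventually] with y h
  simp [h, zero_mem_omega]

theorem one_div {c : Obj} (h : Mem x c .omega) : Germ x fun y => 1 / (BISH.nat y c + 1) := by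
  refine ⟨.succ .empty, .empty, c, ?_⟩
  filter_upwards [h.eventually] with y h
  simp [h, zero_mem_omega, nat_succ, succ_mem_omega]

theorem zero : Germ x fun _ => 0 := by simpa using nat (x := x) zero_mem_omega

theorem one : Germ x fun _ => 1 := by simpa using one_div (x := x) zero_mem_omega

theorem neg (h : Germ x E) : Germ x fun y => -E y := by
  obtain ⟨a, b, c, h⟩ := h
  refine ⟨b, a, c, ?_⟩
  filter_upwards [h] with y ⟨ha, hb, hc, h⟩
  exact ⟨hb, ha, hc, by rw [h]; ring⟩

theorem add (h : Germ x E) (h' : Germ x F) : Germ x fun y => E y + F y := by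
  obtain ⟨a, b, c, h⟩ := h
  obtain ⟨a', b', c', h'⟩ := h'
  refine ⟨.add (.mul a (.succ c')) (.mul a' (.succ c)),
    .add (.mul b (.succ c')) (.mul b' (.succ c)), .add (.mul c c') (.add c c'), ?_⟩
  filter_upwards [h, h'] with y ⟨ha, hb, hc, h⟩ ⟨ha', hb', hc', h'⟩
  have h₁ := succ_mem_omega hc
  have h₂ := succ_mem_omega hc'
  refine ⟨add_mem_omega (mul_mem_omega ha h₂) (mul_mem_omega ha' h₁),
    add_mem_omega (mul_mem_omega hb h₂) (mul_mem_omega hb' h₁),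
    add_mem_omega (mul_mem_omega hc hc') (add_mem_omega hc hc'), ?_⟩
  rw [h, h', nat_add (mul_mem_omega ha h₂) (mul_mem_omega ha' h₁),
    nat_add (mul_mem_omega hb h₂) (mul_mem_omega hb' h₁),
    nat_add (mul_mem_omega hc hc') (add_mem_omega hc hc'), nat_add hc hc', nat_mul ha h₂,
    nat_mul ha' h₁, nat_mul hb h₂, nat_mul hb' h₁, nat_mul hc hc', nat_succ hc, nat_succ hc']
  rw [show BISH.nat y c * BISH.nat y c' + (BISH.nat y c + BISH.nat y c') + 1 =
      (BISH.nat y c + 1) * (BISH.nat y c' + 1) by ring,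
    div_add_div _ _ nat_add_one_pos.ne' nat_add_one_pos.ne']
  congr 1; ring

theorem sub (h : Germ x E) (h' : Germ x F) : Germ x fun y => E y - F y := by
  simpa only [sub_eq_add_neg] using h.add h'.neg

theorem mul (h : Germ x E) (h' : Germ x F) : Germ x fun y => E y * F y := by
  obtain ⟨a, b, c, h⟩ := h
  obtain ⟨a', b', c', h'⟩ := h'
  refine ⟨.add (.mul a a') (.mul b b'), .add (.mul a b') (.mul b a'),
    .add (.mul c c') (.add c c'), ?_⟩
  filter_upwards [h, h'] with y ⟨ha, hb, hc, h⟩ ⟨ha', hb', hc', h'⟩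
  refine ⟨add_mem_omega (mul_mem_omega ha ha') (mul_mem_omega hb hb'),
    add_mem_omega (mul_mem_omega ha hb') (mul_mem_omega hb ha'),
    add_mem_omega (mul_mem_omega hc hc') (add_mem_omega hc hc'), ?_⟩
  rw [h, h', nat_add (mul_mem_omega ha ha') (mul_mem_omega hb hb'),
    nat_add (mul_mem_omega ha hb') (mul_mem_omega hb ha'),
    nat_add (mul_mem_omega hc hc') (add_mem_omega hc hc'), nat_add hc hc', nat_mul ha ha',
    nat_mul hb hb', nat_mul ha hb', nat_mul hb ha', nat_mul hc hc']
  rw [show BISH.nat y c * BISH.nat y c' + (BISH.nat y c + BISH.nat y c') + 1 =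
      (BISH.nat y c + 1) * (BISH.nat y c' + 1) by ring, div_mul_div_comm]
  congr 1; ring

/-- After clearing denominators, the inequality is a membership between natural numbers, and
membership persists to a neighbourhood. With the analogous rule for equality this makes the order of
rational numbers decidable in the model. -/
theorem lt (h : Germ x E) (h' : Germ x F) (hlt : E x < F x) : ∀ᶠ y in 𝓝 x, E y < F y := by
  obtain ⟨a, b, c, h⟩ := h
  obtain ⟨a', b', c', h'⟩ := h'
  obtain ⟨ha, hb, hc, e⟩ := h.self_of_nhds
  obtain ⟨ha', hb', hc', e'⟩ := h'.self_of_nhds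
  rw [e, e', lt_iff_mem ha hb hc ha' hb' hc'] at hlt
  filter_upwards [h, h', hlt.eventually] with y ⟨ha, hb, hc, e⟩ ⟨ha', hb', hc', e'⟩ hlt
  rwa [e, e', lt_iff_mem ha hb hc ha' hb' hc']

theorem eq (h : Germ x E) (h' : Germ x F) (he : E x = F x) : ∀ᶠ y in 𝓝 x, E y = F y := by
  obtain ⟨a, b, c, h⟩ := h.sub h'
  obtain ⟨ha, hb, hc, e⟩ := h.self_of_nhds
  dsimp only at e
  rw [he, sub_self, eq_comm, div_eq_zero_iff, or_iff_left nat_add_one_pos.ne', sub_eq_zero,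
    nat_eq_nat ha hb] at e
  filter_upwards [h, e.eventually] with y ⟨ha, hb, hc, h⟩ e
  rw [(nat_eq_nat ha hb).2 e, sub_self, zero_div, sub_eq_zero] at h
  exact h

theorem le (h : Germ x E) (h' : Germ x F) (hle : E x ≤ F x) : ∀ᶠ y in 𝓝 x, E y ≤ F y :=
  hle.lt_or_eq.elim (fun hlt => (h.lt h' hlt).mono fun _ => le_of_lt)
    fun he => (h.eq h' he).mono fun _ => le_of_eq

end Germ

open Classical in
/-- The value of a code of a rational number. -/
noncomputable def rat (x : Point) (q : Obj) : K x :=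
  if h : ∃ k, Code x q k then h.choose else 0

section

variable {x : Point} {p q s : Obj} {k : K x}

theorem Code.rat_eq (h : Code x q k) : rat x q = k := by
  have h' : ∃ k, Code x q k := ⟨k, h⟩
  rw [rat, dif_pos h']
  exact h'.choose_spec.unique h

theorem Code.code_rat (h : Code x q k) : Code x q (rat x q) := by
  rwa [h.rat_eq]

theorem Code.eventually (h : Code x q k) : ∀ᶠ y in 𝓝 x, Code y q (rat y q) := by
  obtain ⟨a, b, c, ha, hb, hc, h, -⟩ := h
  filter_upwards [ha.eventually, hb.eventually, hc.eventually, h.eventually] with y ha hb hc h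
  exact Code.code_rat ⟨a, b, c, ha, hb, hc, h, rfl⟩

theorem Code.germ (h : Code x q k) : Germ x fun y => rat y q := by
  obtain ⟨a, b, c, ha, hb, hc, h, -⟩ := h
  refine ⟨a, b, c, ?_⟩
  filter_upwards [ha.eventually, hb.eventually, hc.eventually, h.eventually] with y ha hb hc h
  exact ⟨ha, hb, hc, Code.rat_eq ⟨a, b, c, ha, hb, hc, h, rfl⟩⟩

theorem Germ.exists_code {E : ∀ y, K y} (h : Germ x E) : ∃ q, ∀ᶠ y in 𝓝 x, Code y q (E y) := by
  obtain ⟨a, b, c, h⟩ := h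
  refine ⟨.frac a b c, ?_⟩
  filter_upwards [h] with y ⟨ha, hb, hc, h⟩
  rw [h]
  exact code_frac ha hb hc

theorem exists_germ (k : K x) : ∃ E, Germ x E ∧ E x = k := by
  obtain ⟨q, hq⟩ := BISH.exists_code k
  exact ⟨_, hq.germ, hq.rat_eq⟩

theorem rLt_iff {l : K x} (hp : Code x p k) (hq : Code x q l) : RLt x p q ↔ k < l :=
  ⟨fun ⟨_, _, h₁, h₂, h⟩ => by rwa [hp.unique h₁, hq.unique h₂], fun h => ⟨_, _, hp, hq, h⟩⟩

end

end BISH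

namespace BISH
open Filter Topology

/-! ### Real numbers at a point -/

/-- The real numbers at a point. -/
def RealAt (x : Point) (a : Obj) : Prop := Sat x (IsReal (.var 0)) ![a]

section

variable {x : Point} {n : ℕ} {v : Fin n → Obj} {a b : Obj}

theorem sat_IsReal_iff {t : Tm n} : Sat x (IsReal t) v ↔
    (∀ᶠ y in 𝓝 x, ∀ q, Mem y q (t.eval v) → ∃ k, Code y q k) ∧ (∃ q, Mem x q (t.eval v)) ∧
    (∃ p, (∃ k, Code x p k) ∧ ∀ᶠ y in 𝓝 x, ¬ Mem y p (t.eval v)) ∧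
    (∀ᶠ y in 𝓝 x, ∀ q, Mem y q (t.eval v) → ∃ p, Mem y p (t.eval v) ∧ RLt y p q) ∧
    (∀ᶠ y in 𝓝 x, ∀ p, Mem y p (t.eval v) → ∀ q, RLt y p q → Mem y q (t.eval v)) ∧
    (∀ᶠ y in 𝓝 x, ∀ p q, RLt y p q →
      (∀ᶠ z in 𝓝 y, ¬ Mem z p (t.eval v)) ∨ Mem y q (t.eval v)) := by
  simp [IsReal]

@[simp] theorem sat_IsReal {t : Tm n} : Sat x (IsReal t) v ↔ RealAt x (t.eval v) := by
  rw [RealAt, sat_IsReal_iff, sat_IsReal_iff]; rfl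

theorem RealAt.eventually (h : RealAt x a) : ∀ᶠ y in 𝓝 x, RealAt y a := Sat.eventually h

theorem Eqv.realAt (h : Eqv x a b) (ha : RealAt x a) : RealAt x b := by
  simpa using h.sat (IsReal (.var 0)) (v := ![]) (by simpa using ha)

/-- `a < k` for a real number `a` and a rational number `k`. -/
def Up (x : Point) (a : Obj) (k : K x) : Prop := ∃ q, Code x q k ∧ Mem x q a

/-- `k ≤ a` for a real number `a` and a rational number `k`. -/
def Lo (x : Point) (a : Obj) (k : K x) : Prop := ∃ q, Code x q k ∧ ∀ᶠ y in 𝓝 x, ¬ Mem y q a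

variable {k l : K x} {p q : Obj}

theorem RealAt.code (ha : RealAt x a) (hq : Mem x q a) : ∃ k, Code x q k :=
  (sat_IsReal_iff.1 ha).1.self_of_nhds q hq

theorem RealAt.exists_up (ha : RealAt x a) : ∃ k, Up x a k := by
  obtain ⟨q, hq⟩ := (sat_IsReal_iff.1 ha).2.1
  obtain ⟨k, hk⟩ := ha.code hq
  exact ⟨k, q, hk, hq⟩

theorem RealAt.exists_lo (ha : RealAt x a) : ∃ k, Lo x a k := by
  obtain ⟨q, ⟨k, hk⟩, hq⟩ := (sat_IsReal_iff.1 ha).2.2.1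
  exact ⟨k, q, hk, hq⟩

theorem Up.exists_lt (hk : Up x a k) (ha : RealAt x a) : ∃ l < k, Up x a l := by
  obtain ⟨q, hq, h⟩ := hk
  obtain ⟨p, hp, l, k', hl, hk', hlt⟩ := (sat_IsReal_iff.1 ha).2.2.2.1.self_of_nhds q h
  exact ⟨l, by rwa [hq.unique hk'], p, hl, hp⟩

theorem RealAt.mem_of_lt (ha : RealAt x a) (hp : Mem x p a) (h : RLt x p q) : Mem x q a :=
  (sat_IsReal_iff.1 ha).2.2.2.2.1.self_of_nhds p hp q h

theorem Up.mem (hk : Up x a k) (ha : RealAt x a) (hq : Code x q k) : Mem x q a := by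
  obtain ⟨l, hl, p, hp, h⟩ := hk.exists_lt ha
  exact ha.mem_of_lt h ⟨_, _, hp, hq, hl⟩

theorem RealAt.up_iff (ha : RealAt x a) (hq : Code x q k) : Up x a k ↔ Mem x q a :=
  ⟨fun h => h.mem ha hq, fun h => ⟨q, hq, h⟩⟩

theorem Up.mono (hk : Up x a k) (ha : RealAt x a) (h : k ≤ l) : Up x a l := by
  rcases h.eq_or_lt with rfl | h
  · exact hk
  obtain ⟨q, hq⟩ := exists_code l
  obtain ⟨p, hp, h'⟩ := hk
  exact ⟨q, hq, ha.mem_of_lt h' ⟨_, _, hp, hq, h⟩⟩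

/-- A rational number has many codes. Two codes with the same value at x have the same value near x,
and a real number contains both or neither. -/
theorem Lo.not_mem (hk : Lo x a k) (ha : RealAt x a) (hq : Code x q k) :
    ∀ᶠ y in 𝓝 x, ¬ Mem y q a := by
  obtain ⟨p, hp, h⟩ := hk
  filter_upwards [h, ha.eventually, hp.eventually, hq.eventually,
    hp.germ.eq hq.germ (by rw [hp.rat_eq, hq.rat_eq])] with y h ha hp hq e h'
  exact h (Up.mem ⟨q, hq, h'⟩ ha (e ▸ hp))

theorem RealAt.lo_iff (ha : RealAt x a) (hq : Code x q k) :
    Lo x a k ↔ ∀ᶠ y in 𝓝 x, ¬ Mem y q a :=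
  ⟨fun h => h.not_mem ha hq, fun h => ⟨q, hq, h⟩⟩

theorem Lo.lt_of_up (hk : Lo x a k) (hl : Up x a l) (ha : RealAt x a) : k < l := by
  by_contra! h
  obtain ⟨q, hq, h'⟩ := hk
  exact h'.self_of_nhds ((hl.mono ha h).mem ha hq)

theorem Lo.mono (hk : Lo x a k) (ha : RealAt x a) (h : l ≤ k) : Lo x a l := by
  obtain ⟨p, hp⟩ := exists_code l
  obtain ⟨q, hq, h'⟩ := hk
  refine ⟨p, hp, ?_⟩
  filter_upwards [h', ha.eventually, hp.eventually, hq.eventually,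
    hp.germ.le hq.germ (by rwa [hp.rat_eq, hq.rat_eq])] with y h' ha hp hq e h
  exact h' ((Up.mono ⟨p, hp, h⟩ ha e).mem ha hq)

theorem RealAt.located (ha : RealAt x a) (h : k < l) : Lo x a k ∨ Up x a l := by
  obtain ⟨p, hp⟩ := exists_code k
  obtain ⟨q, hq⟩ := exists_code l
  rcases (sat_IsReal_iff.1 ha).2.2.2.2.2.self_of_nhds p q ⟨_, _, hp, hq, h⟩ with h | h
  · exact .inl ⟨p, hp, h⟩
  · exact .inr ⟨q, hq, h⟩

theorem Up.eventually {E : ∀ y, K y} (h : Up x a (E x)) (ha : RealAt x a) (hE : Germ x E) :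
    ∀ᶠ y in 𝓝 x, Up y a (E y) := by
  obtain ⟨q, hq⟩ := hE.exists_code
  filter_upwards [hq, (h.mem ha hq.self_of_nhds).eventually] with y hq h
  exact ⟨q, hq, h⟩

theorem Lo.eventually {E : ∀ y, K y} (h : Lo x a (E x)) (ha : RealAt x a) (hE : Germ x E) :
    ∀ᶠ y in 𝓝 x, Lo y a (E y) := by
  obtain ⟨q, hq⟩ := hE.exists_code
  filter_upwards [hq, (h.not_mem ha hq.self_of_nhds).eventually_nhds] with y hq h
  exact ⟨q, hq, h⟩

theorem lo_of_eventually {E : ∀ y, K y} (hE : Germ x E) (h : ∀ᶠ y in 𝓝 x, ¬ Up y a (E y)) :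
    Lo x a (E x) := by
  obtain ⟨q, hq⟩ := hE.exists_code
  refine ⟨q, hq.self_of_nhds, ?_⟩
  filter_upwards [hq, h] with y hq h h'
  exact h ⟨q, hq, h'⟩

/-- Real numbers have rational approximations. -/
theorem RealAt.approx (ha : RealAt x a) {ε : K x}
    (hε : 0 < ε) : ∃ k, Lo x a k ∧ Up x a (k + ε) := by
  -- The real number is searched on the grid of points (j - b) / (c + 1): two cells are shorter than
  -- ε, the grid starts below l₀, and its m-th point lies above u₀.
  obtain ⟨c, hc, hcε⟩ := exists_one_div_lt (half_pos hε)
  obtain ⟨l₀, hl₀⟩ := ha.exists_lo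
  obtain ⟨u₀, hu₀⟩ := ha.exists_up
  obtain ⟨b, hb, hbl⟩ := exists_nat_gt (-l₀ * (nat x c + 1))
  obtain ⟨m, hm, hmu⟩ := exists_nat_gt (u₀ * (nat x c + 1) + nat x b)
  -- The number of grid points need not be a standard natural number, so the search is an induction
  -- inside the model and has to be a formula: either two adjacent cells enclosing a have been
  -- found, or the m-th grid point is still below a.
  have key : ∀ y m, RealAt y a → Mem y b .omega → Mem y c .omega → Mem y m .omega →
      (Sat y ((ExIn .omega fun j => neg (frac j (.var 3) (.var 4) ∈ₛ .var 2) ⋏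
        frac (succ (succ j)) (.var 3) (.var 4) ∈ₛ .var 2) ⋎
        neg (frac (.var 0) (.var 2) (.var 3) ∈ₛ .var 1)) ![m, a, b, c] ↔
      (∃ j, Mem y j .omega ∧ Lo y a ((nat y j - nat y b) / (nat y c + 1)) ∧
        Up y a ((nat y j + 1 + 1 - nat y b) / (nat y c + 1))) ∨
      Lo y a ((nat y m - nat y b) / (nat y c + 1))) := by
    intro y m ha hb hc hm
    simp only [sat_or, sat_ExIn, sat_and, sat_neg, sat_mem, eval_frac, eval_var, eval_succ,
      eval_omega, Matrix.cons_val, Matrix.cons_val_zero]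
    rw [← ha.lo_iff (code_frac hm hb hc)]
    refine or_congr_left (exists_congr fun j => and_congr_right fun hj => ?_)
    rw [← ha.lo_iff (code_frac hj hb hc),
      ← ha.up_iff (code_frac (succ_mem_omega (succ_mem_omega hj)) hb hc),
      nat_succ (succ_mem_omega hj), nat_succ hj]
  have h := (key x m ha hb hc hm).1 (omega_induction _ ((key x _ ha hb hc zero_mem_omega).2
    (.inr (hl₀.mono ha ?_))) ?_ hm)
  · rcases h with ⟨j, hj, h₁, h₂⟩ | h
    · refine ⟨_, h₁, h₂.mono ha ?_⟩
      have : (nat x j + 1 + 1 - nat x b) / (nat x c + 1) =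
        (nat x j - nat x b) / (nat x c + 1) + (1 / (nat x c + 1) + 1 / (nat x c + 1)) := by ring
      rw [this]; linarith
    · have := h.lt_of_up hu₀ ha
      rw [div_lt_iff₀ nat_add_one_pos] at this
      linarith
  · rw [nat_empty, div_le_iff₀ nat_add_one_pos]
    linarith
  · filter_upwards [ha.eventually, hb.eventually, hc.eventually] with y ha hb hc m hm ih
    refine (key y _ ha hb hc (succ_mem_omega hm)).2 ?_
    rcases (key y _ ha hb hc hm).1 ih with h | h
    · exact .inl h
    rw [nat_succ hm]
    -- Locatedness compares a with the next two grid points; hence cells of double length.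
    rcases ha.located (k := (nat y m + 1 - nat y b) / (nat y c + 1))
      (l := (nat y m + 1 + 1 - nat y b) / (nat y c + 1)) (by
        rw [div_lt_div_iff_of_pos_right nat_add_one_pos]
        linarith) with h' | h'
    · exact .inr h'
    · exact .inl ⟨m, hm, h, h'⟩

end

/-! ### Distances of real numbers -/

/-- `|a - b| < r` for real numbers `a` and `b` and a rational number `r`. -/
def Dist (x : Point) (a b : Obj) (r : K x) : Prop :=
  ∃ k, Lo x a k ∧ Lo x b k ∧ Up x a (k + r) ∧ Up x b (k + r)

/-- `|a - b| < r` for real numbers `a` and `b` and the code `r` of a rational number. -/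
def ADist (x : Point) (a b r : Obj) : Prop :=
  Sat x (AbsSubLt (.var 0) (.var 1) (.var 2)) ![a, b, r]

section

variable {x : Point} {n : ℕ} {v : Fin n → Obj} {a b c q : Obj} {k l r r' : K x}

theorem sat_AbsSubLt_iff {s t u : Tm n} :
    Sat x (AbsSubLt s t u) v ↔ ∃ p s', RAdd x p (u.eval v) s' ∧
    (∀ᶠ y in 𝓝 x, ¬ Mem y p (s.eval v)) ∧ (∀ᶠ y in 𝓝 x, ¬ Mem y p (t.eval v)) ∧
    Mem x s' (s.eval v) ∧ Mem x s' (t.eval v) := by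
  simp [AbsSubLt]

@[simp] theorem sat_AbsSubLt {s t u : Tm n} :
    Sat x (AbsSubLt s t u) v ↔ ADist x (s.eval v) (t.eval v) (u.eval v) := by
  rw [ADist, sat_AbsSubLt_iff, sat_AbsSubLt_iff]; rfl

@[simp] theorem Loc.aDist (a b r : Obj) : Loc fun x => ADist x a b r :=
  fun _ h => Sat.eventually h

theorem ADist.code (h : ADist x a b q) : ∃ k, Code x q k := by
  obtain ⟨p, s, h, -⟩ := sat_AbsSubLt_iff.1 h
  obtain ⟨_, k, -, hk, -⟩ := h.code
  exact ⟨k, hk⟩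

theorem aDist_iff (ha : RealAt x a) (hb : RealAt x b) (hq : Code x q r) :
    ADist x a b q ↔ Dist x a b r := by
  rw [ADist, sat_AbsSubLt_iff]
  constructor
  · rintro ⟨p, s, h, h₁, h₂, h₃, h₄⟩
    obtain ⟨k, l, hk, hl, hs⟩ := h.code
    obtain rfl := hl.unique hq
    exact ⟨k, ⟨p, hk, h₁⟩, ⟨p, hk, h₂⟩, ⟨s, hs, h₃⟩, ⟨s, hs, h₄⟩⟩
  · rintro ⟨k, h₁, h₂, h₃, h₄⟩
    obtain ⟨p, hp⟩ := exists_code k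
    obtain ⟨s, hs⟩ := exists_rAdd hp hq
    obtain ⟨k', l, hk, hl, h⟩ := hs.code
    obtain rfl := hk.unique hp
    obtain rfl := hl.unique hq
    exact ⟨p, s, hs, h₁.not_mem ha hp, h₂.not_mem hb hp, h₃.mem ha h, h₄.mem hb h⟩

theorem Dist.symm (h : Dist x a b r) : Dist x b a r := by
  obtain ⟨k, h₁, h₂, h₃, h₄⟩ := h
  exact ⟨k, h₂, h₁, h₄, h₃⟩

theorem Dist.pos (h : Dist x a b r) (ha : RealAt x a) : 0 < r := by
  obtain ⟨k, h₁, h₂, h₃, h₄⟩ := h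
  linarith [h₁.lt_of_up h₃ ha]

theorem Dist.mono (h : Dist x a b r) (ha : RealAt x a) (hb : RealAt x b) (hr : r ≤ r') :
    Dist x a b r' := by
  obtain ⟨k, h₁, h₂, h₃, h₄⟩ := h
  exact ⟨k, h₁, h₂, h₃.mono ha (by linarith), h₄.mono hb (by linarith)⟩

theorem Dist.exists_lt (h : Dist x a b r) (ha : RealAt x a) (hb : RealAt x b) :
    ∃ r' < r, Dist x a b r' := by
  obtain ⟨k, h₁, h₂, h₃, h₄⟩ := h
  obtain ⟨l, hl, h₃⟩ := h₃.exists_lt ha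
  obtain ⟨l', hl', h₄⟩ := h₄.exists_lt hb
  exact ⟨max l l' - k, by rw [sub_lt_iff_lt_add']; exact max_lt hl hl', k, h₁, h₂,
    h₃.mono ha (by linarith [le_max_left l l']), h₄.mono hb (by linarith [le_max_right l l'])⟩

theorem RealAt.dist_self (ha : RealAt x a) (hr : 0 < r) : Dist x a a r := by
  obtain ⟨k, h₁, h₂⟩ := ha.approx hr
  exact ⟨k, h₁, h₁, h₂, h₂⟩

/-- The intervals of lengths r and r' that enclose a, b and b, c both contain b. They overlap, and
an interval of length r + r' starting at the smaller left end covers both. -/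
theorem Dist.triangle (h : Dist x a b r) (h' : Dist x b c r') (ha : RealAt x a) (hb : RealAt x b)
    (hc : RealAt x c) : Dist x a c (r + r') := by
  have hr := h.pos ha
  have hr' := h'.pos hb
  obtain ⟨k, h₁, h₂, h₃, h₄⟩ := h
  obtain ⟨l, h₁', h₂', h₃', h₄'⟩ := h'
  have e₁ := h₂.lt_of_up h₃' hb
  have e₂ := h₁'.lt_of_up h₄ hb
  rcases le_total k l with hkl | hkl
  · exact ⟨k, h₁, h₂'.mono hc hkl, h₃.mono ha (by linarith), h₄'.mono hc (by linarith)⟩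
  · exact ⟨l, h₁.mono ha hkl, h₂', h₃.mono ha (by linarith), h₄'.mono hc (by linarith)⟩

theorem Up.of_dist (hk : Up x a k) (h : Dist x a b r) (ha : RealAt x a) (hb : RealAt x b) :
    Up x b (k + r) := by
  obtain ⟨l, h₁, h₂, h₃, h₄⟩ := h
  exact h₄.mono hb (by linarith [h₁.lt_of_up hk ha])

theorem Lo.of_dist (hk : Lo x a k) (h : Dist x a b r) (ha : RealAt x a) (hb : RealAt x b) :
    Lo x b (k - r) := by
  obtain ⟨l, h₁, h₂, h₃, h₄⟩ := h
  exact h₂.mono hb (by linarith [hk.lt_of_up h₃ ha])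

theorem Dist.eventually {E : ∀ y, K y} (h : Dist x a b (E x)) (ha : RealAt x a)
    (hb : RealAt x b) (hE : Germ x E) : ∀ᶠ y in 𝓝 x, Dist y a b (E y) := by
  obtain ⟨k, h₁, h₂, h₃, h₄⟩ := h
  obtain ⟨F, hF, rfl⟩ := exists_germ k
  filter_upwards [h₁.eventually ha hF, h₂.eventually hb hF,
    Up.eventually (E := fun y => F y + E y) h₃ ha (hF.add hE),
    Up.eventually (E := fun y => F y + E y) h₄ hb (hF.add hE)] with y h₁ h₂ h₃ h₄
  exact ⟨_, h₁, h₂, h₃, h₄⟩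

/-- Put ε = (r - E x) / 3 and enclose a in [k, k + ε) and b in [l, l + ε). If k and l are at least r
- ε apart, then a and b are at least r - 2 ε apart, which exceeds E x. Otherwise one interval of
length r encloses both. -/
theorem dist_located (ha : RealAt x a) (hb : RealAt x b) {E : ∀ y, K y} (hE : Germ x E)
    (h : E x < r) : (∀ᶠ y in 𝓝 x, ¬ Dist y a b (E y)) ∨ Dist x a b r := by
  have hε : 0 < (r - E x) / 3 := by linarith
  -- In this case E x ≤ 0, and no distance is smaller. The other case makes r long enough to cover
  -- an interval of length ε.
  by_cases hr : r ≤ (r - E x) / 3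
  · left
    filter_upwards [hE.le .zero (by linarith), ha.eventually] with y h ha h'
    linarith [h'.pos ha]
  rw [not_le] at hr
  obtain ⟨k, h₁, h₂⟩ := ha.approx hε
  obtain ⟨l, h₃, h₄⟩ := hb.approx hε
  have sep : ∀ {a b : Obj} {k l : K x}, RealAt x a → RealAt x b → Lo x b l →
      Up x a (k + (r - E x) / 3) → k + r - (r - E x) / 3 ≤ l →
      ∀ᶠ y in 𝓝 x, ¬ Dist y a b (E y) := by
    intro a b k l ha hb h₃ h₂ hkl
    obtain ⟨F, hF, e⟩ := exists_germ (k + (r - E x) / 3)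
    obtain ⟨G, hG, rfl⟩ := exists_germ l
    rw [← e] at h₂
    filter_upwards [h₂.eventually ha hF, h₃.eventually hb hG, (hF.add hE).le hG (by linarith),
      ha.eventually, hb.eventually] with y h₂ h₃ h ha hb hd
    linarith [h₃.lt_of_up (h₂.of_dist hd ha hb) hb]
  by_cases h₅ : k + r - (r - E x) / 3 ≤ l
  · exact .inl (sep ha hb h₃ h₂ h₅)
  by_cases h₆ : l + r - (r - E x) / 3 ≤ k
  · exact .inl ((sep hb ha h₁ h₄ h₆).mono fun y h h' => h h'.symm)
  right
  rw [not_le] at h₅ h₆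
  rcases le_total k l with hkl | hkl
  · exact ⟨k, h₁, h₃.mono hb hkl, h₂.mono ha (by linarith), h₄.mono hb (by linarith)⟩
  · exact ⟨l, h₁.mono ha hkl, h₃, h₂.mono ha (by linarith), h₄.mono hb (by linarith)⟩

/-- With a in [k, k + E), the number b is at least k - E and less than k + 2 E; the interval
enclosing both has length 3 E. -/
theorem dist_of_up {E : ∀ y, K y} (hE : Germ x E) (ha : RealAt x a) (hb : RealAt x b)
    (hpos : 0 < E x) (h : ∀ᶠ y in 𝓝 x, ∀ k, (Up y a k → Up y b (k + E y)) ∧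
      (Up y b k → Up y a (k + E y))) : Dist x a b (3 * E x) := by
  obtain ⟨k, h₁, h₂⟩ := ha.approx hpos
  obtain ⟨F, hF, rfl⟩ := exists_germ k
  refine ⟨F x - E x, h₁.mono ha (by linarith), ?_, h₂.mono ha (by linarith),
    ((h.self_of_nhds _).1 h₂).mono hb (by linarith)⟩
  refine lo_of_eventually (E := fun y => F y - E y) (hF.sub hE) ?_
  filter_upwards [h₁.eventually ha hF, h, ha.eventually] with y h₁ h ha h'
  have := h₁.lt_of_up ((h _).2 h') ha
  linarith

theorem RealAt.ext (ha : RealAt x a) (hb : RealAt x b)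
    (h : ∀ᶠ y in 𝓝 x, ∀ k, Up y a k ↔ Up y b k) : Eqv x a b := by
  refine .of_mem_iff ?_
  filter_upwards [h, ha.eventually, hb.eventually] with y h ha hb q
  constructor <;> intro hq
  · obtain ⟨k, hk⟩ := ha.code hq
    exact ((h k).1 ⟨q, hk, hq⟩).mem hb hk
  · obtain ⟨k, hk⟩ := hb.code hq
    exact ((h k).2 ⟨q, hk, hq⟩).mem ha hk

/-- A set of codes that is closed under `<` is real if it is a located cut. -/
theorem realAt_of (h₁ : ∀ᶠ y in 𝓝 x, ∀ q, Mem y q a → ∃ k, Code y q k) (h₂ : ∃ k, Up x a k)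
    (h₃ : ∃ k, Lo x a k) (h₄ : ∀ᶠ y in 𝓝 x, ∀ k, Up y a k → ∃ l < k, Up y a l)
    (h₅ : ∀ᶠ y in 𝓝 x, ∀ q k l, Up y a k → k < l → Code y q l → Mem y q a)
    (h₆ : ∀ᶠ y in 𝓝 x, ∀ (E : ∀ y, K y) l, Germ y E → E y < l →
      (∀ᶠ z in 𝓝 y, ¬ Up z a (E z)) ∨ Up y a l) : RealAt x a := by
  have mem : ∀ᶠ y in 𝓝 x, ∀ q k, Up y a k → Code y q k → Mem y q a := by
    filter_upwards [h₄, h₅] with y h₄ h₅ q k hk hq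
    obtain ⟨l, hl, h⟩ := h₄ k hk
    exact h₅ q l k h hl hq
  refine sat_IsReal_iff.2 ⟨h₁, ?_, ?_, ?_, ?_, ?_⟩
  · obtain ⟨k, q, -, hq⟩ := h₂
    exact ⟨q, hq⟩
  · obtain ⟨k, q, hk, hq⟩ := h₃
    exact ⟨q, ⟨k, hk⟩, hq⟩
  · filter_upwards [h₁, h₄] with y h₁ h₄ q hq
    obtain ⟨k, hk⟩ := h₁ q hq
    obtain ⟨l, hl, p, hp, h⟩ := h₄ k ⟨q, hk, hq⟩
    exact ⟨p, h, l, k, hp, hk, hl⟩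
  · filter_upwards [h₅] with y h₅ p hp q ⟨k, l, hk, hl, h⟩
    exact h₅ q k l ⟨p, hk, hp⟩ h hl
  · filter_upwards [h₆, mem] with y h₆ mem p q ⟨k, l, hk, hl, h⟩
    refine (h₆ _ l hk.germ (by rwa [hk.rat_eq])).imp (fun h => ?_) fun h => mem q l h hl
    filter_upwards [h, hk.eventually] with z h hk h'
    exact h ⟨p, hk, h'⟩

/-- Elements of the unit interval. -/
def UnitAt (x : Point) (a : Obj) : Prop := Sat x (InUnit (.var 0)) ![a]

theorem sat_InUnit_iff {t : Tm n} : Sat x (InUnit t) v ↔ RealAt x (t.eval v) ∧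
    (∀ᶠ y in 𝓝 x, ¬ Mem y (.frac .empty .empty .empty) (t.eval v)) ∧
    ∀ᶠ y in 𝓝 x, ∀ q, RLt y (.frac (.succ .empty) .empty .empty) q → Mem y q (t.eval v) := by
  simp [InUnit, ratZero, ratOne]

@[simp] theorem sat_InUnit {t : Tm n} : Sat x (InUnit t) v ↔ UnitAt x (t.eval v) := by
  rw [UnitAt, sat_InUnit_iff, sat_InUnit_iff]; rfl

@[simp] theorem Loc.unitAt (a : Obj) : Loc fun x => UnitAt x a := fun _ h => Sat.eventually h

theorem UnitAt.eventually (h : UnitAt x a) : ∀ᶠ y in 𝓝 x, UnitAt y a := Sat.eventually h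

theorem Eqv.unitAt (h : Eqv x a b) (ha : UnitAt x a) : UnitAt x b := by
  simpa using h.sat (InUnit (.var 0)) (v := ![]) (by simpa using ha)

theorem UnitAt.real (h : UnitAt x a) : RealAt x a := (sat_InUnit_iff.1 h).1

theorem UnitAt.up (h : UnitAt x a) (hk : 1 < k) : Up x a k := by
  obtain ⟨q, hq⟩ := exists_code k
  exact ⟨q, hq, (sat_InUnit_iff.1 h).2.2.self_of_nhds q ⟨1, k, code_one.2 rfl, hq, hk⟩⟩

end

end BISH

namespace BISH
open Filter Topology

/-! ### Construction of sets -/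

section

variable {x : Point} {n : ℕ} {v : Fin n → Obj} {a b c : Obj}

/-- The union of a definable family of sets indexed by a set. -/
theorem exists_iUnion (ψ : Fml (n + 2)) (h : ∀ᶠ y in 𝓝 x, ∀ d, Mem y d a →
      ∃ S, ∀ᶠ z in 𝓝 y, ∀ q, Mem z q S ↔ Sat z ψ (q ∷ d ∷ v)) :
    ∃ b, ∀ᶠ y in 𝓝 x, ∀ q, Mem y q b ↔ ∃ d, Mem y d a ∧ Sat y ψ (q ∷ d ∷ v) := by
  let σ : Fin (n + 2) → Tm (n + 3) :=
    Fin.cases (.var 0) (Fin.cases (.var 1) fun i => .var i.succ.succ.succ)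
  have key : ∀ y d S, Sat y (All fun q => iff (q ∈ₛ .var 2) (ψ.subst σ)) (d ∷ S ∷ v) ↔
      ∀ᶠ z in 𝓝 y, ∀ q, Mem z q S ↔ Sat z ψ (q ∷ d ∷ v) := by
    intro y d S
    have e : ∀ q, (fun i => (σ i).eval (q ∷ d ∷ S ∷ v)) = q ∷ d ∷ v := fun q => by
      funext i
      refine Fin.cases rfl (fun i => Fin.cases rfl (fun i => rfl) i) i
    simp [sat_subst, e]
  -- Strong collection gives a set each of whose elements is one of the sets in question, so its
  -- union contains nothing superfluous.
  obtain ⟨b, hb⟩ := collection (x := x) (a := a)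
    (All fun q => iff (q ∈ₛ .var 2) (ψ.subst σ)) (v := v) (by simpa only [key] using h)
  simp only [key] at hb
  refine ⟨.union b, ?_⟩
  filter_upwards [hb] with y ⟨h₁, h₂⟩ q
  rw [mem_union]
  constructor
  · rintro ⟨S, hS, hq⟩
    obtain ⟨d, hd, h⟩ := h₂ S hS
    exact ⟨d, hd, (h.self_of_nhds q).1 hq⟩
  · rintro ⟨d, hd, h⟩
    obtain ⟨S, hS, h'⟩ := h₁ d hd
    exact ⟨S, hS, (h'.self_of_nhds q).2 h⟩

/-- The graph of a definable function on a set. -/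
theorem exists_graph (ψ : Fml (n + 2)) (h : ∀ᶠ y in 𝓝 x, ∀ d, Mem y d a →
      ∃ u, Sat y ψ (d ∷ u ∷ v) ∧ ∀ᶠ z in 𝓝 y, ∀ u', Sat z ψ (d ∷ u' ∷ v) → Eqv z u' u) :
    ∃ f, ∀ᶠ y in 𝓝 x,
      (∀ p, Mem y p f → ∃ d u, Eqv y p (.opair d u) ∧ Mem y d a ∧ Sat y ψ (d ∷ u ∷ v)) ∧
      ∀ d u, Mem y (.opair d u) f ↔ Mem y d a ∧ Sat y ψ (d ∷ u ∷ v) := by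
  let σ : Fin (n + 2) → Tm (n + 3) :=
    Fin.cases (.var 2) (Fin.cases (.var 0) fun i => .var i.succ.succ.succ)
  have key : ∀ y p d, Sat y (Ex fun u => ψ.subst σ ⋏ .var 1 =ₛ opair (.var 2) u) (p ∷ d ∷ v) ↔
      ∃ u, Sat y ψ (d ∷ u ∷ v) ∧ Eqv y p (.opair d u) := by
    intro y p d
    have e : ∀ u, (fun i => (σ i).eval (u ∷ p ∷ d ∷ v)) = d ∷ u ∷ v := fun u => by
      funext i
      refine Fin.cases rfl (fun i => Fin.cases rfl (fun i => rfl) i) i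
    simp [sat_subst, e]
  -- The graph is the union of the singletons of the pairs ⟨d, u⟩, where u is unique near the point.
  obtain ⟨f, hf⟩ := exists_iUnion (x := x) (a := a) (v := v)
    (Ex fun u => ψ.subst σ ⋏ .var 1 =ₛ opair (.var 2) u) (by
      filter_upwards [h] with y h d hd
      obtain ⟨u, hu, hu'⟩ := h d hd
      refine ⟨.upair (.opair d u) (.opair d u), ?_⟩
      simp only [key]
      filter_upwards [hu.eventually, hu'] with z hu hu' p
      rw [mem_upair, or_self]
      refine ⟨fun h => ⟨u, hu, h⟩, fun ⟨u', h, h'⟩ => ?_⟩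
      exact h'.trans ((Eqv.refl _ _).opair (hu' u' h)))
  simp only [key] at hf
  refine ⟨f, ?_⟩
  filter_upwards [hf] with y hf
  refine ⟨fun p hp => ?_, fun d u => ?_⟩
  · obtain ⟨d, hd, u, hu, h⟩ := (hf p).1 hp
    exact ⟨d, u, h, hd, hu⟩
  · rw [hf]
    constructor
    · rintro ⟨d', hd, u', hu, h⟩
      obtain ⟨h₁, h₂⟩ := eqv_opair.1 h
      refine ⟨h₁.mem_left.2 hd, h₁.symm.sat _ ?_⟩
      let τ : Fin (n + 2) → Tm (n + 2) :=
        Fin.cases (.var 1) (Fin.cases (.var 0) fun i => .var i.succ.succ)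
      have e : ∀ d u, (fun i => (τ i).eval (u ∷ d ∷ v)) = d ∷ u ∷ v := fun d u => by
        funext i
        refine Fin.cases rfl (fun i => Fin.cases rfl (fun i => rfl) i) i
      have := h₂.symm.sat (ψ.subst τ) (v := d' ∷ v) (by rwa [sat_subst, e])
      rwa [sat_subst, e] at this
    · rintro ⟨hd, hu⟩
      exact ⟨d, hd, u, hu, .refl _ _⟩

theorem exists_pairs (x : Point) (a b : Obj) : ∃ c, ∀ᶠ y in 𝓝 x, ∀ p, Mem y p c ↔
    ∃ d, Mem y d a ∧ ∃ e, Mem y e b ∧ Eqv y p (.opair d e) := by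
  have h₁ := fun y d => exists_iUnion (x := y) (a := b) (.var 0 =ₛ opair (.var 2) (.var 1))
    (v := ![d]) (.of_forall fun y e _ => ⟨.upair (.opair d e) (.opair d e), .of_forall fun z q => by
      simp [mem_upair]⟩)
  obtain ⟨c, hc⟩ := exists_iUnion (x := x) (a := a)
    (ExIn (.var 2) fun e => .var 1 =ₛ opair (.var 2) e) (v := ![b])
    (.of_forall fun y d _ => by simpa using h₁ y d)
  exact ⟨c, by simpa using hc⟩

/-- The set of codes of rational numbers. -/
theorem exists_rationals (x : Point) :
    ∃ Q, ∀ᶠ y in 𝓝 x, ∀ q, Mem y q Q ↔ ∃ k, Code y q k := by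
  obtain ⟨P, hP⟩ := exists_pairs x .omega .omega
  obtain ⟨Q, hQ⟩ := exists_pairs x P .omega
  refine ⟨Q, ?_⟩
  filter_upwards [hP, hQ] with y hP hQ q
  rw [hQ]
  constructor
  · rintro ⟨d, hd, c, hc, h⟩
    obtain ⟨a, ha, b, hb, h'⟩ := (hP d).1 hd
    exact ⟨_, a, b, c, ha, hb, hc, h.trans (h'.opair (.refl _ _)), rfl⟩
  · rintro ⟨_, a, b, c, ha, hb, hc, h, -⟩
    exact ⟨_, (hP _).2 ⟨a, ha, b, hb, .refl _ _⟩, c, hc, h⟩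

/-! ### Bounded formulas -/

theorem Fml.Bounded.allIn (t : Tm n) {F : Tm (n + 1) → Fml (n + 1)} (h : (F (.var 0)).Bounded) :
    (AllIn t F).Bounded := .all t h

theorem Fml.Bounded.exIn (t : Tm n) {F : Tm (n + 1) → Fml (n + 1)} (h : (F (.var 0)).Bounded) :
    (ExIn t F).Bounded := .ex t h

theorem Fml.Bounded.neg {φ : Fml n} (h : φ.Bounded) : (BISH.neg φ).Bounded := .imp h .bot

theorem bounded_IsRat (t : Tm n) : (IsRat t).Bounded :=
  .exIn _ (.exIn _ (.exIn _ (.eq _ _)))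

theorem bounded_RatLt (s t : Tm n) : (RatLt s t).Bounded :=
  .exIn _ (.exIn _ (.exIn _ (.exIn _ (.exIn _ (.exIn _ (.and (.eq _ _) (.and (.eq _ _)
    (.mem _ _))))))))

theorem bounded_RatAdd (s t u : Tm n) : (RatAdd s t u).Bounded :=
  .exIn _ (.exIn _ (.exIn _ (.exIn _ (.exIn _ (.exIn _ (.and (.eq _ _) (.and (.eq _ _)
    (.eq _ _))))))))

/-- `|s - t| < u` with quantifiers bounded by the set `Q` of rational numbers. -/
def absSubLtIn (Q s t u : Tm n) : Fml n :=
  ExIn Q fun p => ExIn (Q : Tm (n + 1)) fun r => RatAdd p u r ⋏ neg (p ∈ₛ s) ⋏ neg (p ∈ₛ t) ⋏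
    r ∈ₛ s ⋏ r ∈ₛ t

theorem bounded_absSubLtIn (Q s t u : Tm n) : (absSubLtIn Q s t u).Bounded :=
  .exIn _ (.exIn _ (.and (bounded_RatAdd _ _ _) (.and (.neg (.mem _ _)) (.and (.neg (.mem _ _))
    (.and (.mem _ _) (.mem _ _))))))

/-- The codes of rational numbers form a set, so quantifiers over them can be bounded. This makes
distances, and likewise membership in [0,1], accessible to bounded separation. -/
theorem sat_absSubLtIn {Q s t u : Tm n} (hQ : ∀ q, Mem x q (Q.eval v) ↔ ∃ k, Code x q k) :
    Sat x (absSubLtIn Q s t u) v ↔ ADist x (s.eval v) (t.eval v) (u.eval v) := by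
  rw [ADist, sat_AbsSubLt_iff]
  simp only [absSubLtIn, sat_ExIn, sat_and, sat_RatAdd, sat_neg, sat_mem, eval_lift, eval_var,
    Matrix.cons_val_zero, Matrix.cons_val, hQ]
  constructor
  · rintro ⟨p, -, r, -, h⟩
    exact ⟨p, r, h⟩
  · rintro ⟨p, r, h, h'⟩
    obtain ⟨k, l, hk, -, hs⟩ := h.code
    exact ⟨p, ⟨k, hk⟩, r, ⟨_, hs⟩, h, h'⟩

/-- `t ∈ [0,1]` with quantifiers bounded by the set `Q` of rational numbers. -/
def inUnitIn (Q t : Tm n) : Fml n :=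
  ((AllIn t fun q => IsRat q) ⋏ (ExIn t fun q => q =ₛ q) ⋏ (ExIn Q fun p => neg (p ∈ₛ t)) ⋏
    (AllIn t fun q => ExIn (t : Tm (n + 1)) fun p => RatLt p q) ⋏
    (AllIn t fun p => AllIn (Q : Tm (n + 1)) fun q => RatLt p q ⟹ q ∈ₛ t) ⋏
    (AllIn Q fun p => AllIn (Q : Tm (n + 1)) fun q => RatLt p q ⟹ (neg (p ∈ₛ t) ⋎ q ∈ₛ t))) ⋏
  neg (ratZero ∈ₛ t) ⋏ AllIn Q fun q => RatLt ratOne q ⟹ q ∈ₛ t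

theorem bounded_inUnitIn (Q t : Tm n) : (inUnitIn Q t).Bounded :=
  .and (.and (.allIn _ (bounded_IsRat _)) (.and (.exIn _ (.eq _ _)) (.and
    (.exIn _ (.neg (.mem _ _))) (.and (.allIn _ (.exIn _ (bounded_RatLt _ _))) (.and
    (.allIn _ (.allIn _ (.imp (bounded_RatLt _ _) (.mem _ _))))
    (.allIn _ (.allIn _ (.imp (bounded_RatLt _ _) (.or (.neg (.mem _ _)) (.mem _ _)))))))))) 
    (.and (.neg (.mem _ _)) (.allIn _ (.imp (bounded_RatLt _ _) (.mem _ _))))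

theorem sat_inUnitIn {Q t : Tm n} (hQ : ∀ᶠ y in 𝓝 x, ∀ q, Mem y q (Q.eval v) ↔ ∃ k, Code y q k) :
    Sat x (inUnitIn Q t) v ↔ UnitAt x (t.eval v) := by
  have hlt : ∀ᶠ y in 𝓝 x, ∀ p q, RLt y p q → Mem y p (Q.eval v) ∧ Mem y q (Q.eval v) := by
    filter_upwards [hQ] with y hQ p q ⟨k, l, hk, hl, _⟩
    exact ⟨(hQ p).2 ⟨k, hk⟩, (hQ q).2 ⟨l, hl⟩⟩
  rw [UnitAt, sat_InUnit_iff, RealAt, sat_IsReal_iff]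
  simp [inUnitIn, ratZero, ratOne, Eqv.refl]
  refine and_congr (and_congr_right fun _ => and_congr_right fun _ => and_congr ?_
    (and_congr_right fun _ => and_congr ?_ ?_)) (and_congr_right fun _ => ?_)
  · exact exists_congr fun p => and_congr_left fun _ => hQ.self_of_nhds p
  · exact eventually_congr (hlt.mono fun y h => forall_congr' fun p => forall_congr' fun _ =>
      forall_congr' fun q => ⟨fun h' h₁ => h' (h _ _ h₁).2 h₁, fun h' _ h₁ => h' h₁⟩)
  · exact eventually_congr (hlt.mono fun y h => forall_congr' fun p =>
      ⟨fun h' q h₁ => h' (h _ _ h₁).1 q (h _ _ h₁).2 h₁, fun h' _ q _ h₁ => h' q h₁⟩)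
  · exact eventually_congr (hlt.mono fun y h => forall_congr' fun q =>
      ⟨fun h' h₁ => h' (h _ _ h₁).2 h₁, fun h' _ h₁ => h' h₁⟩)

/-- The unit interval is a set if it is contained in one. -/
theorem exists_unit_interval (E : Obj) :
    ∃ I, ∀ᶠ y in 𝓝 x, ∀ d, Mem y d I ↔ Mem y d E ∧ UnitAt y d := by
  obtain ⟨Q, hQ⟩ := exists_rationals x
  obtain ⟨I, hI⟩ := separation (x := x) (inUnitIn (.var 1) (.var 0)) (bounded_inUnitIn _ _) ![Q] E
  refine ⟨I, ?_⟩
  filter_upwards [hI, hQ.eventually_nhds] with y hI hQ d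
  rw [hI, sat_inUnitIn (by simpa using hQ)]
  rfl

/-- A bounded formula defines a set of codes of rational numbers. -/
theorem exists_cut (φ : Fml (n + 1)) (hφ : φ.Bounded) (v : Fin n → Obj) :
    ∃ u, ∀ᶠ y in 𝓝 x, ∀ q, Mem y q u ↔ (∃ k, Code y q k) ∧ Sat y φ (q ∷ v) := by
  obtain ⟨Q, hQ⟩ := exists_rationals x
  obtain ⟨u, hu⟩ := separation (x := x) φ hφ v Q
  refine ⟨u, ?_⟩
  filter_upwards [hQ, hu] with y hQ hu q
  rw [hu, hQ]

theorem sat_IsFun {f : Tm n} {A B : Fml (n + 1)} : Sat x (IsFun f A B) v ↔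
    (∀ᶠ y in 𝓝 x, ∀ p, Mem y p (f.eval v) → ∃ a b, Sat y A (a ∷ v) ∧ Sat y B (b ∷ v) ∧
      Eqv y p (.opair a b)) ∧
    ∀ᶠ y in 𝓝 x, ∀ a, Sat y A (a ∷ v) → ∃ b, Mem y (.opair a b) (f.eval v) ∧
      ∀ᶠ z in 𝓝 y, ∀ b', Mem z (.opair a b') (f.eval v) → Eqv z b' b := by
  simp [IsFun, vecCons_addNat_three]

end

end BISH

namespace BISH
open Filter Topology

/-! ### The two principles at a point -/

section

variable {x : Point} {n : ℕ} {v : Fin n → Obj} {a b f m E ρ w s : Obj}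

/-- The real number `a` is positive. -/
def PosAt (x : Point) (a : Obj) : Prop := Sat x (RealPos (.var 0)) ![a]

theorem sat_RealPos_iff {t : Tm n} : Sat x (RealPos t) v ↔
    ∃ q, RLt x (.frac .empty .empty .empty) q ∧ ∀ᶠ y in 𝓝 x, ¬ Mem y q (t.eval v) := by
  simp [RealPos, ratZero]

@[simp] theorem sat_RealPos {t : Tm n} : Sat x (RealPos t) v ↔ PosAt x (t.eval v) := by
  rw [PosAt, sat_RealPos_iff, sat_RealPos_iff]; rfl

theorem posAt_iff : PosAt x a ↔ ∃ k, 0 < k ∧ Lo x a k := by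
  rw [PosAt, sat_RealPos_iff]
  constructor
  · rintro ⟨q, ⟨_, k, h0, hk, hlt⟩, h⟩
    rw [code_zero] at h0
    subst h0
    exact ⟨k, hlt, q, hk, h⟩
  · rintro ⟨k, hk, q, hq, h⟩
    exact ⟨q, ⟨0, k, code_zero.2 rfl, hq, hk⟩, h⟩

/-- `f` is a function from the unit interval to the real numbers. -/
def FunAt (x : Point) (f : Obj) : Prop :=
  (∀ᶠ y in 𝓝 x, ∀ p, Mem y p f → ∃ a b, UnitAt y a ∧ RealAt y b ∧ Eqv y p (.opair a b)) ∧
    ∀ᶠ y in 𝓝 x, ∀ a, UnitAt y a → ∃ b, Mem y (.opair a b) f ∧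
      ∀ᶠ z in 𝓝 y, ∀ b', Mem z (.opair a b') f → Eqv z b' b

/-- `f` is pointwise continuous. -/
def ContAt (x : Point) (f : Obj) : Prop :=
  ∀ᶠ y in 𝓝 x, ∀ a, UnitAt y a → ∀ ε, RLt y (.frac .empty .empty .empty) ε →
    ∃ δ, RLt y (.frac .empty .empty .empty) δ ∧ ∀ᶠ z in 𝓝 y, ∀ b, UnitAt z b → ADist z a b δ →
      ∀ u u', Mem z (.opair a u) f → Mem z (.opair b u') f → ADist z u u' ε

/-- `m` is the infimum of `f`. -/
def InfAt (x : Point) (f m : Obj) : Prop :=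
  RealAt x m ∧ (∀ᶠ y in 𝓝 x, ∀ a u, Mem y (.opair a u) f → ∀ q, Mem y q u → Mem y q m) ∧
    ∀ᶠ y in 𝓝 x, ∀ q, Mem y q m → ∃ a u, Mem y (.opair a u) f ∧ Mem y q u

theorem sat_POSp : Sat x POSp ![] ↔ ∀ᶠ y in 𝓝 x, ∀ f, FunAt y f → ContAt y f →
    (∀ᶠ z in 𝓝 y, ∀ a u, Mem z (.opair a u) f → PosAt z u) → ∀ m, InfAt y f m → PosAt y m := by
  have h₁ : ∀ y f, Sat y (IsFun (.var 0) (InUnit (.var 0)) (IsReal (.var 0))) ![f] ↔ FunAt y f := by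
    intro y f
    simp [sat_IsFun, FunAt]
  have h₂ : ∀ y f, Sat y (PtwiseContinuous (.var 0)) ![f] ↔ ContAt y f := by
    intro y f
    simp [PtwiseContinuous, ContAt, ratZero]
  have h₃ : ∀ y f, Sat y (PosValued (.var 0)) ![f] ↔
      ∀ᶠ z in 𝓝 y, ∀ a u, Mem z (.opair a u) f → PosAt z u := by
    intro y f
    simp [PosValued]
  have h₄ : ∀ y f m, Sat y (IsInf (Tm.var 0 : Tm 1).lift (.var 0)) ![m, f] ↔ InfAt y f m := by
    intro y f m
    simp [IsInf, InfAt, RealLe, SubsetOf]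
  simp only [← h₁, ← h₂, ← h₃, ← h₄]
  simp [POSp, Loc.sat]

/-- `ρ` is a metric on `E`. -/
def MetricAt (x : Point) (E ρ : Obj) : Prop := Sat x (IsMetric (.var 0) (.var 1)) ![E, ρ]

theorem metricAt_iff : MetricAt x E ρ ↔
    ((∀ᶠ y in 𝓝 x, ∀ p, Mem y p ρ → ∃ c d, (∃ a, Mem y a E ∧ ∃ b, Mem y b E ∧
        Eqv y c (.opair a b)) ∧ RealAt y d ∧ Eqv y p (.opair c d)) ∧
      ∀ᶠ y in 𝓝 x, ∀ c, (∃ a, Mem y a E ∧ ∃ b, Mem y b E ∧ Eqv y c (.opair a b)) →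
        ∃ d, Mem y (.opair c d) ρ ∧ ∀ᶠ z in 𝓝 y, ∀ d', Mem z (.opair c d') ρ → Eqv z d' d) ∧
    (∀ᶠ y in 𝓝 x, ∀ a b d, Mem y (.opair (.opair a b) d) ρ →
      (∀ᶠ z in 𝓝 y, ¬ Mem z (.frac .empty .empty .empty) d) ∧
      (∀ᶠ z in 𝓝 y, ((∀ᶠ z' in 𝓝 z, ∀ q, RLt z' (.frac .empty .empty .empty) q → Mem z' q d) ↔
        Eqv z a b)) ∧
      Mem y (.opair (.opair b a) d) ρ) ∧
    ∀ᶠ y in 𝓝 x, ∀ a b c d d' d'', Mem y (.opair (.opair a b) d) ρ →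
      Mem y (.opair (.opair b c) d') ρ → Mem y (.opair (.opair a c) d'') ρ →
      ∀ p, Mem y p d → ∀ q, Mem y q d' → ∀ r, RAdd y p q r → Mem y r d'' := by
  simp [MetricAt, IsMetric, sat_IsFun, InSquare, ratZero]

/-- The unit interval is a subspace of `(E, ρ)`. -/
def SubspaceAt (x : Point) (E ρ : Obj) : Prop :=
  (∀ᶠ y in 𝓝 x, ∀ a, UnitAt y a → Mem y a E) ∧
    ∀ᶠ y in 𝓝 x, ∀ a b d, UnitAt y a → UnitAt y b → Mem y (.opair (.opair a b) d) ρ →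
      ∀ q, (∃ k, Code y q k) → ∀ᶠ z in 𝓝 y, (Mem z q d ↔ ADist z a b q)

/-- `w` is bounded away from the unit interval. -/
def ExtraAt (x : Point) (E ρ w : Obj) : Prop :=
  Mem x w E ∧ ∃ δ, RLt x (.frac .empty .empty .empty) δ ∧ ∀ᶠ y in 𝓝 x, ∀ a d, UnitAt y a →
    Mem y (.opair (.opair w a) d) ρ → ¬ Mem y δ d

/-- `s` is a sequence in `[0,1] ∪ {w}`. -/
def SeqAt (x : Point) (w s : Obj) : Prop :=
  (∀ᶠ y in 𝓝 x, ∀ p, Mem y p s → ∃ a b, Mem y a .omega ∧ (UnitAt y b ∨ Eqv y b w) ∧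
    Eqv y p (.opair a b)) ∧
    ∀ᶠ y in 𝓝 x, ∀ a, Mem y a .omega → ∃ b, Mem y (.opair a b) s ∧
      ∀ᶠ z in 𝓝 y, ∀ b', Mem z (.opair a b') s → Eqv z b' b

/-- `s` is eventually bounded away from `a`. -/
def AwayAt (x : Point) (ρ s a : Obj) : Prop :=
  ∃ N, Mem x N .omega ∧ ∃ δ, RLt x (.frac .empty .empty .empty) δ ∧
    ∀ᶠ y in 𝓝 x, ∀ k, Mem y k .omega → Eqv y N k ∨ Mem y N k → ∀ z d, Mem y (.opair k z) s →
      Mem y (.opair (.opair a z) d) ρ → ¬ Mem y δ d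

theorem sat_ASL : Sat x ASL ![] ↔ ∀ᶠ y in 𝓝 x, ∀ E ρ w, MetricAt y E ρ → SubspaceAt y E ρ →
    ExtraAt y E ρ w → ∀ s, SeqAt y w s → (∀ᶠ z in 𝓝 y, ∀ a, UnitAt z a → AwayAt z ρ s a) →
    ∃ k, Mem y k .omega ∧ Mem y (.opair k w) s := by
  have h₁ : ∀ y w ρ E, Sat y (IsMetric (Tm.var 0 : Tm 1).lift.lift (Tm.var 0 : Tm 2).lift)
      ![w, ρ, E] ↔ MetricAt y E ρ := by
    intro y w ρ E
    rw [metricAt_iff]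
    simp [IsMetric, sat_IsFun, InSquare, ratZero]
  have h₂ : ∀ y w ρ E, Sat y (UnitSubspace (Tm.var 0 : Tm 1).lift.lift (Tm.var 0 : Tm 2).lift)
      ![w, ρ, E] ↔ SubspaceAt y E ρ := by
    intro y w ρ E
    simp [UnitSubspace, SubspaceAt]
  have h₃ : ∀ y w ρ E, Sat y (IsExtraPoint (Tm.var 0 : Tm 1).lift.lift (Tm.var 0 : Tm 2).lift
      (.var 0)) ![w, ρ, E] ↔ ExtraAt y E ρ w := by
    intro y w ρ E
    simp [IsExtraPoint, ExtraAt, ratZero]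
  have h₄ : ∀ y s w ρ E, Sat y (IsFun (.var 0) (.var 0 ∈ₛ .omega)
      (InUnit (.var 0) ⋎ .var 0 =ₛ (Tm.var 0 : Tm 3).lift.lift)) ![s, w, ρ, E] ↔ SeqAt y w s := by
    intro y s w ρ E
    simp [sat_IsFun, SeqAt]
  have h₅ : ∀ y a s w ρ E, Sat y (EventuallyAway (Tm.var 0 : Tm 2).lift.lift.lift
      (Tm.var 0 : Tm 4).lift (.var 0)) ![a, s, w, ρ, E] ↔ AwayAt y ρ s a := by
    intro y a s w ρ E
    simp [EventuallyAway, AwayAt, ratZero]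
  have l₁ : ∀ E ρ, Loc fun y => MetricAt y E ρ := fun E ρ => Loc.sat _ _
  have l₂ : ∀ E ρ, Loc fun y => SubspaceAt y E ρ := fun E ρ => by
    simp only [← fun y => h₂ y E ρ E, Loc.sat]
  have l₃ : ∀ E ρ w, Loc fun y => ExtraAt y E ρ w := fun E ρ w => by
    simp only [← h₃, Loc.sat]
  have l₄ : ∀ w s, Loc fun y => SeqAt y w s := fun w s => by
    simp only [← fun y => h₄ y s w w w, Loc.sat]
  simp [ASL, h₁, h₂, h₃, h₄, h₅, l₁, l₂, l₃, l₄]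

end

end BISH

/-! ### From positivity to the anti-Specker property -/

namespace BISH
open Filter Topology

/-! ### Sequences in the extended unit interval -/

section

variable {x : Point} {a b c n t z : Obj} {k l r : K x} {E : ∀ y, K y}

theorem mem_omega_of_mem (hn : Mem x n .omega) (ha : Mem x a n) : Mem x a .omega := by
  have key : ∀ y n, Sat y (AllIn (.var 0) fun j => j ∈ₛ .omega) ![n] ↔
      ∀ᶠ z in 𝓝 y, ∀ j, Mem z j n → Mem z j .omega := by
    intro y n
    simp
  refine ((key x n).1 (omega_induction _ ((key x _).2 ?_) ?_ hn)).self_of_nhds a ha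
  · exact .of_forall fun y j hj => (not_mem_empty hj).elim
  · refine .of_forall fun y k hk ih => (key y _).2 ?_
    filter_upwards [(key y _).1 ih, hk.eventually] with z ih hk j hj
    exact (mem_succ.1 hj).elim (ih j) fun h => h.mem_left.2 hk

theorem Eqv.up (h : Eqv x a b) (hk : Up x a k) : Up x b k := by
  obtain ⟨q, hq, h'⟩ := hk
  exact ⟨q, hq, h.mem_right.1 h'⟩

theorem Eqv.lo (h : Eqv x a b) (hk : Lo x a k) : Lo x b k := by
  obtain ⟨q, hq, h'⟩ := hk
  refine ⟨q, hq, ?_⟩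
  filter_upwards [h', h.eventually] with y h' h hq
  exact h' (h.mem_right.2 hq)

theorem Eqv.dist (h : Eqv x b c) (hd : Dist x a b r) : Dist x a c r := by
  obtain ⟨k, h₁, h₂, h₃, h₄⟩ := hd
  exact ⟨k, h₁, h.lo h₂, h₃, h.up h₄⟩

theorem Germ.eventually (h : Germ x E) : ∀ᶠ y in 𝓝 x, Germ y E := by
  obtain ⟨a, b, c, h⟩ := h
  filter_upwards [h.eventually_nhds] with y h
  exact ⟨a, b, c, h⟩

theorem Germ.div_nat (hE : Germ x E) (hn : Mem x n .omega) :
    Germ x fun y => E y / (BISH.nat y n + 1) := by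
  simpa [div_eq_mul_inv] using hE.mul (.one_div hn)

/-- `s` is a sequence in `[0,1] ∪ {w}` that is eventually bounded away from the points of `[0,1]`.
Moreover, `Q` is the set of rational numbers and `I` the unit interval. -/
structure Seq (x : Point) (Q I w s : Obj) : Prop where
  rat : ∀ᶠ y in 𝓝 x, ∀ q, Mem y q Q ↔ ∃ k, Code y q k
  unit : ∀ᶠ y in 𝓝 x, ∀ d, Mem y d I ↔ UnitAt y d
  extra : ∀ᶠ y in 𝓝 x, ¬ UnitAt y w
  total : ∀ᶠ y in 𝓝 x, ∀ n, Mem y n .omega → ∃ t, Mem y (.opair n t) s ∧ (UnitAt y t ∨ Eqv y t w)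
  unique : ∀ᶠ y in 𝓝 x, ∀ n t t', Mem y n .omega → Mem y (.opair n t) s → Mem y (.opair n t') s →
    Eqv y t t'
  away : ∀ᶠ y in 𝓝 x, ∀ a, UnitAt y a → ∃ N E, Mem y N .omega ∧ Germ y E ∧ 0 < E y ∧
    ∀ᶠ z in 𝓝 y, ∀ k t, Mem z k .omega → nat z N ≤ nat z k → Mem z (.opair k t) s → UnitAt z t →
      ¬ Dist z a t (E z)

variable {Q I w s : Obj}

theorem Seq.eventually (h : Seq x Q I w s) : ∀ᶠ y in 𝓝 x, Seq y Q I w s := by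
  filter_upwards [h.rat.eventually_nhds, h.unit.eventually_nhds, h.extra.eventually_nhds,
    h.total.eventually_nhds, h.unique.eventually_nhds, h.away.eventually_nhds]
    with y h₁ h₂ h₃ h₄ h₅ h₆
  exact ⟨h₁, h₂, h₃, h₄, h₅, h₆⟩

/-- The terms of the sequence `s` up to the index `n` are different from `w`. -/
def Before (x : Point) (w s n : Obj) : Prop :=
  ∀ᶠ y in 𝓝 x, ∀ j, Mem y j n.succ → ¬ Mem y (.opair j w) s

theorem Before.not_mem (h : Before x w s n) : ¬ Mem x (.opair n w) s :=
  h.self_of_nhds n (mem_succ.2 (.inr (.refl _ _)))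

theorem Before.mono {m : Obj} (h : Before x w s n) (hn : Mem x n .omega) (hm : Mem x m .omega)
    (hmn : nat x m ≤ nat x n) : Before x w s m := by
  filter_upwards [h, hn.eventually, hm.eventually, (Germ.nat hm).le (.nat hn) hmn]
    with y h hn hm hmn j hj
  have hj' := mem_omega_of_mem (succ_mem_omega hm) hj
  refine h j ?_
  rw [← nat_lt_nat hj' (succ_mem_omega hn), nat_succ hn]
  rw [← nat_lt_nat hj' (succ_mem_omega hm), nat_succ hm] at hj
  linarith

theorem Seq.exists_unitAt (h : Seq x Q I w s) (hn : Mem x n .omega) (hb : Before x w s n) :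
    ∃ t, Mem x (.opair n t) s ∧ UnitAt x t := by
  obtain ⟨t, ht, h' | h'⟩ := h.total.self_of_nhds n hn
  · exact ⟨t, ht, h'⟩
  · exact (hb.not_mem (((Eqv.refl _ n).opair h').mem_left.1 ht)).elim

/-- Every term is a point of [0,1] or equals w, and w is no point of [0,1]; so equality with w can
be decided term by term. The search returns the first index at which w occurs. -/
theorem Seq.before_or (h : Seq x Q I w s) (hn : Mem x n .omega) : Before x w s n ∨
    ∃ k, Mem x k n.succ ∧ Mem x (.opair k w) s ∧
      ∀ᶠ y in 𝓝 x, ∀ j, Mem y j k → ¬ Mem y (.opair j w) s := by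
  have key : ∀ y n, Sat y ((AllIn (succ (.var 0)) fun j => neg (opair j (.var 2) ∈ₛ .var 3)) ⋎
      ExIn (succ (.var 0)) fun k => opair k (.var 2) ∈ₛ .var 3 ⋏
        AllIn k fun j => neg (opair j (.var 3) ∈ₛ .var 4)) ![n, w, s] ↔ Before y w s n ∨
      ∃ k, Mem y k n.succ ∧ Mem y (.opair k w) s ∧
        ∀ᶠ z in 𝓝 y, ∀ j, Mem z j k → ¬ Mem z (.opair j w) s := by
    intro y n
    simp [Before]
  refine (key x n).1 (omega_induction _ ((key x _).2 ?_) ?_ hn)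
  · obtain ⟨t, ht, h' | h'⟩ := h.total.self_of_nhds _ zero_mem_omega
    · left
      filter_upwards [h.extra, h.unique, ht.eventually, h'.eventually] with y h₁ h₂ ht h' j hj hjw
      rw [mem_succ, or_iff_right not_mem_empty] at hj
      exact h₁ ((h₂ _ _ _ zero_mem_omega ht ((hj.opair (.refl _ _)).mem_left.1 hjw)).unitAt h')
    · exact .inr ⟨.empty, mem_succ.2 (.inr (.refl _ _)),
        ((Eqv.refl _ _).opair h').mem_left.1 ht, .of_forall fun y j hj => (not_mem_empty hj).elim⟩
  · filter_upwards [h.eventually] with y h k hk ih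
    refine (key y _).2 ?_
    rcases (key y _).1 ih with ih | ⟨m, hm, h₁, h₂⟩
    · obtain ⟨t, ht, h' | h'⟩ := h.total.self_of_nhds _ (succ_mem_omega hk)
      · left
        filter_upwards [h.extra, h.unique, ht.eventually, h'.eventually, ih, hk.eventually]
          with y h₁ h₂ ht h' ih hk j hj hjw
        rcases mem_succ.1 hj with hj | hj
        · exact ih j hj hjw
        · exact h₁ ((h₂ _ _ _ (succ_mem_omega hk) ht
            ((hj.opair (.refl _ _)).mem_left.1 hjw)).unitAt h')
      · exact .inr ⟨k.succ, mem_succ.2 (.inr (.refl _ _)),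
          ((Eqv.refl _ _).opair h').mem_left.1 ht, ih⟩
    · exact .inr ⟨m, mem_succ.2 (.inl hm), h₁, h₂⟩

/-- `max (1 / (n + 1)) ((n + 1) |z - s n|) < k`, and the terms up to `s n` differ from `w`. -/
def Term (x : Point) (w s n z : Obj) (k : K x) : Prop :=
  Before x w s n ∧ 1 / (nat x n + 1) < k ∧
    ∃ t, UnitAt x t ∧ Mem x (.opair n t) s ∧ Dist x z t (k / (nat x n + 1))

theorem Term.mono (h : Term x w s n z k) (hz : RealAt x z) (hkl : k ≤ l) : Term x w s n z l := by
  obtain ⟨h₁, h₂, t, h₃, h₄, h₅⟩ := h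
  exact ⟨h₁, h₂.trans_le hkl, t, h₃, h₄, h₅.mono hz h₃.real
    (by have := nat_add_one_pos (x := x) (a := n); gcongr)⟩

theorem Term.exists_lt (h : Term x w s n z k) (hz : RealAt x z) : ∃ l < k, Term x w s n z l := by
  obtain ⟨h₁, h₂, t, h₃, h₄, h₅⟩ := h
  have hn := nat_add_one_pos (x := x) (a := n)
  obtain ⟨r, hr, h₅⟩ := h₅.exists_lt hz h₃.real
  obtain ⟨l, hl, hl'⟩ := exists_between h₂
  rw [lt_div_iff₀ hn] at hr
  refine ⟨max l (r * (nat x n + 1)), max_lt hl' hr, h₁, hl.trans_le (le_max_left _ _), t, h₃, h₄,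
    h₅.mono hz h₃.real ?_⟩
  rw [le_div_iff₀ hn]
  exact le_max_right _ _

/-- The n-th term is a Lipschitz function of z with constant n + 1. -/
theorem Term.of_dist {z' : Obj} (h : Term x w s n z k) (hd : Dist x z z' r) (hz : RealAt x z)
    (hz' : RealAt x z') : Term x w s n z' (k + r * (nat x n + 1)) := by
  obtain ⟨h₁, h₂, t, h₃, h₄, h₅⟩ := h
  have hn := nat_add_one_pos (x := x) (a := n)
  refine ⟨h₁, ?_, t, h₃, h₄, (hd.symm.triangle h₅ hz' hz h₃.real).mono hz' h₃.real ?_⟩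
  · have := mul_pos (hd.pos hz) hn
    linarith
  · rw [add_div, mul_div_cancel_right₀ _ hn.ne', add_comm]

/-- The condition on the earlier terms is decided by `Seq.before_or`, the bound 1 / (n + 1) by
comparing rational numbers, and the distance of z from s n is located. -/
theorem Seq.term_located (h : Seq x Q I w s) (hn : Mem x n .omega) (hz : RealAt x z)
    (hE : Germ x E) (hl : E x < l) :
    (∀ᶠ y in 𝓝 x, ¬ Term y w s n z (E y)) ∨ Term x w s n z l := by
  have hpos := nat_add_one_pos (x := x) (a := n)
  rcases h.before_or hn with hb | ⟨k, hk, hk', -⟩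
  · rcases le_or_gt l (1 / (nat x n + 1)) with h' | h'
    · left
      filter_upwards [hE.le (.one_div hn) (by linarith)] with y h h'
      linarith [h'.2.1]
    · obtain ⟨t, ht, htu⟩ := h.exists_unitAt hn hb
      refine (dist_located hz htu.real (hE.div_nat hn)
        ((div_lt_div_iff_of_pos_right hpos).2 hl)).imp
            (fun h₁ => ?_) fun h₁ => ⟨hb, h', t, htu, ht, h₁⟩
      filter_upwards [h₁, h.unique, hn.eventually, ht.eventually]
          with y h₁ h₂ hn ht ⟨_, _, t', _, ht', h₃⟩
      exact h₁ ((h₂ n t' t hn ht' ht).dist h₃)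
  · left
    filter_upwards [hk.eventually, hk'.eventually] with y hk hk' h
    exact h.1.self_of_nhds k hk hk'

/-- Near a point of the unit interval, only finitely many terms are relevant. -/
theorem Seq.tail (h : Seq x Q I w s) (hz : UnitAt x z) : ∃ M E, Mem x M .omega ∧ Germ x E ∧
    0 < E x ∧ ∀ᶠ y in 𝓝 x, ∀ z' n k, UnitAt y z' → Dist y z z' (E y) → Mem y n .omega →
      nat y M ≤ nat y n → Term y w s n z' k → 1 < k := by
  obtain ⟨N, E, hN, hE, hpos, h'⟩ := h.away.self_of_nhds z hz
  -- From N on, the terms in [0,1] have distance at least E from z. For z' within E / 2 of z and n ≥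
  -- N + L, a term with k ≤ 1 would lie within k / (n + 1) ≤ 1 / (L + 1) < E / 2 of z', hence within
  -- E of z.
  obtain ⟨L, hL, hL'⟩ := exists_one_div_lt (half_pos hpos)
  -- Halving must be given by one code on a whole neighbourhood, so F is a germ with F + F = 1 near
  -- x.
  obtain ⟨F, hF, hFx⟩ := exists_germ (x := x) (1 / 2)
  refine ⟨.add N L, fun y => E y * F y, add_mem_omega hN hL,
      hE.mul hF, by simp only [hFx]; linarith, ?_⟩
  have hF' := (hF.add hF).eq .one (by rw [hFx]; norm_num)
  filter_upwards [h', hF', hN.eventually, hL.eventually, hz.eventually,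
    Germ.zero.lt hE hpos,
    (Germ.one_div hL).lt (hE.mul hF) (by simp only [hFx]; linarith)]
    with y h' hF hN hL hz hpos hL' z' n k hz' hd hn hMn ⟨_, _, t, ht, hnt, hd'⟩
  rw [nat_add hN hL] at hMn
  have hN' := nat_nonneg (x := y) (a := N)
  have hL₀ := nat_nonneg (x := y) (a := L)
  have hn₀ := nat_add_one_pos (x := y) (a := n)
  by_contra! hk
  refine h' n t hn (by linarith) hnt ht ((hd.triangle hd' hz.real hz'.real ht.real).mono
    hz.real ht.real ?_)
  have h₁ : k / (BISH.nat y n + 1) ≤ 1 / (BISH.nat y L + 1) := by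
    rw [div_le_div_iff₀ hn₀ (by linarith)]
    nlinarith
  have h₂ : E y * F y + E y * F y = E y := by rw [← mul_add, hF, mul_one]
  linarith

end

end BISH

/-! ### Finite search among the terms of the infimum -/

namespace BISH
open Filter Topology

section

variable {x : Point} {m n z M : Obj} {k l : K x} {E : ∀ y, K y} {Q I w s : Obj}

theorem Term.congr (hT : Term x w s m z k) (h : Eqv x m n) (hm : Mem x m .omega)
    (hn : Mem x n .omega) : Term x w s n z k := by
  obtain ⟨h₁, h₂, t, h₃, h₄, h₅⟩ := hT
  have e := (nat_eq_nat hm hn).2 h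
  exact ⟨h₁.mono hm hn e.ge, e ▸ h₂, t, h₃, (h.opair (.refl _ _)).mem_left.1 h₄, e ▸ h₅⟩

/-- The bounded formula that expresses `Term`. -/
def termF {i : ℕ} (m q z Q I w s : Tm i) : Fml i :=
  (AllIn (succ m) fun j => neg (opair j w ∈ₛ s)) ⋏ RatLt (frac (succ .empty) .empty m) q ⋏
    ExIn I fun t => opair m t ∈ₛ s ⋏ ExIn .omega fun a => ExIn .omega fun b => ExIn .omega fun c =>
      q =ₛ frac a b c ⋏ absSubLtIn Q z t (frac a b (.add (.mul c m) (.add c m)))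

theorem bounded_termF {i : ℕ} (m q z Q I w s : Tm i) : (termF m q z Q I w s).Bounded :=
  .and (.allIn _ (.neg (.mem _ _))) (.and (bounded_RatLt _ _) (.exIn _ (.and (.mem _ _)
    (.exIn _ (.exIn _ (.exIn _ (.and (.eq _ _) (bounded_absSubLtIn _ _ _ _))))))))

theorem sat_termF {i : ℕ} {m q z Q I w s : Tm i} {v : Fin i → Obj}
    (h : Seq x (Q.eval v) (I.eval v) (w.eval v) (s.eval v)) (hm : Mem x (m.eval v) .omega)
    (hz : RealAt x (z.eval v)) (hq : Code x (q.eval v) k) :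
    Sat x (termF m q z Q I w s) v ↔ Term x (w.eval v) (s.eval v) (m.eval v) (z.eval v) k := by
  have h₁ : Sat x (AllIn (succ m) fun j => neg (opair j w ∈ₛ s)) v ↔
      Before x (w.eval v) (s.eval v) (m.eval v) := by simp [Before]
  have hm' := code_one_div hm
  have h₂ : Sat x (RatLt (frac (succ .empty) .empty m) q) v ↔ 1 / (nat x (m.eval v) + 1) < k := by
    simp [rLt_iff hm' hq]
  rw [termF, Term, sat_and, sat_and, h₁, h₂]
  refine and_congr_right fun _ => and_congr_right fun _ => ?_
  simp only [sat_ExIn, sat_and, sat_mem, sat_eq, eval_lift, eval_var, eval_opair, eval_omega,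
    Matrix.cons_val_zero, h.unit.self_of_nhds]
  refine exists_congr fun t => and_congr_right fun ht => and_congr_right fun _ => ?_
  have hn := nat_add_one_pos (x := x) (a := m.eval v)
  -- Division of (a - b) / (c + 1) by m + 1 is carried out on codes: the new denominator is (c m + c
  -- + m) + 1.
  have key : ∀ {a b c : Obj}, Mem x a .omega → Mem x b .omega → Mem x c .omega →
      Eqv x (q.eval v) (.frac a b c) →
      Code x (.frac a b (.add (.mul c (m.eval v)) (.add c (m.eval v))))
          (k / (nat x (m.eval v) + 1)) := by
    intro a b c ha hb hc e
    have hcm := mul_mem_omega hc hm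
    have hcm' := add_mem_omega hc hm
    have hc' := nat_add_one_pos (x := x) (a := c)
    convert code_frac ha hb (add_mem_omega hcm hcm') using 1
    rw [hq.unique (e.symm.code (code_frac ha hb hc)), nat_add hcm hcm', nat_add hc hm,
      nat_mul hc hm, div_div]
    congr 1
    ring
  constructor
  · rintro ⟨a, ha, b, hb, c, hc, e, h'⟩
    simp only [eval_frac, eval_lift, eval_var, Matrix.cons_val_zero] at e
    rw [sat_absSubLtIn (by simpa using h.rat.self_of_nhds)] at h'
    simp only [eval_frac, eval_lift, eval_var, Matrix.cons_val_zero, eval_add, eval_mul] at h'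
    exact (aDist_iff hz ht.real (key ha hb hc e)).1 h'
  · intro h'
    obtain ⟨a, b, c, ha, hb, hc, e, -⟩ := hq
    refine ⟨a, ha, b, hb, c, hc, by simpa using e, ?_⟩
    rw [sat_absSubLtIn (by simpa using h.rat.self_of_nhds)]
    simp only [eval_frac, eval_lift, eval_var, Matrix.cons_val_zero, eval_add, eval_mul]
    exact (aDist_iff hz ht.real (key ha hb hc e)).2 h'

/-- A minimum of finitely many located quantities is located. The number M belongs to the model, so
the argument is an induction inside it, with codes p and q of the two bounds as parameters of the
formula. -/
theorem Seq.search (h : Seq x Q I w s) (hz : RealAt x z) (hE : Germ x E) (hl : E x < l)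
    (hM : Mem x M .omega) : (∀ᶠ y in 𝓝 x, ∀ n, Mem y n M → ¬ Term y w s n z (E y)) ∨
    ∃ n, Mem x n .omega ∧ Term x w s n z l := by
  obtain ⟨F, hF, rfl⟩ := exists_germ l
  obtain ⟨p, hp⟩ := hE.exists_code
  obtain ⟨q, hq⟩ := hF.exists_code
  have key : ∀ᶠ y in 𝓝 x, ∀ M, Mem y M .omega →
      (Sat y ((AllIn (.var 0) fun n => neg (termF n (.var 2) (.var 4) (.var 5) (.var 6) (.var 7)
        (.var 8))) ⋎ ExIn .omega fun n => termF n (.var 3) (.var 4) (.var 5) (.var 6) (.var 7)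
        (.var 8)) ![M, p, q, z, Q, I, w, s] ↔
      (∀ᶠ y' in 𝓝 y, ∀ n, Mem y' n M → ¬ Term y' w s n z (E y')) ∨
        ∃ n, Mem y n .omega ∧ Term y w s n z (F y)) := by
    filter_upwards [h.eventually.eventually_nhds, hz.eventually.eventually_nhds, hp.eventually_nhds,
      hq] with y h hz hp hq M hM
    simp only [sat_or, sat_AllIn, sat_ExIn, eval_var, eval_omega, Matrix.cons_val_zero, sat_neg,
      ev_forall_imp_ev fun _ => Loc.mem _ _]
    refine or_congr (eventually_congr ?_) (exists_congr fun n => and_congr_right fun hn => ?_)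
    · filter_upwards [h, hz, hp, hM.eventually] with y' h hz hp hM
      refine forall_congr' fun n => imp_congr_right fun hn => not_congr ?_
      exact sat_termF (by simpa using h) (by simpa using mem_omega_of_mem hM hn)
        (by simpa using hz) (by simpa using hp)
    · exact sat_termF (by simpa using h.self_of_nhds) (by simpa using hn)
        (by simpa using hz.self_of_nhds) (by simpa using hq)
  refine (key.self_of_nhds M hM).1
      (omega_induction _ ((key.self_of_nhds _ zero_mem_omega).2 ?_) ?_ hM)
  · exact .inl (.of_forall fun y n hn => (not_mem_empty hn).elim)
  · filter_upwards [key, h.eventually, hz.eventually, hE.eventually, hE.lt hF hl]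
      with y key h hz hE hl k hk ih
    refine (key _ (succ_mem_omega hk)).2 ?_
    rcases (key _ hk).1 ih with ih | ih
    · rcases h.term_located hk hz hE hl with h' | h'
      · left
        filter_upwards [ih, h', hk.eventually] with y ih h' hk n hn hT
        rcases mem_succ.1 hn with hn | hn
        · exact ih n hn hT
        · exact h' (hT.congr hn (hn.mem_left.2 hk) hk)
      · exact .inr ⟨k, hk, h'⟩
    · exact .inr ih

end

end BISH

/-! ### The function attached to the sequence -/

namespace BISH
open Filter Topology

section

variable {x : Point} {n z M u u' : Obj} {k l : K x} {E : ∀ y, K y} {Q I w s : Obj}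

/-- `min 1 (inf (max (1 / (n + 1)) ((n + 1) |z - s n|))) < k`, where the infimum is over all `n`
such that the terms up to `s n` differ from `w`. -/
def CutAt (x : Point) (w s z : Obj) (k : K x) : Prop :=
  1 < k ∨ ∃ n, Mem x n .omega ∧ Term x w s n z k

theorem CutAt.mono (h : CutAt x w s z k) (hz : RealAt x z) (hkl : k ≤ l) : CutAt x w s z l :=
  h.imp hkl.trans_lt' fun ⟨n, hn, h⟩ => ⟨n, hn, h.mono hz hkl⟩

theorem CutAt.exists_lt (h : CutAt x w s z k) (hz : RealAt x z) : ∃ l < k, CutAt x w s z l := by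
  rcases h with h | ⟨n, hn, h⟩
  · obtain ⟨l, h₁, h₂⟩ := exists_between h
    exact ⟨l, h₂, .inl h₁⟩
  · obtain ⟨l, hl, h⟩ := h.exists_lt hz
    exact ⟨l, hl, .inr ⟨n, hn, h⟩⟩

theorem Seq.tail_lo (h : Seq x Q I w s) (hz : UnitAt x z) : ∃ M, Mem x M .omega ∧
    ∀ᶠ y in 𝓝 x, ∀ n k, Mem y n .omega → nat y M ≤ nat y n → Term y w s n z k → 1 < k := by
  obtain ⟨M, D, hM, hD, hpos, ht⟩ := h.tail hz
  refine ⟨M, hM, ?_⟩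
  filter_upwards [ht, hz.eventually, Germ.zero.lt hD hpos] with y ht hz hpos n k hn hMn h
  exact ht z n k hz (hz.real.dist_self hpos) hn hMn h

/-- The terms with index at least M exceed 1 and do not affect the minimum with 1; the remaining
ones are handled by the finite search. -/
theorem Seq.cut_located (h : Seq x Q I w s) (hz : UnitAt x z) (hE : Germ x E) (hl : E x < l) :
    (∀ᶠ y in 𝓝 x, ¬ CutAt y w s z (E y)) ∨ CutAt x w s z l := by
  rcases lt_or_ge 1 l with h₁ | h₁
  · exact .inr (.inl h₁)
  obtain ⟨M, hM, ht⟩ := h.tail_lo hz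
  rcases h.search hz.real hE hl hM with h' | h'
  · left
    filter_upwards [h', ht, hE.le .one (by linarith), hM.eventually] with y h' ht h₁ hM
    rintro (h₂ | ⟨n, hn, hT⟩)
    · linarith
    · rcases lt_or_ge (nat y n) (nat y M) with hnM | hnM
      · exact h' n ((nat_lt_nat hn hM).1 hnM) hT
      · linarith [ht n _ hn hnM hT]
  · exact .inr (.inr h')

/-- Within F of z only indices n < M matter, because the other terms exceed 1. The relevant terms
are Lipschitz with constant below M + 1, so a displacement of at most E / (M + 1) changes them by at
most E. -/
theorem Seq.cut_continuous (h : Seq x Q I w s) (hz : UnitAt x z) (hE : Germ x E) (hpos : 0 < E x) :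
    ∃ D, Germ x D ∧ 0 < D x ∧ ∀ᶠ y in 𝓝 x, ∀ z', UnitAt y z' → Dist y z z' (D y) → ∀ k,
      (CutAt y w s z k → CutAt y w s z' (k + E y)) ∧
      (CutAt y w s z' k → CutAt y w s z (k + E y)) := by
  obtain ⟨M, F, hM, hF, hF₀, ht⟩ := h.tail hz
  have hM₀ := nat_add_one_pos (x := x) (a := M)
  obtain ⟨D, hD, e⟩ := exists_germ (min (F x) (E x / (nat x M + 1)))
  refine ⟨D, hD, e ▸ lt_min hF₀ (div_pos hpos hM₀), ?_⟩
  have hDE : D x * (nat x M + 1) ≤ E x := by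
    rw [e, ← le_div_iff₀ hM₀]
    exact min_le_right _ _
  filter_upwards [ht, hz.eventually, hM.eventually, hD.le hF (e ▸ min_le_left _ _),
    (hD.mul ((Germ.nat hM).add .one)).le hE hDE, Germ.zero.lt hF hF₀, Germ.zero.lt hE hpos]
    with y ht hz hM hDF hDE hF₀ hE₀ z' hz' hd k
  have aux : ∀ {a b : Obj}, UnitAt y a → UnitAt y b → Dist y a b (D y) → Dist y z a (F y) →
      CutAt y w s a k → CutAt y w s b (k + E y) := by
    rintro a b ha hb hab hza (h₁ | ⟨n, hn, hT⟩)
    · exact .inl (by linarith)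
    · rcases lt_or_ge (nat y n) (nat y M) with hnM | hnM
      · refine .inr ⟨n, hn, (hT.of_dist hab ha.real hb.real).mono hb.real ?_⟩
        have := hab.pos ha.real
        nlinarith
      · exact .inl (by linarith [ht a n k ha hza hn hnM hT])
  exact ⟨aux hz hz' hd (hz.real.dist_self hF₀),
    aux hz' hz hd.symm (hd.mono hz.real hz'.real hDF)⟩

/-- The bounded formula that expresses `CutAt`. -/
def cutF {i : ℕ} (q z Q I w s : Tm i) : Fml i :=
  RatLt ratOne q ⋎ ExIn .omega fun n => termF n q z Q I w s

theorem bounded_cutF {i : ℕ} (q z Q I w s : Tm i) : (cutF q z Q I w s).Bounded :=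
  .or (bounded_RatLt _ _) (.exIn _ (bounded_termF _ _ _ _ _ _ _))

theorem sat_cutF {i : ℕ} {q z Q I w s : Tm i} {v : Fin i → Obj}
    (h : Seq x (Q.eval v) (I.eval v) (w.eval v) (s.eval v)) (hz : RealAt x (z.eval v))
    (hq : Code x (q.eval v) k) :
    Sat x (cutF q z Q I w s) v ↔ CutAt x (w.eval v) (s.eval v) (z.eval v) k := by
  have h₁ : Sat x (RatLt ratOne q) v ↔ 1 < k := by
    simp [ratOne, rLt_iff (code_one.2 rfl) hq]
  rw [cutF, sat_or, h₁, sat_ExIn, CutAt]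
  refine or_congr_right (exists_congr fun n => and_congr_right fun hn => ?_)
  simpa using sat_termF (m := .var 0) (q := q.lift) (z := z.lift) (Q := Q.lift) (I := I.lift)
    (w := w.lift) (s := s.lift) (v := n ∷ v) (by simpa using h)
        (by simpa using hn) (by simpa using hz)
    (by simpa using hq)

/-- The real number `u` is the value at `z` of the function given by the cuts above. -/
def ValueAt (x : Point) (w s z u : Obj) : Prop :=
  ∀ᶠ y in 𝓝 x, (∀ q, Mem y q u → ∃ k, Code y q k) ∧
    ∀ q k, Code y q k → (Mem y q u ↔ CutAt y w s z k)

theorem ValueAt.eventually (h : ValueAt x w s z u) : ∀ᶠ y in 𝓝 x, ValueAt y w s z u :=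
  h.eventually_nhds

theorem ValueAt.up_iff (h : ValueAt x w s z u) : Up x u k ↔ CutAt x w s z k := by
  constructor
  · rintro ⟨q, hq, hu⟩
    exact (h.self_of_nhds.2 q k hq).1 hu
  · intro h'
    obtain ⟨q, hq⟩ := exists_code k
    exact ⟨q, hq, (h.self_of_nhds.2 q k hq).2 h'⟩

theorem ValueAt.unique (h : ValueAt x w s z u) (h' : ValueAt x w s z u') : Eqv x u u' := by
  refine .of_mem_iff ?_
  filter_upwards [h, h'] with y h h' q
  constructor <;> intro hq
  · obtain ⟨k, hk⟩ := h.1 q hq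
    exact (h'.2 q k hk).2 ((h.2 q k hk).1 hq)
  · obtain ⟨k, hk⟩ := h'.1 q hq
    exact (h.2 q k hk).2 ((h'.2 q k hk).1 hq)

theorem Seq.exists_valueAt (h : Seq x Q I w s) (hz : RealAt x z) : ∃ u, ValueAt x w s z u := by
  obtain ⟨u, hu⟩ := exists_cut (x := x) (cutF (.var 0) (.var 1) (.var 2) (.var 3) (.var 4) (.var 5))
    (bounded_cutF _ _ _ _ _ _) ![z, Q, I, w, s]
  refine ⟨u, ?_⟩
  filter_upwards [hu, h.eventually, hz.eventually] with y hu h hz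
  refine ⟨fun q hq => ((hu q).1 hq).1, fun q k hq => ?_⟩
  rw [hu, and_iff_right ⟨k, hq⟩]
  exact sat_cutF (by simpa using h) (by simpa using hz) (by simpa using hq)

/-- The terms with n < M are greater than 1 / (M + 1) because of their part 1 / (n + 1), and all
later ones are greater than 1. -/
theorem ValueAt.posAt (h : ValueAt x w s z u) (hs : Seq x Q I w s) (hz : UnitAt x z) :
    PosAt x u := by
  obtain ⟨M, hM, ht⟩ := hs.tail_lo hz
  refine posAt_iff.2 ⟨1 / (nat x M + 1), one_div_pos.2 nat_add_one_pos,
    lo_of_eventually (.one_div hM) ?_⟩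
  filter_upwards [h.eventually, ht, hM.eventually] with y h ht hM hu
  have hM₁ : 1 / (BISH.nat y M + 1) ≤ 1 := by
    rw [div_le_one nat_add_one_pos]
    linarith [nat_nonneg (x := y) (a := M)]
  rcases h.up_iff.1 hu with h₁ | ⟨n, hn, hT⟩
  · linarith
  · rcases lt_or_ge (nat y n) (nat y M) with hnM | hnM
    · have := hT.2.1
      rw [one_div_lt_one_div nat_add_one_pos nat_add_one_pos] at this
      linarith
    · linarith [ht n _ hn hnM hT]

theorem ValueAt.realAt (h : ValueAt x w s z u) (hs : Seq x Q I w s) (hz : UnitAt x z) :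
    RealAt x u := by
  refine realAt_of (h.mono fun y h => h.1) ⟨2, h.up_iff.2 (.inl one_lt_two)⟩ ?_ ?_ ?_ ?_
  · obtain ⟨k, -, hk⟩ := posAt_iff.1 (h.posAt hs hz)
    exact ⟨k, hk⟩
  · filter_upwards [h.eventually, hz.eventually] with y h hz k hk
    obtain ⟨l, hl, h'⟩ := (h.up_iff.1 hk).exists_lt hz.real
    exact ⟨l, hl, h.up_iff.2 h'⟩
  · filter_upwards [h.eventually, hz.eventually] with y h hz q k l hk hkl hq
    exact (h.self_of_nhds.2 q l hq).2 ((h.up_iff.1 hk).mono hz.real hkl.le)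
  · filter_upwards [h.eventually, hz.eventually, hs.eventually] with y h hz hs E l hE hl
    rw [h.up_iff]
    refine (hs.cut_located hz hE hl).imp_left fun h' => ?_
    filter_upwards [h', h.eventually] with y h' h hu
    exact h' (h.up_iff.1 hu)

theorem Seq.exists_function (h : Seq x Q I w s) : ∃ f, ∀ᶠ y in 𝓝 x,
    (∀ p, Mem y p f → ∃ a u, Eqv y p (.opair a u) ∧ UnitAt y a ∧ ValueAt y w s a u) ∧
    ∀ a u, Mem y (.opair a u) f ↔ UnitAt y a ∧ ValueAt y w s a u := by
  have key : ∀ᶠ y in 𝓝 x, ∀ a u, UnitAt y a → (Sat y (All fun q => iff (q ∈ₛ .var 2)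
      (IsRat q ⋏ cutF q (.var 1) (.var 3) (.var 4) (.var 5) (.var 6))) ![a, u, Q, I, w, s] ↔
      ValueAt y w s a u) := by
    filter_upwards [h.eventually.eventually_nhds] with y h a u ha
    simp only [sat_All, sat_iff, sat_and, sat_mem, sat_IsRat, ev_forall_ev, eval_var,
      Matrix.cons_val_zero]
    refine eventually_congr ?_
    filter_upwards [h, ha.eventually] with y h ha
    have e : ∀ q k, Code y q k → (Sat y (cutF (.var 0) (.var 1) (.var 3) (.var 4) (.var 5) (.var 6))
        ![q, a, u, Q, I, w, s] ↔ CutAt y w s a k) := fun q k hq =>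
      sat_cutF (by simpa using h) (by simpa using ha.real) (by simpa using hq)
    constructor
    · intro h'
      refine ⟨fun q hq => ((h' q).1 hq).1, fun q k hq => ?_⟩
      rw [← e q k hq]
      exact (h' q).trans (and_iff_right ⟨k, hq⟩)
    · rintro ⟨h₁, h₂⟩ q
      constructor
      · intro hq
        obtain ⟨k, hk⟩ := h₁ q hq
        exact ⟨⟨k, hk⟩, (e q k hk).2 ((h₂ q k hk).1 hq)⟩
      · rintro ⟨⟨k, hk⟩, hq⟩
        exact (h₂ q k hk).2 ((e q k hk).1 hq)
  -- The formula says that u consists exactly of the rational numbers in the cut at z; on I, this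
  -- determines u.
  obtain ⟨f, hf⟩ := exists_graph (x := x) (a := I) (v := ![Q, I, w, s])
    (All fun q => iff (q ∈ₛ .var 2)
      (IsRat q ⋏ cutF q (.var 1) (.var 3) (.var 4) (.var 5) (.var 6))) (by
      filter_upwards [key.eventually_nhds, h.eventually] with y key h d hd
      have hd' := (h.unit.self_of_nhds d).1 hd
      obtain ⟨u, hu⟩ := h.exists_valueAt hd'.real
      refine ⟨u, (key.self_of_nhds d u hd').2 hu, ?_⟩
      filter_upwards [key, hd'.eventually, hu.eventually] with z key hd hu u' hu'
      exact ((key d u' hd).1 hu').unique hu)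
  refine ⟨f, ?_⟩
  filter_upwards [hf, key, h.unit] with y ⟨h₁, h₂⟩ key hI
  constructor
  · intro p hp
    obtain ⟨a, u, e, ha, hu⟩ := h₁ p hp
    rw [hI] at ha
    exact ⟨a, u, e, ha, (key a u ha).1 hu⟩
  · intro a u
    rw [h₂, hI]
    exact and_congr_right fun ha => key a u ha

end

end BISH

/-! ### The infimum of the function and the occurrence of ω -/

namespace BISH
open Filter Topology

section

variable {x : Point} {n f m E ρ : Obj} {k l : K x} {Q I w s : Obj}

/-- `min 1 (inf (1 / (n + 1))) < k`, where the infimum is over all `n` such that the terms up to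
`s n` differ from `w`. -/
def InfCut (x : Point) (w s : Obj) (k : K x) : Prop :=
  1 < k ∨ ∃ n, Mem x n .omega ∧ Before x w s n ∧ 1 / (nat x n + 1) < k

theorem exists_infCut (x : Point) (w s : Obj) : ∃ m, ∀ᶠ y in 𝓝 x,
    (∀ q, Mem y q m → ∃ k, Code y q k) ∧ ∀ q k, Code y q k → (Mem y q m ↔ InfCut y w s k) := by
  obtain ⟨m, hm⟩ := exists_cut (x := x) (RatLt ratOne (.var 0) ⋎ ExIn .omega fun n =>
    (AllIn (succ n) fun j => neg (opair j (.var 3) ∈ₛ .var 4)) ⋏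
      RatLt (frac (succ .empty) .empty n) (.var 1)) (.or (bounded_RatLt _ _) (.exIn _ (.and
        (.allIn _ (.neg (.mem _ _))) (bounded_RatLt _ _)))) ![w, s]
  refine ⟨m, ?_⟩
  filter_upwards [hm] with y hm
  refine ⟨fun q hq => ((hm q).1 hq).1, fun q k hq => ?_⟩
  rw [hm, and_iff_right ⟨k, hq⟩, InfCut, sat_or, sat_ExIn]
  refine or_congr ?_ (exists_congr fun n => and_congr_right fun hn => ?_)
  · simp [ratOne, rLt_iff (code_one.2 rfl) hq]
  · rw [← rLt_iff (code_one_div hn) hq]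
    simp [Before]

theorem infCut_up_iff (hm : ∀ q k, Code x q k → (Mem x q m ↔ InfCut x w s k)) :
    Up x m k ↔ InfCut x w s k := by
  constructor
  · rintro ⟨q, hq, h⟩
    exact (hm q k hq).1 h
  · intro h
    obtain ⟨q, hq⟩ := exists_code k
    exact ⟨q, hq, (hm q k hq).2 h⟩

/-- Choose 1 / (N + 1) < l. If w does not occur up to N, then N shows that the infimum is below l.
If w occurs first at j + 1, the infimum is 1 / (j + 1), a rational number that can be compared with
l; if it occurs first at 0, the infimum is 1. -/
theorem Seq.infCut_located (h : Seq x Q I w s) {E : ∀ y, K y} (hE : Germ x E) (hl : E x < l) :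
    (∀ᶠ y in 𝓝 x, ¬ InfCut y w s (E y)) ∨ InfCut x w s l := by
  rcases lt_or_ge 1 l with h₁ | h₁
  · exact .inr (.inl h₁)
  have hE₁ : ∀ᶠ y in 𝓝 x, E y < 1 := hE.lt .one (hl.trans_le h₁)
  rcases le_or_gt l 0 with h₀ | h₀
  · left
    filter_upwards [hE₁, hE.lt .zero (hl.trans_le h₀)] with y h₁ h₀
    rintro (h | ⟨n, -, -, h⟩)
    · linarith
    · linarith [one_div_pos.2 (nat_add_one_pos (x := y) (a := n))]
  obtain ⟨N, hN, hNl⟩ := exists_one_div_lt h₀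
  rcases h.before_or hN with hb | ⟨k, hk, hks, hkb⟩
  · exact .inr (.inr ⟨N, hN, hb, hNl⟩)
  have hkω := mem_omega_of_mem (succ_mem_omega hN) hk
  rcases mem_omega.1 hkω with hk₀ | ⟨j, hj, hkj⟩
  · left
    filter_upwards [hE₁, hks.eventually, hk₀.eventually] with y h₁ hks hk₀
    rintro (h | ⟨n, hn, hb, -⟩)
    · linarith
    · refine (hb.mono hn zero_mem_omega ?_).not_mem ((hk₀.opair (.refl _ _)).mem_left.1 hks)
      rw [nat_empty]
      exact nat_nonneg
  · rcases lt_or_ge (1 / (nat x j + 1)) l with hjl | hjl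
    · refine .inr (.inr ⟨j, hj, ?_, hjl⟩)
      filter_upwards [hkb, hkj.eventually] with y hkb hkj i hi
      exact hkb i (hkj.mem_right.2 hi)
    · left
      filter_upwards [hE₁, hks.eventually, hkj.eventually, hj.eventually,
        hE.lt (.one_div hj) (hl.trans_le hjl)] with y h₁ hks hkj hj hEj
      rintro (h | ⟨n, hn, hb, hnE⟩)
      · linarith
      · have hlt := hnE.trans hEj
        rw [one_div_lt_one_div nat_add_one_pos nat_add_one_pos] at hlt
        refine (hb.mono hn (succ_mem_omega hj) ?_).not_mem
          ((hkj.opair (.refl _ _)).mem_left.1 hks)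
        rw [nat_succ hj]
        by_contra! hnj
        rw [nat_lt_add_one hn hj] at hnj
        linarith

/-- The pointwise positivity property yields an index at which the sequence equals `w`. -/
theorem Seq.exists_mem (h : Seq x Q I w s) (hP : Sat x POSp ![]) :
    ∃ k, Mem x k .omega ∧ Mem x (.opair k w) s := by
  -- If the sequence starts with w, nothing remains to be shown. Otherwise its first term provides a
  -- point of [0,1].
  rcases h.before_or zero_mem_omega with hb₀ | ⟨k, hk, hks, -⟩
  swap
  · exact ⟨k, mem_omega_of_mem (succ_mem_omega zero_mem_omega) hk, hks⟩
  obtain ⟨t₀, -, ht₀⟩ := h.exists_unitAt zero_mem_omega hb₀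
  obtain ⟨f, hf⟩ := h.exists_function
  obtain ⟨m, hm⟩ := exists_infCut x w s
  have hm' : ∀ᶠ y in 𝓝 x, ∀ k, Up y m k ↔ InfCut y w s k := by
    filter_upwards [hm] with y hm k
    exact infCut_up_iff hm.2
  have hreal : RealAt x m := by
    refine realAt_of (hm.mono fun y hm => hm.1) ⟨2, (hm'.self_of_nhds _).2 (.inl one_lt_two)⟩
      ⟨0, lo_of_eventually .zero ?_⟩ ?_ ?_ ?_
    · filter_upwards [hm'] with y hm
      rw [hm]
      rintro (h | ⟨n, -, -, h⟩)
      · exact absurd h (by norm_num)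
      · linarith [one_div_pos.2 (nat_add_one_pos (x := y) (a := n))]
    · filter_upwards [hm'] with y hm k hk
      simp only [hm] at hk ⊢
      rcases hk with hk | ⟨n, hn, hb, hk⟩
      · obtain ⟨l, h₁, h₂⟩ := exists_between hk
        exact ⟨l, h₂, .inl h₁⟩
      · obtain ⟨l, h₁, h₂⟩ := exists_between hk
        exact ⟨l, h₂, .inr ⟨n, hn, hb, h₁⟩⟩
    · filter_upwards [hm, hm'] with y hm hm' q k l hk hkl hq
      rw [hm.2 q l hq]
      rw [hm'] at hk
      exact hk.imp (fun h => h.trans hkl) fun ⟨n, hn, hb, h⟩ => ⟨n, hn, hb, h.trans hkl⟩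
    · filter_upwards [hm'.eventually_nhds, h.eventually] with y hm h E l hE hl
      rw [hm.self_of_nhds]
      refine (h.infCut_located hE hl).imp_left fun h' => ?_
      filter_upwards [hm, h'] with z hm h'
      rwa [hm]
  have hfun : FunAt x f := by
    constructor
    · filter_upwards [hf, h.eventually] with y hf h p hp
      obtain ⟨a, u, e, ha, hu⟩ := hf.1 p hp
      exact ⟨a, u, ha, hu.realAt h ha, e⟩
    · filter_upwards [hf.eventually_nhds, h.eventually] with y hf h a ha
      obtain ⟨u, hu⟩ := h.exists_valueAt ha.real
      refine ⟨u, (hf.self_of_nhds.2 a u).2 ⟨ha, hu⟩, ?_⟩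
      filter_upwards [hf, hu.eventually] with z hf hu u' hu'
      exact ((hf.2 a u').1 hu').2.unique hu
  have hcont : ContAt x f := by
    filter_upwards [hf.eventually_nhds, h.eventually] with y hf h a ha ε ⟨_, e, h0, he, hpos⟩
    rw [code_zero] at h0
    subst h0
    -- A third of the tolerance, because `dist_of_up` loses a factor 3.
    obtain ⟨F, hF, hFx⟩ := exists_germ (x := y) (e / 3)
    obtain ⟨D, hD, hD₀, hc⟩ := h.cut_continuous ha hF (by rw [hFx]; linarith)
    obtain ⟨δ, hδ⟩ := hD.exists_code
    refine ⟨δ, ⟨0, _, code_zero.2 rfl, hδ.self_of_nhds, hD₀⟩, ?_⟩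
    have h3 : ∀ᶠ z in 𝓝 y, BISH.rat z ε = 3 * F z := by
      have := he.germ.eq ((hF.add hF).add hF) (by rw [he.rat_eq, hFx]; ring)
      filter_upwards [this] with z this
      rw [this]; ring
    filter_upwards [hf, hc.eventually_nhds, h.eventually, hδ.eventually_nhds, h3, he.eventually,
      ha.eventually, Germ.zero.lt hF (by rw [hFx]; linarith), hF.eventually, hD.eventually]
      with z hf hc h hδ h3 he ha hF₀ hF hD b hb hab u u' hu hu'
    have hu := ((hf.2 a u).1 hu).2
    have hu' := ((hf.2 b u').1 hu').2
    rw [aDist_iff ha.real hb.real hδ.self_of_nhds] at hab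
    rw [aDist_iff (hu.realAt h ha) (hu'.realAt h hb) (h3 ▸ he)]
    refine dist_of_up hF (hu.realAt h ha) (hu'.realAt h hb) hF₀ ?_
    filter_upwards [hc, hab.eventually ha.real hb.real hD, hb.eventually, hu.eventually,
      hu'.eventually] with z' hc hab hb hu hu' k
    simp only [hu.up_iff, hu'.up_iff]
    exact hc b hb hab k
  have hpos : ∀ᶠ y in 𝓝 x, ∀ a u, Mem y (.opair a u) f → PosAt y u := by
    filter_upwards [hf, h.eventually] with y hf h a u hau
    obtain ⟨ha, hu⟩ := (hf.2 a u).1 hau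
    exact hu.posAt h ha
  have hinf : InfAt x f m := by
    refine ⟨hreal, ?_, ?_⟩
    · filter_upwards [hf, hm] with y hf hm a u hau q hq
      have hu := ((hf.2 a u).1 hau).2.self_of_nhds
      obtain ⟨k, hk⟩ := hu.1 q hq
      rw [hm.2 q k hk]
      exact ((hu.2 q k hk).1 hq).imp_right fun ⟨n, hn, hT⟩ => ⟨n, hn, hT.1, hT.2.1⟩
    · filter_upwards [hf, hm, h.eventually, ht₀.eventually] with y hf hm h ht₀ q hq
      obtain ⟨k, hk⟩ := hm.1 q hq
      -- For k > 1 any point will do, since the function never exceeds 1. Otherwise the point is s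
      -- n, where the distance vanishes and the n-th term is 1 / (n + 1).
      rcases (hm.2 q k hk).1 hq with h₁ | ⟨n, hn, hb, hnk⟩
      · obtain ⟨u, hu⟩ := h.exists_valueAt ht₀.real
        exact ⟨t₀, u, (hf.2 _ _).2 ⟨ht₀, hu⟩, (hu.self_of_nhds.2 q k hk).2 (.inl h₁)⟩
      · obtain ⟨t, hnt, ht⟩ := h.exists_unitAt hn hb
        obtain ⟨u, hu⟩ := h.exists_valueAt ht.real
        have hn₀ := nat_add_one_pos (x := y) (a := n)
        exact ⟨t, u, (hf.2 _ _).2 ⟨ht, hu⟩, (hu.self_of_nhds.2 q k hk).2 (.inr ⟨n, hn, hb, hnk, t,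
          ht, hnt, ht.real.dist_self (div_pos ((one_div_pos.2 hn₀).trans hnk) hn₀)⟩)⟩
  obtain ⟨k, hk, hlo⟩ := posAt_iff.1 ((sat_POSp.1 hP).self_of_nhds f hfun hcont hpos m hinf)
  -- If w did not occur up to N, the infimum would be at most 1 / (N + 1) < k, against the lower
  -- bound k.
  obtain ⟨N, hN, hNk⟩ := exists_one_div_lt hk
  rcases h.before_or hN with hb | ⟨j, hj, hjs, -⟩
  · exact (lt_irrefl k (hlo.lt_of_up ((hm'.self_of_nhds k).2 (.inr ⟨N, hN, hb, hNk⟩)) hreal)).elim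
  · exact ⟨j, mem_omega_of_mem (succ_mem_omega hN) hj, hjs⟩

/-- Only distances between points of [0,1] enter the construction, so the abstract metric can be
discarded. The unit interval is a set since it is contained in E. -/
theorem seq_of_asl (hmet : MetricAt x E ρ) (hsub : SubspaceAt x E ρ) (hex : ExtraAt x E ρ w)
    (hs : SeqAt x w s) (haway : ∀ᶠ y in 𝓝 x, ∀ a, UnitAt y a → AwayAt y ρ s a) :
    ∃ Q I, Seq x Q I w s := by
  obtain ⟨Q, hQ⟩ := exists_rationals x
  obtain ⟨I, hI⟩ := exists_unit_interval (x := x) E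
  obtain ⟨⟨-, hρ⟩, hmet, -⟩ := metricAt_iff.1 hmet
  obtain ⟨hsubE, hsub⟩ := hsub
  obtain ⟨hw, δ, ⟨_, e, h0, he, hpos⟩, hδ⟩ := hex
  rw [code_zero] at h0
  subst h0
  refine ⟨Q, I, hQ, ?_, ?_, ?_, ?_, ?_⟩
  · filter_upwards [hI, hsubE] with y hI hE d
    rw [hI]
    exact ⟨fun h => h.2, fun h => ⟨hE d h, h⟩⟩
  · filter_upwards [hρ, hmet, hw.eventually, hδ, he.eventually,
      Germ.zero.lt he.germ (he.rat_eq ▸ hpos)]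
      with y hρ hmet hw hδ he hpos hu
    -- If w were in [0,1], the distance of w from itself, which is 0, would be at least δ.
    obtain ⟨d, hd, -⟩ := hρ (.opair w w) ⟨w, hw, w, hw, .refl _ _⟩
    exact hδ w d hu hd (((hmet w w d hd).2.1.self_of_nhds.2 (.refl _ _)).self_of_nhds δ
      ⟨0, _, code_zero.2 rfl, he, hpos⟩)
  · filter_upwards [hs.1, hs.2] with y h₁ h₂ n hn
    obtain ⟨t, ht, -⟩ := h₂ n hn
    obtain ⟨a, b, ha, hb, e'⟩ := h₁ _ ht
    have hbt := (eqv_opair.1 e').2.symm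
    exact ⟨t, ht, hb.imp hbt.unitAt hbt.symm.trans⟩
  · filter_upwards [hs.2] with y h n t t' hn ht ht'
    obtain ⟨b, -, hb⟩ := h n hn
    exact (hb.self_of_nhds t ht).trans (hb.self_of_nhds t' ht').symm
  · filter_upwards [haway, hρ.eventually_nhds, hsubE.eventually_nhds, hsub.eventually_nhds]
      with y haway hρ hsubE hsub a ha
    obtain ⟨N, hN, δ, ⟨_, e, h0, he, hpos⟩, h⟩ := haway a ha
    rw [code_zero] at h0
    subst h0
    refine ⟨N, fun z => rat z δ, hN, he.germ, by simpa only [he.rat_eq] using hpos, ?_⟩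
    filter_upwards [h, hN.eventually, hρ, hsubE, hsub, he.eventually, ha.eventually]
      with z h hN hρ hsubE hsub he ha k t hk hNk hkt ht hd
    obtain ⟨d, hd', -⟩ := hρ (.opair a t) ⟨a, hsubE a ha, t, hsubE t ht, .refl _ _⟩
    refine h k hk ((nat_le_nat hN hk).1 hNk) t d hkt hd' ?_
    rw [(hsub a t d ha ht hd' δ ⟨_, he⟩).self_of_nhds, aDist_iff ha.real ht.real he]
    exact hd

theorem sat_ASL_of_sat_POSp (hP : Sat x POSp ![]) : Sat x ASL ![] := by
  rw [sat_ASL]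
  filter_upwards [hP.eventually] with y hP E ρ w hmet hsub hex s hs haway
  obtain ⟨Q, I, h⟩ := seq_of_asl hmet hsub hex hs haway
  exact h.exists_mem hP

end

end BISH

/-! ### From the anti-Specker property to positivity -/

namespace BISH
open Filter Topology

/-! ### Countable choice -/

section

variable {x : Point} {n : ℕ} {v : Fin n → Obj} {a b c d r : Obj}

theorem Eqv.sat₂ (h : Eqv x a b) (h' : Eqv x c d) (φ : Fml (n + 2)) (hs : Sat x φ (a ∷ c ∷ v)) :
    Sat x φ (b ∷ d ∷ v) := by
  refine h.sat φ ?_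
  let τ : Fin (n + 2) → Tm (n + 2) :=
    Fin.cases (.var 1) (Fin.cases (.var 0) fun i => .var i.succ.succ)
  have e : ∀ d u, (fun i => (τ i).eval (u ∷ d ∷ v)) = d ∷ u ∷ v := fun d u => by
    funext i
    refine Fin.cases rfl (fun i => Fin.cases rfl (fun i => rfl) i) i
  have := h'.sat (φ.subst τ) (v := a ∷ v) (by rwa [sat_subst, e])
  rwa [sat_subst, e] at this

theorem dependent_choice (h : ∀ᶠ y in 𝓝 x, ∀ c, Mem y c a → ∃ d, Mem y d a ∧ Mem y (.opair c d) r)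
    (hb : Mem x b a) : ∃ g,
    ((∀ᶠ y in 𝓝 x, ∀ p, Mem y p g → ∃ k c, Mem y k .omega ∧ Mem y c a ∧ Eqv y p (.opair k c)) ∧
      ∀ᶠ y in 𝓝 x, ∀ k, Mem y k .omega → ∃ c, Mem y (.opair k c) g ∧
        ∀ᶠ z in 𝓝 y, ∀ c', Mem z (.opair k c') g → Eqv z c' c) ∧
    Mem x (.opair .empty b) g ∧
    ∀ᶠ y in 𝓝 x, ∀ k, Mem y k .omega → ∀ c d, Mem y (.opair k c) g →
      Mem y (.opair k.succ d) g → Mem y (.opair c d) r := by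
  have := (Derives.ax (Γ := []) (CZFDC.dependentChoice (n := 0))).sat (x := x) ![]
  simp [sat_IsFun] at this
  obtain ⟨g, ⟨h₁, h₂⟩, h₃⟩ := this.self_of_nhds a r h b hb
  refine ⟨g, ⟨?_, h₂⟩, h₃⟩
  filter_upwards [h₁] with y h₁ p hp
  obtain ⟨k, hk, c, hc, e⟩ := h₁ p hp
  exact ⟨k, c, hk, hc, e⟩

/-- Dependent choice is applied to pairs ⟨k, t⟩ with φ(k, t), where each step raises the first
component by one; the second components form the sequence. -/
theorem countable_choice (φ : Fml (n + 2))
    (h : ∀ᶠ y in 𝓝 x, ∀ k, Mem y k .omega → ∃ t, Sat y φ (k ∷ t ∷ v)) : ∃ s, ∀ᶠ y in 𝓝 x,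
      (∀ p, Mem y p s → ∃ k t, Eqv y p (.opair k t) ∧ Mem y k .omega ∧ Sat y φ (k ∷ t ∷ v)) ∧
      (∀ k t, Mem y (.opair k t) s → Sat y φ (k ∷ t ∷ v)) ∧
      ∀ k, Mem y k .omega → ∃ t, Mem y (.opair k t) s ∧
        ∀ᶠ z in 𝓝 y, ∀ t', Mem z (.opair k t') s → Eqv z t' t := by
  let σ : Fin (n + 2) → Tm (n + 3) :=
    Fin.cases (.var 1) (Fin.cases (.var 0) fun i => .var i.succ.succ.succ)
  have key : ∀ y k p, Sat y (Ex fun t => φ.subst σ ⋏ .var 2 =ₛ opair (.var 1) t) (k ∷ p ∷ v) ↔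
      ∃ t, Sat y φ (k ∷ t ∷ v) ∧ Eqv y p (.opair k t) := by
    intro y k p
    have e : ∀ t, (fun i => (σ i).eval (t ∷ k ∷ p ∷ v)) = k ∷ t ∷ v := fun t => by
      funext i
      refine Fin.cases rfl (fun i => Fin.cases rfl (fun i => rfl) i) i
    simp [sat_subst, e]
  -- Dependent choice needs a set: A consists of pairs ⟨k, t⟩ with φ(k, t) and has one for each k.
  obtain ⟨A, hA⟩ := collection (x := x) (a := .omega) (v := v)
    (Ex fun t => φ.subst σ ⋏ .var 2 =ₛ opair (.var 1) t) (by
      filter_upwards [h] with y h k hk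
      obtain ⟨t, ht⟩ := h k hk
      exact ⟨.opair k t, (key _ _ _).2 ⟨t, ht, .refl _ _⟩⟩)
  simp only [key] at hA
  have key' : ∀ y p q, Sat y (ExIn .omega fun k => Ex fun t =>
      Ex fun t' => .var 3 =ₛ opair (.var 2) t ⋏
        opair (succ (.var 2)) t' ∈ₛ .var 5 ⋏ .var 4 =ₛ opair (.var 3) (opair (succ (.var 2)) t'))
        ![p, q, A] ↔ ∃ k, Mem y k .omega ∧ ∃ t t', Eqv y p (.opair k t) ∧
      Mem y (.opair k.succ t') A ∧ Eqv y q (.opair p (.opair k.succ t')) := by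
    intro y p q
    simp
  have hA' : ∀ᶠ y in 𝓝 x, ∀ k, Mem y k .omega → ∃ t, Mem y (.opair k t) A := by
    filter_upwards [hA] with y hA k hk
    obtain ⟨p, hp, t, -, e⟩ := hA.1 k hk
    exact ⟨t, e.mem_left.1 hp⟩
  -- The relation leads from each ⟨k, t⟩ in A to some ⟨k + 1, t'⟩ in A. Collection suffices, as not
  -- all such pairs are required.
  obtain ⟨r, hr⟩ := collection (x := x) (a := A) (v := ![A])
    (ExIn .omega fun k => Ex fun t => Ex fun t' => .var 3 =ₛ opair (.var 2) t ⋏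
        opair (succ (.var 2)) t' ∈ₛ .var 5 ⋏ .var 4 =ₛ opair (.var 3)
            (opair (succ (.var 2)) t')) (by
      filter_upwards [hA, hA'] with y hA hA' p hp
      obtain ⟨k, hk, t, -, e⟩ := hA.2 p hp
      obtain ⟨t', ht'⟩ := hA' k.succ (succ_mem_omega hk)
      exact ⟨_, (key' _ _ _).2 ⟨k, hk, t, t', e, ht', .refl _ _⟩⟩)
  simp only [key'] at hr
  obtain ⟨t₀, ht₀⟩ := hA'.self_of_nhds _ zero_mem_omega
  obtain ⟨g, ⟨hg₁, hg₂⟩, hg₀, hg⟩ := dependent_choice (x := x) (a := A) (r := r) (by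
    filter_upwards [hr] with y hr p hp
    obtain ⟨q, hq, k, hk, t, t', -, ht', e⟩ := hr.1 p hp
    exact ⟨_, ht', e.mem_left.1 hq⟩) ht₀
  have hind : ∀ y k, Sat y (Ex fun t => opair (.var 1) (opair (.var 1) t) ∈ₛ .var 2) ![k, g] ↔
      ∃ t, Mem y (.opair k (.opair k t)) g := by
    intro y k
    simp
  -- By induction, the k-th value of g has first component k.
  have hg' : ∀ᶠ y in 𝓝 x, ∀ k, Mem y k .omega → ∃ t, Mem y (.opair k (.opair k t)) g := by
    filter_upwards [hg₀.eventually, hg₂.eventually_nhds, hg.eventually_nhds, hr.eventually_nhds]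
      with y hg₀ hg₂ hg hr k hk
    refine (hind y k).1 (omega_induction _ ((hind y _).2 ⟨t₀, hg₀⟩) ?_ hk)
    filter_upwards [hg₂, hg, hr] with z hg₂ hg hr j hj ih
    obtain ⟨t, ht⟩ := (hind z j).1 ih
    obtain ⟨p, hp, -⟩ := hg₂ j.succ (succ_mem_omega hj)
    obtain ⟨c, -, i, -, t₁, t', e₁, -, e₂⟩ := hr.2 _ (hg j hj _ _ ht hp)
    obtain ⟨e₃, e₄⟩ := eqv_opair.1 e₂
    have e₅ := (eqv_opair.1 (e₃.trans e₁)).1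
    exact (hind z _).2 ⟨t', ((Eqv.refl _ _).opair
        (e₄.trans (e₅.symm.succ.opair (.refl _ _)))).mem_left.1 hp⟩
  have huniq : ∀ᶠ y in 𝓝 x, ∀ k t t', Mem y k .omega → Mem y (.opair k (.opair k t)) g →
      Mem y (.opair k (.opair k t')) g → Eqv y t t' := by
    filter_upwards [hg₂] with y hg₂ k t t' hk ht ht'
    obtain ⟨c, -, hc⟩ := hg₂ k hk
    exact (eqv_opair.1 ((hc.self_of_nhds _ ht).trans (hc.self_of_nhds _ ht').symm)).2
  have hψ : ∀ y k t, Sat y (opair (.var 0) (opair (.var 0) (.var 1)) ∈ₛ .var 2) ![k, t, g] ↔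
      Mem y (.opair k (.opair k t)) g := by
    intro y k t
    simp
  obtain ⟨s, hs⟩ := exists_graph (x := x) (a := .omega) (v := ![g])
    (opair (.var 0) (opair (.var 0) (.var 1)) ∈ₛ .var 2) (by
      filter_upwards [hg', huniq.eventually_nhds] with y hg' huniq k hk
      obtain ⟨t, ht⟩ := hg' k hk
      refine ⟨t, (hψ _ _ _).2 ht, ?_⟩
      filter_upwards [huniq, ht.eventually, hk.eventually] with z huniq ht hk t' ht'
      exact huniq k t' t hk ((hψ _ _ _).1 ht') ht)
  simp only [hψ] at hs
  have hφ : ∀ᶠ y in 𝓝 x, ∀ k t, Mem y (.opair k (.opair k t)) g → Sat y φ (k ∷ t ∷ v) := by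
    filter_upwards [hg₁, hA] with y hg₁ hA k t ht
    obtain ⟨j, c, -, hc, e⟩ := hg₁ _ ht
    obtain ⟨i, -, t', h', e'⟩ := hA.2 c hc
    obtain ⟨e₁, e₂⟩ := eqv_opair.1 ((eqv_opair.1 e).2.trans e')
    exact e₁.symm.sat₂ e₂.symm φ h'
  refine ⟨s, ?_⟩
  filter_upwards [hs, hφ, hg', huniq.eventually_nhds, hs.eventually_nhds] with y hs hφ hg' huniq hs'
  refine ⟨fun p hp => ?_, fun k t h => hφ k t ((hs.2 k t).1 h).2, fun k hk => ?_⟩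
  · obtain ⟨k, t, e, hk, h⟩ := hs.1 p hp
    exact ⟨k, t, e, hk, hφ k t h⟩
  · obtain ⟨t, ht⟩ := hg' k hk
    refine ⟨t, (hs.2 k t).2 ⟨hk, ht⟩, ?_⟩
    filter_upwards [hs', huniq, hk.eventually, ht.eventually] with z hs huniq hk ht t' ht'
    exact huniq k t' t hk ((hs.2 k t').1 ht').2 ht

end

end BISH

namespace BISH
open Filter Topology

/-! ### The metric of a set of real numbers -/

section

variable {x : Point} {a a' b b' c d d' E m f : Obj} {k l r : K x}

theorem Eqv.aDist {q : Obj} (h : Eqv x a a') (h' : Eqv x b b') (hd : ADist x a b q) :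
    ADist x a' b' q := by
  simpa using h.sat₂ h' (AbsSubLt (.var 0) (.var 1) (.var 2)) (v := ![q]) (by simpa using hd)

/-- `d` is the distance of the real numbers `a` and `b`. -/
def DistSet (x : Point) (a b d : Obj) : Prop := ∀ᶠ y in 𝓝 x, ∀ q, Mem y q d ↔ ADist y a b q

theorem DistSet.eventually (h : DistSet x a b d) : ∀ᶠ y in 𝓝 x, DistSet y a b d :=
  h.eventually_nhds

theorem DistSet.unique (h : DistSet x a b d) (h' : DistSet x a b d') : Eqv x d d' := by
  refine .of_mem_iff ?_
  filter_upwards [h, h'] with y h h' q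
  rw [h, h']

theorem DistSet.congr (h : DistSet x a b d) (e : Eqv x a a') (e' : Eqv x b b') :
    DistSet x a' b' d := by
  filter_upwards [h, e.eventually, e'.eventually] with y h e e' q
  rw [h]
  exact ⟨e.aDist e', e.symm.aDist e'.symm⟩

theorem DistSet.symm (h : DistSet x a b d) : DistSet x b a d := by
  have aux : ∀ {y a b q}, ADist y a b q → ADist y b a q := by
    intro y a b q h
    simp only [ADist, sat_AbsSubLt_iff] at h ⊢
    obtain ⟨p, s, h, h₁, h₂, h₃, h₄⟩ := h
    exact ⟨p, s, h, h₂, h₁, h₄, h₃⟩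
  filter_upwards [h] with y h q
  rw [h]
  exact ⟨aux, aux⟩

theorem DistSet.up_iff (h : DistSet x a b d) (ha : RealAt x a) (hb : RealAt x b) :
    Up x d r ↔ Dist x a b r := by
  constructor
  · rintro ⟨q, hq, hqd⟩
    exact (aDist_iff ha hb hq).1 ((h.self_of_nhds q).1 hqd)
  · intro h'
    obtain ⟨q, hq⟩ := exists_code r
    exact ⟨q, hq, (h.self_of_nhds q).2 ((aDist_iff ha hb hq).2 h')⟩

theorem exists_dist (ha : RealAt x a) (hb : RealAt x b) : ∃ r, Dist x a b r := by
  obtain ⟨k, hk⟩ := ha.exists_lo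
  obtain ⟨k', hk'⟩ := hb.exists_lo
  obtain ⟨l, hl⟩ := ha.exists_up
  obtain ⟨l', hl'⟩ := hb.exists_up
  exact ⟨max l l' - min k k', min k k', hk.mono ha (min_le_left _ _),
      hk'.mono hb (min_le_right _ _),
    hl.mono ha (by rw [add_sub_cancel]; exact le_max_left _ _),
    hl'.mono hb (by rw [add_sub_cancel]; exact le_max_right _ _)⟩

theorem DistSet.realAt (h : DistSet x a b d) (ha : RealAt x a) (hb : RealAt x b) : RealAt x d := by
  have hup : ∀ᶠ y in 𝓝 x, ∀ r, Up y d r ↔ Dist y a b r := by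
    filter_upwards [h.eventually, ha.eventually, hb.eventually] with y h ha hb r
    exact h.up_iff ha hb
  refine realAt_of ?_ ?_ ⟨0, lo_of_eventually .zero ?_⟩ ?_ ?_ ?_
  · filter_upwards [h] with y h q hq
    exact ((h q).1 hq).code
  · obtain ⟨r, hr⟩ := exists_dist ha hb
    exact ⟨r, (h.up_iff ha hb).2 hr⟩
  · filter_upwards [hup, ha.eventually] with y hup ha h
    exact lt_irrefl _ (((hup _).1 h).pos ha)
  · filter_upwards [hup, ha.eventually, hb.eventually] with y hup ha hb k hk
    simp only [hup] at hk ⊢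
    exact hk.exists_lt ha hb
  · filter_upwards [hup, h, ha.eventually, hb.eventually] with y hup h ha hb q k l hk hkl hq
    rw [h, aDist_iff ha hb hq]
    exact ((hup k).1 hk).mono ha hb hkl.le
  · filter_upwards [hup.eventually_nhds, ha.eventually, hb.eventually] with y hup ha hb F l hF hl
    rw [hup.self_of_nhds]
    refine (dist_located ha hb hF hl).imp_left fun h => ?_
    filter_upwards [h, hup] with z h hup
    rwa [hup]

/-- Cuts are open: a rational above a can be lowered a little and is still above a, and the slack
pays for the distance to b. -/
theorem eqv_of_dist (ha : RealAt x a) (hb : RealAt x b)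
    (h : ∀ᶠ y in 𝓝 x, ∀ r : K y, 0 < r → Dist y a b r) : Eqv x a b := by
  refine ha.ext hb ?_
  filter_upwards [h, ha.eventually, hb.eventually] with y h ha hb k
  constructor <;> intro hk
  · obtain ⟨l, hl, h'⟩ := hk.exists_lt ha
    exact (h'.of_dist (h (k - l) (by linarith)) ha hb).mono hb (by linarith)
  · obtain ⟨l, hl, h'⟩ := hk.exists_lt hb
    exact (h'.of_dist (h (k - l) (by linarith)).symm hb ha).mono ha (by linarith)

theorem exists_distSet (x : Point) (a b : Obj) : ∃ d, DistSet x a b d := by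
  obtain ⟨Q, hQ⟩ := exists_rationals x
  obtain ⟨d, hd⟩ := exists_cut (x := x) (absSubLtIn (.var 3) (.var 1) (.var 2) (.var 0))
    (bounded_absSubLtIn _ _ _ _) ![a, b, Q]
  refine ⟨d, ?_⟩
  filter_upwards [hd, hQ] with y hd hQ q
  rw [hd, sat_absSubLtIn (by simpa using hQ)]
  exact ⟨fun h => h.2, fun h => ⟨h.code, h⟩⟩

/-- The metric of a set of real numbers. -/
theorem exists_metric (x : Point) (E : Obj) : ∃ ρ, ∀ᶠ y in 𝓝 x,
    (∀ p, Mem y p ρ → ∃ a b d, Eqv y p (.opair (.opair a b) d) ∧ Mem y a E ∧ Mem y b E ∧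
      DistSet y a b d) ∧
    ∀ a b d, Mem y (.opair (.opair a b) d) ρ ↔ Mem y a E ∧ Mem y b E ∧ DistSet y a b d := by
  obtain ⟨P, hP⟩ := exists_pairs x E E
  have key : ∀ y p d, Sat y (Ex fun a => Ex fun b => .var 2 =ₛ opair (.var 1) (.var 0) ⋏
      All fun q => q ∈ₛ .var 4 ⟺ AbsSubLt (.var 2) (.var 1) q) ![p, d] ↔
      ∃ a b, Eqv y p (.opair a b) ∧ DistSet y a b d := by
    intro y p d
    simp [DistSet]
  obtain ⟨ρ, hρ⟩ := exists_graph (x := x) (a := P) (v := ![])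
    (Ex fun a => Ex fun b => .var 2 =ₛ opair (.var 1) (.var 0) ⋏
      All fun q => q ∈ₛ .var 4 ⟺ AbsSubLt (.var 2) (.var 1) q) (by
      filter_upwards [hP] with y hP p hp
      obtain ⟨a, -, b, -, e⟩ := (hP p).1 hp
      obtain ⟨d, hd⟩ := exists_distSet y a b
      refine ⟨d, (key _ _ _).2 ⟨a, b, e, hd⟩, ?_⟩
      filter_upwards [e.eventually, hd.eventually] with z e hd d' hd'
      obtain ⟨a', b', e', hd'⟩ := (key _ _ _).1 hd'
      obtain ⟨e₁, e₂⟩ := eqv_opair.1 (e'.symm.trans e)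
      exact (hd'.congr e₁ e₂).unique hd)
  simp only [key] at hρ
  refine ⟨ρ, ?_⟩
  filter_upwards [hρ, hP] with y hρ hP
  constructor
  · intro p hp
    obtain ⟨c, d, e, hc, a, b, e', hd⟩ := hρ.1 p hp
    obtain ⟨a', ha, b', hb, e''⟩ := (hP c).1 hc
    obtain ⟨e₁, e₂⟩ := eqv_opair.1 (e'.symm.trans e'')
    exact ⟨a, b, d, e.trans (e'.opair (.refl _ _)), e₁.mem_left.2 ha, e₂.mem_left.2 hb, hd⟩
  · intro a b d
    rw [hρ.2, hP]
    constructor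
    · rintro ⟨⟨a', ha, b', hb, e⟩, a'', b'', e', hd⟩
      obtain ⟨e₁, e₂⟩ := eqv_opair.1 e
      obtain ⟨e₃, e₄⟩ := eqv_opair.1 e'
      exact ⟨e₁.mem_left.2 ha, e₂.mem_left.2 hb, hd.congr e₃.symm e₄.symm⟩
    · rintro ⟨ha, hb, hd⟩
      exact ⟨⟨a, ha, b, hb, .refl _ _⟩, a, b, .refl _ _, hd⟩

theorem metricAt_of {ρ : Obj} (hE : ∀ᶠ y in 𝓝 x, ∀ a, Mem y a E → RealAt y a)
    (hρ : ∀ᶠ y in 𝓝 x,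
      (∀ p, Mem y p ρ → ∃ a b d, Eqv y p (.opair (.opair a b) d) ∧ Mem y a E ∧ Mem y b E ∧
        DistSet y a b d) ∧
      ∀ a b d, Mem y (.opair (.opair a b) d) ρ ↔ Mem y a E ∧ Mem y b E ∧ DistSet y a b d) :
    MetricAt x E ρ := by
  refine metricAt_iff.2 ⟨⟨?_, ?_⟩, ?_, ?_⟩
  · filter_upwards [hρ, hE] with y hρ hE p hp
    obtain ⟨a, b, d, e, ha, hb, hd⟩ := hρ.1 p hp
    exact ⟨_, d, ⟨a, ha, b, hb, .refl _ _⟩, hd.realAt (hE a ha) (hE b hb), e⟩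
  · filter_upwards [hρ.eventually_nhds] with y hρ c ⟨a, ha, b, hb, e⟩
    obtain ⟨d, hd⟩ := exists_distSet y a b
    refine ⟨d, ((e.opair (.refl _ _)).mem_left).2 ((hρ.self_of_nhds.2 a b d).2 ⟨ha, hb, hd⟩), ?_⟩
    filter_upwards [hρ, e.eventually, hd.eventually] with z hρ e hd d' hd'
    exact ((hρ.2 a b d').1 ((e.opair (.refl _ _)).mem_left.1 hd')).2.2.unique hd
  · filter_upwards [hρ, hE.eventually_nhds] with y hρ hE a b d hd
    obtain ⟨ha, hb, hd⟩ := (hρ.2 a b d).1 hd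
    have ha' := hE.self_of_nhds a ha
    have hb' := hE.self_of_nhds b hb
    refine ⟨?_, ?_, (hρ.2 b a d).2 ⟨hb, ha, hd.symm⟩⟩
    · filter_upwards [hd.eventually, ha'.eventually, hb'.eventually] with z hd ha hb h
      exact lt_irrefl _ (((hd.up_iff ha hb).1 ⟨_, code_zero.2 rfl, h⟩).pos ha)
    · filter_upwards [hd.eventually, ha'.eventually, hb'.eventually] with z hd ha hb
      constructor
      · intro h
        refine eqv_of_dist ha hb ?_
        filter_upwards [h, hd.eventually, ha.eventually, hb.eventually] with z' h hd ha hb r hr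
        obtain ⟨q, hq⟩ := exists_code r
        exact (hd.up_iff ha hb).1 ⟨q, hq, h q ⟨0, r, code_zero.2 rfl, hq, hr⟩⟩
      · intro e
        filter_upwards [hd.eventually, ha.eventually, hb.eventually, e.eventually]
          with z' hd ha hb e q ⟨_, r, h0, hq, hr⟩
        rw [code_zero] at h0
        subst h0
        rw [hd.self_of_nhds, aDist_iff ha hb hq]
        exact e.dist (ha.dist_self hr)
  · filter_upwards [hρ, hE] with y hρ hE a b c d d' d'' h h' h'' p hp q hq r hr
    obtain ⟨ha, hb, hd⟩ := (hρ.2 _ _ _).1 h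
    obtain ⟨-, hc, hd'⟩ := (hρ.2 _ _ _).1 h'
    obtain ⟨-, -, hd''⟩ := (hρ.2 _ _ _).1 h''
    obtain ⟨k, l, hk, hl, hkl⟩ := hr.code
    have ha := hE a ha
    have hb := hE b hb
    have hc := hE c hc
    rw [hd''.self_of_nhds, aDist_iff ha hc hkl]
    exact ((hd.up_iff ha hb).1 ⟨p, hk, hp⟩).triangle ((hd'.up_iff hb hc).1 ⟨q, hl, hq⟩) ha hb hc

end

end BISH

namespace BISH
open Filter Topology

/-! ### From the anti-Specker property to positivity -/

section

variable {x : Point} {a b u E m f w : Obj} {k l r : K x}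

/-- The first components of the elements of f can be collected into a set D containing [0,1], from
which [0,1] is separated. -/
theorem FunAt.exists_unit_interval (hf : FunAt x f) :
    ∃ I, ∀ᶠ y in 𝓝 x, ∀ a, Mem y a I ↔ UnitAt y a := by
  have key : ∀ y p a, Sat y (Ex fun b => .var 1 =ₛ opair (.var 2) b) ![p, a] ↔
      ∃ b, Eqv y p (.opair a b) := by
    intro y p a
    simp
  obtain ⟨D, hD⟩ := collection (x := x) (a := f) (v := ![])
      (Ex fun b => .var 1 =ₛ opair (.var 2) b) (by
    filter_upwards [hf.1] with y h p hp
    obtain ⟨a, b, -, -, e⟩ := h p hp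
    exact ⟨a, (key _ _ _).2 ⟨b, e⟩⟩)
  simp only [key] at hD
  obtain ⟨I, hI⟩ := BISH.exists_unit_interval (x := x) D
  refine ⟨I, ?_⟩
  filter_upwards [hI, hD, hf.2] with y hI hD h a
  rw [hI, and_iff_right_iff_imp]
  intro ha
  obtain ⟨b, hb, -⟩ := h a ha
  obtain ⟨a', ha', b', e⟩ := hD.1 _ hb
  exact (eqv_opair.1 e).1.mem_left.2 ha'

theorem FunAt.unitAt (hf : FunAt x f) (h : Mem x (.opair a u) f) : UnitAt x a ∧ RealAt x u := by
  obtain ⟨b, c, hb, hc, e⟩ := hf.1.self_of_nhds _ h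
  obtain ⟨e₁, e₂⟩ := eqv_opair.1 e
  exact ⟨e₁.symm.unitAt hb, e₂.symm.realAt hc⟩

theorem FunAt.eventually (hf : FunAt x f) : ∀ᶠ y in 𝓝 x, FunAt y f := by
  filter_upwards [hf.1.eventually_nhds, hf.2.eventually_nhds] with y h₁ h₂
  exact ⟨h₁, h₂⟩

/-- There is the real number `2`. -/
theorem exists_two (x : Point) : ∃ w, ∀ᶠ y in 𝓝 x, RealAt y w ∧ Lo y w 2 := by
  obtain ⟨w, hw⟩ := exists_cut (x := x) (RatLt (frac (succ (succ .empty)) .empty .empty) (.var 0))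
    (bounded_RatLt _ _) ![]
  have hw' : ∀ᶠ y in 𝓝 x, ∀ q k, Code y q k → (Mem y q w ↔ 2 < k) := by
    filter_upwards [hw] with y hw q k hq
    have h2 : Code y (.frac (.succ (.succ .empty)) .empty .empty) 2 := by
      convert code_frac (succ_mem_omega (succ_mem_omega zero_mem_omega)) zero_mem_omega
        zero_mem_omega using 1
      rw [nat_succ (succ_mem_omega zero_mem_omega), nat_succ zero_mem_omega, nat_empty]
      norm_num
    rw [hw, and_iff_right ⟨k, hq⟩]
    simp [rLt_iff h2 hq]
  have hup : ∀ᶠ y in 𝓝 x, ∀ k, Up y w k ↔ 2 < k := by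
    filter_upwards [hw'] with y hw k
    constructor
    · rintro ⟨q, hq, h⟩
      exact (hw q k hq).1 h
    · intro h
      obtain ⟨q, hq⟩ := exists_code k
      exact ⟨q, hq, (hw q k hq).2 h⟩
  refine ⟨w, ?_⟩
  filter_upwards [hw.eventually_nhds, hw'.eventually_nhds, hup.eventually_nhds] with y hw hw' hup
  have h2 : Germ y fun z => 2 := by simpa [one_add_one_eq_two] using Germ.one.add (.one (x := y))
  have hlo : Lo y w 2 := lo_of_eventually h2 (hup.mono fun z h h' => lt_irrefl _ ((h 2).1 h'))
  refine ⟨realAt_of (hw.mono fun z h q hq => ((h q).1 hq).1)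
    ⟨3, (hup.self_of_nhds 3).2 (by norm_num)⟩ ⟨2, hlo⟩ ?_ ?_ ?_, hlo⟩
  · filter_upwards [hup] with z hup k hk
    rw [hup] at hk
    obtain ⟨l, h₁, h₂⟩ := exists_between hk
    exact ⟨l, h₂, (hup l).2 h₁⟩
  · filter_upwards [hup, hw'] with z hup hw q k l hk hkl hq
    rw [hw q l hq]
    exact ((hup k).1 hk).trans hkl
  · filter_upwards [hup.eventually_nhds] with z hup E l hE hl
    rcases lt_or_ge 2 l with h | h
    · exact .inr ((hup.self_of_nhds l).2 h)
    · left
      have h2 : Germ z fun z => 2 := by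
        simpa [one_add_one_eq_two] using Germ.one.add (.one (x := z))
      filter_upwards [hup, hE.lt h2 (hl.trans_le h)] with z' hup h h'
      exact lt_asymm h ((hup _).1 h')

theorem not_unitAt_of_lo (hw : RealAt x w) (h : Lo x w 2) : ¬ UnitAt x w := fun hu =>
  absurd (h.lt_of_up (hu.up (k := 2) (by norm_num)) hw) (lt_irrefl _)

theorem not_dist_of_lo (hw : RealAt x w) (h : Lo x w 2) (ha : UnitAt x a) (hr : r ≤ 1) :
    ¬ Dist x a w r := by
  intro hd
  -- Lowering r to some r' < 1 makes the estimate strict: 2 ≤ w < k + r' gives k > 2 - r' > 1,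
  -- whereas k ≤ a ≤ 1.
  obtain ⟨r', hr', k, h₁, -, -, h₂⟩ := (hd.mono ha.real hw hr).exists_lt ha.real hw
  have := h.lt_of_up h₂ hw
  linarith [h₁.lt_of_up (ha.up (k := 2 - r') (by linarith)) ha.real]

/-- Either `f t < 1 / (k + 1)`, or `t = w` and `1 / (k + 2) ≤ m`. -/
def Choose (x : Point) (f m w k t : Obj) : Prop :=
  (∃ u, Mem x (.opair t u) f ∧ Mem x (.frac (.succ .empty) .empty k) u) ∨
    Eqv x t w ∧ ∀ᶠ y in 𝓝 x, ¬ Mem y (.frac (.succ .empty) .empty k.succ) m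

/-- Locatedness of m with respect to 1 / (j + 2) < 1 / (j + 1): either the first is at most m, or m
is below the second and so is some value of f. -/
theorem exists_choose (hm : InfAt x f m) (w : Obj) {j : Obj} (hj : Mem x j .omega) :
    ∃ t, Choose x f m w j t := by
  have h : 1 / (nat x j.succ + 1) < 1 / (nat x j + 1) := by
    rw [one_div_lt_one_div nat_add_one_pos nat_add_one_pos, nat_succ hj]
    linarith
  rcases hm.1.located h with h | h
  · exact ⟨w, .inr ⟨.refl _ _, (hm.1.lo_iff (code_one_div (succ_mem_omega hj))).1 h⟩⟩
  · obtain ⟨a, u, hau, hu⟩ := hm.2.2.self_of_nhds _ ((hm.1.up_iff (code_one_div hj)).1 h)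
    exact ⟨a, .inl ⟨u, hau, hu⟩⟩

theorem InfAt.eventually (h : InfAt x f m) : ∀ᶠ y in 𝓝 x, InfAt y f m := by
  filter_upwards [h.1.eventually, h.2.1.eventually_nhds, h.2.2.eventually_nhds] with y h₁ h₂ h₃
  exact ⟨h₁, h₂, h₃⟩

theorem exists_choose_seq (hm : InfAt x f m) (w : Obj) : ∃ s, ∀ᶠ y in 𝓝 x,
    (∀ p, Mem y p s → ∃ k t, Eqv y p (.opair k t) ∧ Mem y k .omega ∧ Choose y f m w k t) ∧
    (∀ k t, Mem y (.opair k t) s → Choose y f m w k t) ∧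
    ∀ k, Mem y k .omega → ∃ t, Mem y (.opair k t) s ∧
      ∀ᶠ z in 𝓝 y, ∀ t', Mem z (.opair k t') s → Eqv z t' t := by
  have key : ∀ y k t, Sat y ((Ex fun u => opair (.var 2) u ∈ₛ .var 3 ⋏
      frac (succ .empty) .empty (.var 1) ∈ₛ u) ⋎ (.var 1 =ₛ .var 4 ⋏
      neg (frac (succ .empty) .empty (succ (.var 0)) ∈ₛ .var 3))) ![k, t, f, m, w] ↔
      Choose y f m w k t := by
    intro y k t
    simp [Choose]
  obtain ⟨s, hs⟩ := countable_choice (x := x) (v := ![f, m, w]) _ (by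
    filter_upwards [hm.eventually] with y hm j hj
    obtain ⟨t, ht⟩ := exists_choose hm w hj
    exact ⟨t, (key _ _ _).2 ht⟩)
  simp only [key] at hs
  exact ⟨s, hs⟩

/-- The chosen sequence takes the value 2 only where a positive lower bound for m has been found.
Elsewhere its terms have ever smaller values of f, so they cannot accumulate at a point, where f is
positive and continuous. -/
theorem posAt_of_sat_ASL (hA : Sat x ASL ![]) (hf : FunAt x f) (hc : ContAt x f)
    (hpos : ∀ᶠ y in 𝓝 x, ∀ a u, Mem y (.opair a u) f → PosAt y u) (hm : InfAt x f m) :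
    PosAt x m := by
  obtain ⟨I, hI⟩ := hf.exists_unit_interval
  obtain ⟨w, hw⟩ := exists_two x
  let E : Obj := .union (.upair I (.upair w w))
  have hE : ∀ᶠ y in 𝓝 x, ∀ a, Mem y a E ↔ UnitAt y a ∨ Eqv y a w := by
    filter_upwards [hI] with y hI a
    rw [mem_union]
    simp only [mem_upair]
    constructor
    · rintro ⟨d, h | h, ha⟩
      · exact .inl ((hI a).1 (h.mem_right.1 ha))
      · exact .inr ((or_self _).mp (mem_upair.1 (h.mem_right.1 ha)))
    · rintro (h | h)
      · exact ⟨I, .inl (.refl _ _), (hI a).2 h⟩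
      · exact ⟨_, .inr (.refl _ _), mem_upair.2 (.inl h)⟩
  obtain ⟨ρ, hρ⟩ := exists_metric x E
  have hmet : MetricAt x E ρ := by
    refine metricAt_of ?_ hρ
    filter_upwards [hE, hw] with y hE hw a ha
    rcases (hE a).1 ha with h | h
    · exact h.real
    · exact h.symm.realAt hw.1
  have hsub : SubspaceAt x E ρ := by
    constructor
    · filter_upwards [hE] with y hE a ha
      exact (hE a).2 (.inl ha)
    · filter_upwards [hρ] with y hρ a b d ha hb hd q hq
      filter_upwards [((hρ.2 a b d).1 hd).2.2] with z h
      exact h q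
  have hdist : ∀ᶠ y in 𝓝 x, ∀ q k, Code y q k → k ≤ 1 → ∀ a b d, UnitAt y a → Eqv y b w →
      Mem y (.opair (.opair a b) d) ρ → ¬ Mem y q d := by
    filter_upwards [hρ, hw] with y hρ hw q k hq hk a b d ha e hd hqd
    have h := ((hρ.2 a b d).1 hd).2.2.congr (.refl _ _) e
    exact not_dist_of_lo hw.1 hw.2 ha hk ((h.up_iff ha.real hw.1).1 ⟨q, hq, hqd⟩)
  have hext : ExtraAt x E ρ w := by
    refine ⟨(hE.self_of_nhds w).2 (.inr (.refl _ _)), _, ⟨0, 1, code_zero.2 rfl, code_one.2 rfl,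
      zero_lt_one⟩, ?_⟩
    filter_upwards [hdist, hρ] with y h hρ a d ha hd
    have hd' := (hρ.2 w a d).1 hd
    exact h _ 1 (code_one.2 rfl) le_rfl a w d ha (.refl _ _)
      ((hρ.2 a w d).2 ⟨hd'.2.1, hd'.1, hd'.2.2.symm⟩)
  obtain ⟨s, hs⟩ := exists_choose_seq hm w
  have hseq : SeqAt x w s := by
    constructor
    · filter_upwards [hs, hf.eventually] with y hs hf p hp
      obtain ⟨k, t, e, hk, ht⟩ := hs.1 p hp
      exact ⟨k, t, hk, ht.imp (fun ⟨u, hu, _⟩ => (hf.unitAt hu).1) fun h => h.1, e⟩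
    · filter_upwards [hs] with y hs
      exact hs.2.2
  have haway : ∀ᶠ y in 𝓝 x, ∀ a, UnitAt y a → AwayAt y ρ s a := by
    filter_upwards [hf.eventually.eventually_nhds, hc, hpos, hs.eventually_nhds,
      hρ.eventually_nhds, hdist.eventually_nhds] with y hf hc hpos hs hρ hdist a ha
    obtain ⟨u, hau, -⟩ := hf.self_of_nhds.2.self_of_nhds a ha
    obtain ⟨k, hk, hlo⟩ := posAt_iff.1 (hpos a u hau)
    -- As k ≤ f(a), the values of f near a are at least k / 2. From N on this excludes terms in
    -- [0,1] near a, whose values are below 1 / (N + 1) < k / 2.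
    obtain ⟨F, hF, hFx⟩ := exists_germ (x := y) (k / 2)
    obtain ⟨ε, hε⟩ := hF.exists_code
    obtain ⟨δ, ⟨_, e, h0, hδ, hδ₀⟩, hc⟩ := hc a ha ε ⟨0, _, code_zero.2 rfl, hε.self_of_nhds,
      by rw [hFx]; linarith⟩
    rw [code_zero] at h0
    subst h0
    -- The bound e, from continuity, takes care of the terms in [0,1]; the bound 1 takes care of the
    -- terms equal to w, which are at least 1 away from a.
    obtain ⟨D, hD, hDx⟩ := exists_germ (min e 1)
    obtain ⟨δ', hδ'⟩ := hD.exists_code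
    obtain ⟨N, hN, hNk⟩ := exists_one_div_lt (half_pos hk)
    have hu := (hf.self_of_nhds.unitAt hau).2
    refine ⟨N, hN, δ', ⟨0, _, code_zero.2 rfl, hδ'.self_of_nhds, hDx ▸ lt_min hδ₀ one_pos⟩, ?_⟩
    have hlo' : ∀ᶠ z in 𝓝 y, Lo z u (F z + F z) :=
      Lo.eventually (E := fun z => F z + F z) (by rwa [hFx, add_halves]) hu (hF.add hF)
    filter_upwards [hf, hs, hρ, hdist, hc, hlo', hε, hδ', hδ.eventually, hN.eventually,
      ha.eventually, hau.eventually, (Germ.one_div hN).lt hF (hFx ▸ hNk),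
      hD.le .one (hDx ▸ min_le_right _ _), hD.le hδ.germ
          (by rw [hδ.rat_eq, hDx]; exact min_le_left _ _)]
      with z hf hs hρ hdist hc hlo hε hδ' hδ hN ha hau hNF hD₁ hDδ j hj hNj t d hjt hd hmem
    rcases hs.2.1 j t hjt with ⟨u', htu, hju⟩ | ⟨e, -⟩
    · obtain ⟨ht, hu'⟩ := hf.unitAt htu
      have hu := (hf.unitAt hau).2
      have hat := (((hρ.2 a t d).1 hd).2.2.up_iff ha.real ht.real).1 ⟨δ', hδ', hmem⟩
      have h := hc t ht ((aDist_iff ha.real ht.real hδ).2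
          (hat.mono ha.real ht.real hDδ)) u u' hau htu
      rw [aDist_iff hu hu' hε] at h
      have h₁ := (hlo.of_dist h hu hu').lt_of_up ⟨_, code_one_div hj, hju⟩ hu'
      have h₂ : 1 / (nat z j + 1) ≤ 1 / (nat z N + 1) := by
        rw [one_div_le_one_div nat_add_one_pos nat_add_one_pos]
        linarith [(nat_le_nat hN hj).2 hNj]
      linarith
    · exact hdist δ' _ hδ' hD₁ a t d ha e hd hmem
  obtain ⟨j, hj, hjw⟩ := (sat_ASL.1 hA).self_of_nhds E ρ w hmet hsub hext s hseq haway
  -- The term w is not in the domain of f, so it was chosen because 1 / (j + 2) ≤ m.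
  rcases hs.self_of_nhds.2.1 j w hjw with ⟨u, hu, -⟩ | ⟨-, h⟩
  · have hw := hw.self_of_nhds
    exact (not_unitAt_of_lo hw.1 hw.2 (hf.unitAt hu).1).elim
  · exact posAt_iff.2 ⟨_, one_div_pos.2 nat_add_one_pos, _, code_one_div (succ_mem_omega hj), h⟩

theorem sat_POSp_of_sat_ASL (hA : Sat x ASL ![]) : Sat x POSp ![] := by
  rw [sat_POSp]
  filter_upwards [hA.eventually] with y hA f hf hc hpos m hm
  exact posAt_of_sat_ASL hA hf hc hpos hm

end

end BISH

theorem mainTheorem4 : BISH.Provable (BISH.iff BISH.POSp BISH.ASL) := by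
  refine BISH.provable_of_sat fun x => ?_
  rw [BISH.sat_iff]
  exact .of_forall fun y => ⟨BISH.sat_ASL_of_sat_POSp, BISH.sat_POSp_of_sat_ASL⟩
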